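/- All vector spaces are over $\mathbb{Q}$ and all intervals are intervals of rational numbers. Let $I$ be a countable set and let $A=(a_{ij})_{i,j\in I}$ be a Borcherds--Cartan matrix: an integer matrix with $a_{ii}=2$ ($i$ is called real) or $a_{ii}\le 0$ ($i$ is called imaginary), with $a_{ij}\le 0$ for $i\ne j$, and with $a_{ij}=0$ if and only if $a_{ji}=0$. Let $\mathfrak h$ be a vector space with simple coroots $\alpha_i^\vee\in\mathfrak h$ and linearly independent simple roots $\alpha_i\in\mathfrak h^*$ such that $\alpha_i^\vee(\alpha_j)=a_{ij}$ (for example a Cartan subalgebra of the generalized Kac--Moody algebra of $A$). Put $\Pi=\{\alpha_i\}_{i\in I}$, $P=\{\mu\in\mathfrak h^*\mid\alpha_i^\vee(\mu)\in\mathbb Z\ \forall i\in I\}$, $P^+=\{\mu\in P\mid \alpha_i^\vee(\mu)\ge 0\ \forall i\in I\}$, $Q^+=\bigoplus_i\mathbb N\alpha_i$ and $r_i(x)=x-\alpha_i^\vee(x)\alpha_i$ on $\mathfrak h^*$. Let $T$ be the monoid generated by all $r_i$, $i\in I$, and let $W$ be the group generated by the $r_i$ with $i$ real; it acts on $\mathfrak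 h$ through $r_i(h)=h-h(\alpha_i)\alpha_i^\vee$. For $\beta=w\alpha_i\in W\Pi$ put $\beta^\vee=w\alpha_i^\vee$ and $r_\beta(x)=x-\beta^\vee(x)\beta$; call $\beta$ positive if $\beta\in Q^+$, real if $\beta^\vee(\beta)=2$, and imaginary if $\beta^\vee(\beta)\le0$. Fix $\lambda\in P^+$. For $\mu,\nu\in T\lambda$ write $\mu>\nu$ if there are $s\ge1$, weights $\mu=\lambda_0,\dots,\lambda_s=\nu$ and positive $\beta_1,\dots,\beta_s\in W\Pi$ with $\lambda_{i-1}=r_{\beta_i}\lambda_i$ and $\beta_i^\vee(\lambda_i)>0$ for all $i$; let $\operatorname{dist}(\mu,\nu)$ be the maximal such $s$. Write $\nu\stackrel{\beta}{\leftarrow}\mu$ if $\mu=r_\beta\nu>\nu$ and $\operatorname{dist}(\mu,\nu)=1$. For a rational $0<a\le1$, an $a$-chain for $(\mu,\nu)$ is a sequence $\nu=\nu_s\stackrel{\beta_s}{\leftarrow}\cdots\stackrel{\beta_1}{\leftarrow}\nu_0=\mu$ in $T\lambda$, $s\ge1$, such that $a\beta_i^\vee(\nu_i)$ is a positive integer if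 $\beta_i$ is real and equals $1$ if $\beta_i$ is imaginary. Let $\mathbb P_\lambda$ be the set of generalized Lakshmibai--Seshadri paths of shape $\lambda$, that is, of the maps $\pi:[0,1]\to\mathfrak h^*$ of the form $$\pi(t)=\sum_{i=1}^{j-1}(a_i-a_{i-1})\lambda_i+(t-a_{j-1})\lambda_j\qquad(a_{j-1}\le t\le a_j,\ 1\le j\le s),$$ where $s\ge1$, $\lambda_1>\dots>\lambda_s$ lie in $T\lambda$, $0=a_0<a_1<\dots<a_s=1$ are rational, there is an $a_i$-chain for $(\lambda_i,\lambda_{i+1})$ for $1\le i\le s-1$, and, if $\lambda_s\neq\lambda$, there is a $1$-chain for $(\lambda_s,\lambda)$. Let $\pi_\lambda(t)=t\lambda$. For a path $\pi$ put $h_i(t)=\alpha_i^\vee(\pi(t))$ and let $m_i$ be the least integer among the values of $h_i$. For a map $g$, an element $c$ and $p\le q$ in $[0,1]$ let $B(g,c,p,q)\pi$ be the path equal to $\pi(t)$ for $t\le p$, to $\pi(p)+g(\pi(t)-\pi(p))$ for $p\le t\le q$, and to $\pi(t)+c$ for $t\ge q$. * $f_i$ ($i\in I$): let $p$ be maximal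 with $h_i(p)=m_i$. If $p=1$, put $f_i\pi=0$. Otherwise let $q\ge p$ be minimal with $h_i(q)=m_i+1$, and put $f_i\pi=B(r_i,-\alpha_i,p,q)\pi$. * $e_i$ ($i$ real): let $q$ be minimal with $h_i(q)=m_i$. If $q=0$, put $e_i\pi=0$. Otherwise let $p\le q$ be maximal with $h_i(p)=m_i+1$, and put $e_i\pi=B(r_i,\alpha_i,p,q)\pi$. * $e_i$ ($i$ imaginary): let $p$ be maximal with $h_i(p)=m_i$. If $p<1$, let $q\ge p$ be minimal with $h_i(q)=m_i+1-a_{ii}$. If $p=1$, or there is no such $q$, or $h_i(t)\le m_i-a_{ii}$ for some $t\ge q$, put $e_i\pi=0$. Otherwise put $e_i\pi=B(r_i^{-1},\alpha_i,p,q)\pi$, where $r_i^{-1}(x)=x+\frac{1}{1-a_{ii}}\alpha_i^\vee(x)\alpha_i$. On $\mathbb P_\lambda$ the operators $e_i$ are modified by setting $e_i\pi=0$ whenever $e_i\pi\notin\mathbb P_\lambda$. Put $\operatorname{wt}\pi=\pi(1)$, $\varepsilon_i(\pi)=-m_i$ for $i$ real, $\varepsilon_i(\pi)=0$ for $i$ imaginary,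 and $\varphi_i(\pi)=\varepsilon_i(\pi)+\alpha_i^\vee(\operatorname{wt}\pi)$. **Proposition.** The path $\pi_\lambda$ lies in $\mathbb P_\lambda$, and for $\pi\in\mathbb P_\lambda$ one has $e_i\pi=0$ for all $i\in I$ if and only if $\pi=\pi_\lambda$. Moreover $\mathbb P_\lambda=\mathcal F\pi_\lambda$, where $\mathcal F$ is the monoid generated by the $f_i$, $i\in I$ (so $\mathcal F\pi_\lambda$ is the set of the nonzero elements obtained from $\pi_\lambda$ by finitely many $f_i$); in particular $\mathbb P_\lambda$ is stable under the $f_i$. With these operations $\mathbb P_\lambda$ is a highest weight crystal of highest weight $\lambda$ generated by $\pi_\lambda$. Here a crystal is a set $B$ with maps $\operatorname{wt}:B\to P$, $\varepsilon_i,\varphi_i:B\to\mathbb Z\cup\{-\infty\}$ and $e_i,f_i:B\to B\cup\{0\}$ such that for all $i\in I$ and $b,b'\in B$: $\varphi_i(b)=\varepsilon_i(b)+\alpha_i^\vee(\operatorname{wt}b)$; if $e_ib\ne0$, then $\operatorname{wt}(e_ib)=\operatorname{wt}b+\alpha_i$, and $\varepsilon_i(e_ib)$ is $\varepsilon_i(b)-1$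 for $i$ real and $\varepsilon_i(b)$ for $i$ imaginary; $e_ib=b'$ if and only if $f_ib'=b$; if $\varphi_i(b)=-\infty$, then $e_ib=f_ib=0$; and for $i$ imaginary, $\varepsilon_i(b)\in-\mathbb N\cup\{-\infty\}$ and $\varphi_i(b)\in\mathbb N\cup\{-\infty\}$. It is a highest weight crystal of highest weight $\lambda$ generated by $b_\lambda\in B$ if $\operatorname{wt}b_\lambda=\lambda$ and $B=\mathcal Fb_\lambda$. -/

import Mathlib

open Module

namespace BorcherdsPath

/-- Borcherds-Cartan matrices. An index `i` is real if `A i i = 2`, and imaginary otherwise. -/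
structure IsBorcherdsCartan {I : Type*} (A : Matrix I I ℤ) : Prop where
  diag : ∀ i, A i i = 2 ∨ A i i ≤ 0
  off_diag : ∀ i j, i ≠ j → A i j ≤ 0
  zero_iff : ∀ i j, A i j = 0 ↔ A j i = 0

/-- Simple roots `α_i ∈ 𝔥*` (linearly independent) and simple coroots `α_i^∨ ∈ 𝔥` with
`α_i^∨(α_j) = a_ij`, for a rational vector space `𝔥`. -/
structure Realization {I : Type*} (A : Matrix I I ℤ) (𝔥 : Type*) [AddCommGroup 𝔥]
    [Module ℚ 𝔥] where
  root : I → Dual ℚ 𝔥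
  coroot : I → 𝔥
  root_coroot : ∀ i j, root j (coroot i) = (A i j : ℚ)
  linearIndependent_root : LinearIndependent ℚ root

/-- The rational unit interval. -/
abbrev UnitQ : Type := Set.Icc (0 : ℚ) 1

/-- Maps from the rational unit interval to `𝔥*`. -/
abbrev PathMap (𝔥 : Type*) [AddCommGroup 𝔥] [Module ℚ 𝔥] : Type _ := UnitQ → Dual ℚ 𝔥

/-- The set of elements obtained from `b` by applying finitely many of the operators `f i`
(`none` plays the role of the extra element `0`). -/
def generatedBy {I B : Type*} (f : I → B → Option B) (b : B) : Set B :=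
  {x | Relation.ReflTransGen (fun y z => ∃ i, f i y = some z) b x}

/-- The linear path `t ↦ t • lam`. -/
def straightPath {𝔥 : Type*} [AddCommGroup 𝔥] [Module ℚ 𝔥] (lam : Dual ℚ 𝔥) : PathMap 𝔥 :=
  fun t => (t : ℚ) • lam

namespace Realization

variable {I : Type*} {A : Matrix I I ℤ} {𝔥 : Type*} [AddCommGroup 𝔥] [Module ℚ 𝔥]
  (R : Realization A 𝔥)

/-! ### Weights, reflections and roots -/

/-- The weight lattice `P`. -/
def weights : Set (Dual ℚ 𝔥) := {x | ∀ i, ∃ n : ℤ, x (R.coroot i) = n}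

/-- The set `P^+`; both real and imaginary indices are taken into account. -/
def dominantWeights : Set (Dual ℚ 𝔥) := {x | x ∈ R.weights ∧ ∀ i, 0 ≤ x (R.coroot i)}

/-- `Q^+`, the set of sums of simple roots. -/
def posRootLattice : AddSubmonoid (Dual ℚ 𝔥) := AddSubmonoid.closure (Set.range R.root)

/-- `r_i x = x - α_i^∨(x) α_i` on `𝔥*`. -/
def r (i : I) : End ℚ (Dual ℚ 𝔥) :=
  preReflection (R.root i) (Dual.eval ℚ 𝔥 (R.coroot i))

/-- `r_i⁻¹ x = x + (1 / (1 - a_ii)) α_i^∨(x) α_i` on `𝔥*`, used for imaginary `i`. -/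
def rInv (i : I) (x : Dual ℚ 𝔥) : Dual ℚ 𝔥 :=
  x + (1 / (1 - (A i i : ℚ)) * x (R.coroot i)) • R.root i

/-- The monoid `T` generated by all the `r_i`. -/
def T : Submonoid (End ℚ (Dual ℚ 𝔥)) := Submonoid.closure (Set.range R.r)

/-- The orbit `T lam`. -/
def orbit (lam : Dual ℚ 𝔥) : Set (Dual ℚ 𝔥) := {μ | ∃ τ ∈ R.T, μ = τ lam}

/-- The Weyl group, generated by the `r_i` with `i` real, realized on `𝔥` by
`r_i h = h - h(α_i) α_i^∨`. Its action on `𝔥*` is the contragredient one,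
`w x = x ∘ w⁻¹`, that is `w.symm.dualMap`. -/
def weylGroup : Subgroup (𝔥 ≃ₗ[ℚ] 𝔥) :=
  Subgroup.closure
    {w | ∃ i, A i i = 2 ∧ ∀ x, w x = x - R.root i x • R.coroot i}

/-- `β ∈ WΠ` is a positive root and `βv` is its coroot: `β = w α_i`, `βv = w α_i^∨` and
`β ∈ Q^+`. (The element `βv` is determined by `β`.) -/
def IsPosRoot (β : Dual ℚ 𝔥) (βv : 𝔥) : Prop :=
  (∃ w ∈ R.weylGroup, ∃ i, β = w.symm.dualMap (R.root i) ∧ βv = w (R.coroot i)) ∧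
    β ∈ R.posRootLattice

/-! ### The order on an orbit and chains -/

/-- `μ = r_β ν` with `β` a positive root in `WΠ` and `β^∨(ν) > 0`. -/
def Step (β : Dual ℚ 𝔥) (βv : 𝔥) (μ ν : Dual ℚ 𝔥) : Prop :=
  R.IsPosRoot β βv ∧ μ = ν - ν βv • β ∧ 0 < ν βv

/-- `R.StepSeq s μ ν`: there are `μ = λ_0, λ_1, …, λ_s = ν`, with `s ≥ 1`, such that each
`(λ_{i-1}, λ_i)` is a step. -/
inductive StepSeq : ℕ → Dual ℚ 𝔥 → Dual ℚ 𝔥 → Prop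
  | single {β : Dual ℚ 𝔥} {βv : 𝔥} {μ ν : Dual ℚ 𝔥} (h : R.Step β βv μ ν) : StepSeq 1 μ ν
  | cons {s : ℕ} {β : Dual ℚ 𝔥} {βv : 𝔥} {μ κ ν : Dual ℚ 𝔥} (h : R.Step β βv μ κ)
      (t : StepSeq s κ ν) : StepSeq (s + 1) μ ν

/-- The relation `μ > ν`. -/
def Above (μ ν : Dual ℚ 𝔥) : Prop := ∃ s, R.StepSeq s μ ν

/-- The distance of `μ` and `ν`: the maximal length of a sequence of steps. -/
noncomputable def dist (μ ν : Dual ℚ 𝔥) : ℕ∞ := ⨆ (s : ℕ) (_ : R.StepSeq s μ ν), (s : ℕ∞)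

/-- The relation `ν ←β μ`: `μ = r_β ν > ν` and the distance of `μ` and `ν` is `1`. -/
def Covers (β : Dual ℚ 𝔥) (βv : 𝔥) (μ ν : Dual ℚ 𝔥) : Prop :=
  R.Step β βv μ ν ∧ R.dist μ ν = 1

/-- A link of an `a`-chain in `T lam`. The root `β` is real if `β^∨(β) = 2` and imaginary if
`β^∨(β) ≤ 0`. -/
def Link (lam : Dual ℚ 𝔥) (a : ℚ) (μ ν : Dual ℚ 𝔥) : Prop :=
  μ ∈ R.orbit lam ∧ ν ∈ R.orbit lam ∧ ∃ (β : Dual ℚ 𝔥) (βv : 𝔥), R.Covers β βv μ ν ∧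
    (β βv = 2 → ∃ n : ℕ, 0 < n ∧ a * ν βv = n) ∧ (β βv ≤ 0 → a * ν βv = 1)

/-- There is an `a`-chain `ν = ν_s ← ⋯ ← ν_0 = μ`, with `s ≥ 1`, in `T lam` for `(μ, ν)`. -/
def HasChain (lam : Dual ℚ 𝔥) (a : ℚ) : Dual ℚ 𝔥 → Dual ℚ 𝔥 → Prop :=
  Relation.TransGen (R.Link lam a)

/-! ### Generalized Lakshmibai-Seshadri paths -/

/-- The sequences `(l 1 > l 2 > ⋯ > l s ; 0 = a 0 < a 1 < ⋯ < a s = 1)` that define the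
generalized Lakshmibai-Seshadri paths of shape `lam`. Other values of `l` and `a` are
irrelevant. -/
structure IsGLSData (lam : Dual ℚ 𝔥) (s : ℕ) (l : ℕ → Dual ℚ 𝔥) (a : ℕ → ℚ) : Prop where
  one_le : 1 ≤ s
  a_zero : a 0 = 0
  a_last : a s = 1
  a_lt : ∀ i, i < s → a i < a (i + 1)
  mem_orbit : ∀ i, 1 ≤ i → i ≤ s → l i ∈ R.orbit lam
  above : ∀ i, 1 ≤ i → i < s → R.Above (l i) (l (i + 1))
  chain : ∀ i, 1 ≤ i → i < s → R.HasChain lam (a i) (l i) (l (i + 1))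
  chain_last : l s ≠ lam → R.HasChain lam 1 (l s) lam

/-- The set of generalized Lakshmibai-Seshadri paths of shape `lam`: the piecewise linear maps
with velocity `l j` on `[a (j - 1), a j]`. -/
def glsPaths (lam : Dual ℚ 𝔥) : Set (PathMap 𝔥) :=
  {π | ∃ (s : ℕ) (l : ℕ → Dual ℚ 𝔥) (a : ℕ → ℚ), R.IsGLSData lam s l a ∧
    ∀ j, 1 ≤ j → j ≤ s → ∀ t : UnitQ, a (j - 1) ≤ t → (t : ℚ) ≤ a j →
      π t = ∑ i ∈ Finset.Ico 1 j, (a i - a (i - 1)) • l i + ((t : ℚ) - a (j - 1)) • l j}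

/-! ### The root operators -/

/-- `h_i^π(t) = α_i^∨(π(t))`. -/
def ht (i : I) (π : PathMap 𝔥) (t : UnitQ) : ℚ := π t (R.coroot i)

/-- `m_i^π`, the least integer among the values of `h_i^π`. -/
noncomputable def minInt (i : I) (π : PathMap 𝔥) : ℤ := sInf {n : ℤ | ∃ t, R.ht i π t = n}

/-- The path which equals `π` up to the time `p`, is transformed by `g` between `p` and `q`, and
is shifted by `c` from `q` on. -/
def bend (g : Dual ℚ 𝔥 → Dual ℚ 𝔥) (c : Dual ℚ 𝔥) (p q : UnitQ) (π : PathMap 𝔥) : PathMap 𝔥 :=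
  fun t => if t ≤ p then π t else if t ≤ q then π p + g (π t - π p) else π t + c

/-- `f_i π = π'`, with `p = f_+^i(π)` and `q = f_-^i(π)`. -/
def FRel (i : I) (π π' : PathMap 𝔥) : Prop :=
  ∃ p q : UnitQ, IsGreatest {t | R.ht i π t = R.minInt i π} p ∧ p < 1 ∧
    IsLeast {t | p ≤ t ∧ R.ht i π t = R.minInt i π + 1} q ∧
    π' = bend (R.r i) (-R.root i) p q π

/-- `e_i π = π'` for real `i`, with `p = e_-^i(π)` and `q = e_+^i(π)`. -/
def ERealRel (i : I) (π π' : PathMap 𝔥) : Prop :=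
  ∃ p q : UnitQ, IsLeast {t | R.ht i π t = R.minInt i π} q ∧ 0 < q ∧
    IsGreatest {t | t ≤ q ∧ R.ht i π t = R.minInt i π + 1} p ∧
    π' = bend (R.r i) (R.root i) p q π

/-- `e_i π = π'` for imaginary `i`, with `p = e_-^i(π) = f_+^i(π)` and `q = e_+^i(π)`. -/
def EImRel (i : I) (π π' : PathMap 𝔥) : Prop :=
  ∃ p q : UnitQ, IsGreatest {t | R.ht i π t = R.minInt i π} p ∧ p < 1 ∧
    IsLeast {t | p ≤ t ∧ R.ht i π t = R.minInt i π + 1 - A i i} q ∧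
    (∀ t, q ≤ t → (R.minInt i π : ℚ) - A i i < R.ht i π t) ∧
    π' = bend (R.rInv i) (R.root i) p q π

/-- `e_i π = π'`. -/
def ERel (i : I) (π π' : PathMap 𝔥) : Prop :=
  (A i i = 2 ∧ R.ERealRel i π π') ∨ (A i i ≠ 2 ∧ R.EImRel i π π')

theorem FRel.unique {R : Realization A 𝔥} {i : I} {π π₁ π₂ : PathMap 𝔥} (h₁ : R.FRel i π π₁)
    (h₂ : R.FRel i π π₂) : π₁ = π₂ := by
  obtain ⟨p, q, hp, -, hq, rfl⟩ := h₁
  obtain ⟨p', q', hp', -, hq', rfl⟩ := h₂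
  obtain rfl := hp.unique hp'
  obtain rfl := hq.unique hq'
  rfl

theorem ERel.unique {R : Realization A 𝔥} {i : I} {π π₁ π₂ : PathMap 𝔥} (h₁ : R.ERel i π π₁)
    (h₂ : R.ERel i π π₂) : π₁ = π₂ := by
  rcases h₁ with ⟨hi, p, q, hq, -, hp, rfl⟩ | ⟨hi, p, q, hp, -, hq, -, rfl⟩ <;>
    rcases h₂ with ⟨hi', p', q', hq', -, hp', rfl⟩ | ⟨hi', p', q', hp', -, hq', -, rfl⟩
  · obtain rfl := hq.unique hq'
    obtain rfl := hp.unique hp'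
    rfl
  · exact absurd hi hi'
  · exact absurd hi' hi
  · obtain rfl := hp.unique hp'
    obtain rfl := hq.unique hq'
    rfl

open Classical in
/-- The operator `f_i` on paths; `none` stands for `0`. -/
noncomputable def f (i : I) (π : PathMap 𝔥) : Option (PathMap 𝔥) :=
  if h : ∃ π', R.FRel i π π' then some h.choose else none

open Classical in
/-- The operator `e_i` on paths; `none` stands for `0`. -/
noncomputable def e (i : I) (π : PathMap 𝔥) : Option (PathMap 𝔥) :=
  if h : ∃ π', R.ERel i π π' then some h.choose else none

theorem f_eq_some_iff {i : I} {π π' : PathMap 𝔥} : R.f i π = some π' ↔ R.FRel i π π' := by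
  unfold f
  split_ifs with h
  · exact ⟨fun H => Option.some.inj H ▸ h.choose_spec,
      fun H => congrArg some (h.choose_spec.unique H)⟩
  · exact ⟨fun H => by simp at H, fun H => (h ⟨_, H⟩).elim⟩

theorem e_eq_some_iff {i : I} {π π' : PathMap 𝔥} : R.e i π = some π' ↔ R.ERel i π π' := by
  unfold e
  split_ifs with h
  · exact ⟨fun H => Option.some.inj H ▸ h.choose_spec,
      fun H => congrArg some (h.choose_spec.unique H)⟩
  · exact ⟨fun H => by simp at H, fun H => (h ⟨_, H⟩).elim⟩

/-! ### Crystals -/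

/-- The operations of a crystal; `⊥` stands for `-∞` and `none` for `0`. -/
structure CrystalOps (R : Realization A 𝔥) (B : Type*) where
  wt : B → Dual ℚ 𝔥
  ε : I → B → WithBot ℤ
  φ : I → B → WithBot ℤ
  e : I → B → Option B
  f : I → B → Option B

/-- The axioms of a (generalized) crystal. -/
structure CrystalOps.IsCrystal {R : Realization A 𝔥} {B : Type*} (C : R.CrystalOps B) :
    Prop where
  wt_mem : ∀ b, C.wt b ∈ R.weights
  phi_eq : ∀ i b (n : ℤ), C.wt b (R.coroot i) = n → C.φ i b = C.ε i b + (n : WithBot ℤ)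
  wt_e : ∀ i b b', C.e i b = some b' → C.wt b' = C.wt b + R.root i
  eps_e_real : ∀ i b b', A i i = 2 → C.e i b = some b' → C.ε i b' + 1 = C.ε i b
  eps_e_im : ∀ i b b', A i i ≠ 2 → C.e i b = some b' → C.ε i b' = C.ε i b
  e_iff_f : ∀ i b b', C.e i b = some b' ↔ C.f i b' = some b
  phi_bot : ∀ i b, C.φ i b = ⊥ → C.e i b = none ∧ C.f i b = none
  eps_im : ∀ i b, A i i ≠ 2 → C.ε i b ≤ 0
  phi_im : ∀ i b, A i i ≠ 2 → C.φ i b = ⊥ ∨ 0 ≤ C.φ i b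

/-- `C` is a highest weight crystal of highest weight `μ`, generated by `b` under the `f_i`. -/
def CrystalOps.IsHighestWeight {R : Realization A 𝔥} {B : Type*} (C : R.CrystalOps B)
    (μ : Dual ℚ 𝔥) (b : B) : Prop :=
  C.IsCrystal ∧ C.wt b = μ ∧ generatedBy C.f b = Set.univ

open Classical in
/-- A path, viewed as an element of `X ∪ {0}`: it is replaced by `0` if it is not in `X`. -/
noncomputable def truncate (X : Set (PathMap 𝔥)) (o : Option (PathMap 𝔥)) : Option X :=
  o.bind fun π => if h : π ∈ X then some ⟨π, h⟩ else none

/-- The crystal operations on the set of generalized Lakshmibai-Seshadri paths of shape `lam`.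
The operators are set to `0` whenever the result leaves this set, `ε_i(π)` is `-m_i^π` for `i`
real and `0` for `i` imaginary, and `φ_i(π) = ε_i(π) + α_i^∨(π(1))`, where the floor is only used
to read the integer `α_i^∨(π(1))` as an element of `ℤ`. -/
noncomputable def glsCrystal (lam : Dual ℚ 𝔥) : R.CrystalOps (R.glsPaths lam) where
  wt π := π.1 1
  ε i π := ((if A i i = 2 then -R.minInt i π.1 else 0 : ℤ) : WithBot ℤ)
  φ i π := ((if A i i = 2 then -R.minInt i π.1 else 0 : ℤ) + ⌊R.ht i π.1 1⌋ : ℤ)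
  e i π := truncate (R.glsPaths lam) (R.e i π.1)
  f i π := truncate (R.glsPaths lam) (R.f i π.1)

end Realization

end BorcherdsPath

/-!
The proof has three layers: roots, the order on the orbit `T λ`, and paths.

*Roots.* The key fact about `WΠ` is that a real simple reflection `r_k`
permutes the positive elements of `WΠ` other than `α_k`, and that for a positive `β` the numbers `β(α_k^∨)` and
`α_k(β^∨)` have the same sign. Positive roots are generated here as an inductive predicate `PosPair` on
pairs (root, coroot): simple pairs, and reflections of such pairs that increase the height.
The fact is proved by induction on the height (`posPair_induction`). The induction step takes place in
the orbit of a pair under two real reflections, whose lowest element is antidominant or simple; the orbit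
is then given by alternating words no longer than the order `2, 3, 4, 6, ∞` of the product of the two
reflections. Consequently `PosPair` agrees with the positive roots in `WΠ` (`isPosRoot_iff`).

*Order.* The lifting property `reflTransGen_flip` shows that every `μ ∈ T λ` satisfies `μ ≥ λ`, hence is
nonnegative on the imaginary simple coroots. A pair of weights at distance `1` (a cover) on which
`α_i^∨` changes sign, `i` real, is the reflection `r_i` (`Cover.eq_simplePair`); if the sign does not
change, then `r_i` maps the cover to a cover (`Cover.r`). For `i` imaginary `r_i` preserves the covers
on which `α_i^∨` is constant (`Cover.r_im`). A cover that starts at a weight which is nonnegative on the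
real simple coroots comes from an imaginary simple root (`Cover.exists_imaginary`). All these statements
pass to chains.

*Paths.* A path is described by weak data (`PathData`): consecutive velocities may coincide, so that break
points may be inserted, and `λ` is added as a last velocity. Along a chain for the parameter `a`, the
number `a α_i^∨(v)` changes by an integer. Hence for real `i` the local minima of `h_i` are integers, and
for imaginary `i` the function `h_i` is nondecreasing and concave. These shapes imply that `e_i` and `f_i`
are inverse to each other (`eRel_iff_fRel`), and the statements on chains imply that `f_i`, and `e_i` for
real `i`, preserve the set of paths (`FRel.mem_glsPaths`, `PathData.e_mem`).

Finally, a path different from `π_λ` can be raised by some `e_i` within the set (`exists_eRel_mem`): if the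
initial velocity is negative on a real simple coroot, by the corresponding `e_i`, and otherwise by
the imaginary `e_i` that undoes the first link of the first nontrivial chain. Since the weights lie in
`λ - Q^+`, the height of `λ - π(1)` is a natural number that drops by one at each such step, and
every path is reached from `π_λ` by operators `f_i`.
-/

namespace BorcherdsPath

namespace Realization

variable {I : Type*} {A : Matrix I I ℤ} {𝔥 : Type*} [AddCommGroup 𝔥] [Module ℚ 𝔥]
  (R : Realization A 𝔥)

/-! ### Coordinates along the simple roots -/

theorem r_apply (i : I) (x : Dual ℚ 𝔥) : R.r i x = x - x (R.coroot i) • R.root i := by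
  simp [r, preReflection_apply]

theorem exists_coord : ∃ φ : Dual ℚ 𝔥 →ₗ[ℚ] (I →₀ ℚ),
    φ ∘ₗ Finsupp.linearCombination ℚ R.root = LinearMap.id :=
  (Finsupp.linearCombination ℚ R.root).exists_leftInverse_of_injective
    (LinearMap.ker_eq_bot.2 R.linearIndependent_root)

/-- A linear map `𝔥* → ℚ^(I)` that reads off the coefficients of linear combinations of the
simple roots (its values outside their span are arbitrary). -/
noncomputable def coord : Dual ℚ 𝔥 →ₗ[ℚ] (I →₀ ℚ) := R.exists_coord.choose

theorem coord_linearCombination (c : I →₀ ℚ) :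
    R.coord (Finsupp.linearCombination ℚ R.root c) = c :=
  LinearMap.congr_fun R.exists_coord.choose_spec c

theorem coord_root (i : I) : R.coord (R.root i) = Finsupp.single i 1 := by
  simpa using R.coord_linearCombination (Finsupp.single i 1)

/-- The height: the sum of the coefficients of a linear combination of simple roots. -/
noncomputable def height : Dual ℚ 𝔥 →ₗ[ℚ] ℚ :=
  Finsupp.linearCombination ℚ (fun _ : I => (1 : ℚ)) ∘ₗ R.coord

theorem height_root (i : I) : R.height (R.root i) = 1 := by
  simp [height, coord_root]

theorem height_eq (x : Dual ℚ 𝔥) : R.height x = (R.coord x).sum fun _ q => q := by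
  simp [height, Finsupp.linearCombination_apply]

/-- The cone of the linear combinations of simple roots with nonnegative rational coefficients. -/
def posCone : AddSubmonoid (Dual ℚ 𝔥) where
  carrier := {x | Finsupp.linearCombination ℚ R.root (R.coord x) = x ∧ ∀ i, 0 ≤ R.coord x i}
  zero_mem' := by simp
  add_mem' := by
    rintro x y ⟨hx, hx'⟩ ⟨hy, hy'⟩
    refine ⟨by simp [hx, hy], fun i => ?_⟩
    simpa using add_nonneg (hx' i) (hy' i)

variable {R}

theorem smul_mem_posCone {q : ℚ} (hq : 0 ≤ q) {x : Dual ℚ 𝔥} (hx : x ∈ R.posCone) :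
    q • x ∈ R.posCone :=
  ⟨by simp [hx.1], fun i => by simpa using mul_nonneg hq (hx.2 i)⟩

variable (R) in
theorem root_mem_posCone (i : I) : R.root i ∈ R.posCone := by
  classical
  refine ⟨by simp [coord_root], fun j => ?_⟩
  rw [coord_root, Finsupp.single_apply]
  split_ifs <;> simp

theorem posRootLattice_le_posCone : R.posRootLattice ≤ R.posCone := by
  refine (AddSubmonoid.closure_le).2 ?_
  rintro _ ⟨i, rfl⟩
  exact R.root_mem_posCone i

theorem height_nonneg {x : Dual ℚ 𝔥} (hx : x ∈ R.posCone) : 0 ≤ R.height x := by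
  rw [height_eq]
  exact Finset.sum_nonneg fun i _ => hx.2 i

theorem eq_zero_of_height {x : Dual ℚ 𝔥} (hx : x ∈ R.posCone) (h : R.height x = 0) : x = 0 := by
  rw [height_eq] at h
  have h' := (Finset.sum_eq_zero_iff_of_nonneg fun i _ => hx.2 i).1 h
  have : R.coord x = 0 := by
    ext i
    by_cases hi : i ∈ (R.coord x).support
    · exact h' i hi
    · simpa using hi
  rw [← hx.1, this, map_zero]

theorem eq_zero_of_neg_mem {x : Dual ℚ 𝔥} (hx : x ∈ R.posCone) (h : -x ∈ R.posCone) : x = 0 := by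
  refine eq_zero_of_height hx (le_antisymm ?_ (height_nonneg hx))
  have := height_nonneg h
  rw [map_neg] at this
  linarith

/-- The rays spanned by the simple roots are faces of the cone. -/
theorem eq_smul_root_of_add {x y : Dual ℚ 𝔥} (hx : x ∈ R.posCone) (hy : y ∈ R.posCone) {q : ℚ}
    {i : I} (h : x + y = q • R.root i) : x = R.coord x i • R.root i := by
  classical
  conv_lhs => rw [← hx.1]
  have key : R.coord x = Finsupp.single i (R.coord x i) := by
    ext j
    by_cases hj : j = i
    · simp [hj]
    · have h1 := congrArg (fun z => R.coord z j) h
      simp only [map_add, map_smul, coord_root, Finsupp.add_apply, Finsupp.smul_apply,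
        Finsupp.single_apply, if_neg (Ne.symm hj), smul_zero] at h1
      have h2 := hx.2 j
      have h3 := hy.2 j
      rw [Finsupp.single_apply, if_neg (Ne.symm hj)]
      linarith
  rw [key]
  simp

theorem root_ne_zero (i : I) : R.root i ≠ 0 := R.linearIndependent_root.ne_zero i

theorem smul_root_eq {i j : I} {p q : ℚ} (h : p • R.root i = q • R.root j) (hp : p ≠ 0) :
    i = j ∧ p = q := by
  classical
  have h1 := congrArg (fun z => R.coord z i) h
  simp only [map_smul, coord_root, Finsupp.smul_apply, Finsupp.single_apply, if_true,
    smul_eq_mul, mul_one, mul_ite, mul_zero] at h1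
  by_cases hij : j = i
  · subst hij
    simpa using h1
  · rw [if_neg hij] at h1
    exact absurd h1 hp

theorem IsBorcherdsCartan.le_zero_of_ne_two (hA : IsBorcherdsCartan A) {i : I} (hi : A i i ≠ 2) :
    A i i ≤ 0 := (hA.diag i).resolve_left hi

theorem posCone_coroot_nonpos (hA : IsBorcherdsCartan A) {i : I} (hi : A i i ≠ 2)
    {x : Dual ℚ 𝔥} (hx : x ∈ R.posCone) : x (R.coroot i) ≤ 0 := by
  rw [← hx.1, Finsupp.linearCombination_apply, Finsupp.sum, LinearMap.sum_apply]
  refine Finset.sum_nonpos fun j _ => ?_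
  rw [LinearMap.smul_apply, R.root_coroot, smul_eq_mul]
  refine mul_nonpos_of_nonneg_of_nonpos (hx.2 j) ?_
  by_cases hij : i = j
  · subst hij
    exact_mod_cast IsBorcherdsCartan.le_zero_of_ne_two hA hi
  · exact_mod_cast hA.off_diag i j hij

theorem root_mem_posRootLattice (i : I) : R.root i ∈ R.posRootLattice :=
  AddSubmonoid.subset_closure ⟨i, rfl⟩

theorem exists_nat_height {x : Dual ℚ 𝔥} (hx : x ∈ R.posRootLattice) :
    ∃ n : ℕ, R.height x = n := by
  induction hx using AddSubmonoid.closure_induction with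
  | mem x hx =>
    obtain ⟨i, rfl⟩ := hx
    exact ⟨1, by simp [height_root]⟩
  | zero => exact ⟨0, by simp⟩
  | add x y _ _ hx hy =>
    obtain ⟨m, hm⟩ := hx
    obtain ⟨n, hn⟩ := hy
    exact ⟨m + n, by simp [hm, hn]⟩

theorem exists_int_coroot {x : Dual ℚ 𝔥} (hx : x ∈ R.posRootLattice) (i : I) :
    ∃ n : ℤ, x (R.coroot i) = n := by
  induction hx using AddSubmonoid.closure_induction with
  | mem x hx =>
    obtain ⟨j, rfl⟩ := hx
    exact ⟨A i j, R.root_coroot i j⟩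
  | zero => exact ⟨0, by simp⟩
  | add x y _ _ hx hy =>
    obtain ⟨m, hm⟩ := hx
    obtain ⟨n, hn⟩ := hy
    exact ⟨m + n, by simp [hm, hn]⟩

/-! ### Reflections of pairs (root, coroot) -/

variable (R) in
/-- The pair `(α_i, α_i^∨)`. -/
def simplePair (i : I) : Dual ℚ 𝔥 × 𝔥 := (R.root i, R.coroot i)

variable (R) in
/-- The simultaneous action of `r_k` on `𝔥* × 𝔥`. -/
def rPair (k : I) : (Dual ℚ 𝔥 × 𝔥) →ₗ[ℚ] (Dual ℚ 𝔥 × 𝔥) where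
  toFun z := (R.r k z.1, z.2 - R.root k z.2 • R.coroot k)
  map_add' x y := by
    ext1
    · simp
    · simp only [Prod.snd_add, map_add, add_smul]
      abel
  map_smul' c x := by
    ext1
    · simp
    · simp [mul_smul, smul_sub]

theorem rPair_fst (k : I) (z : Dual ℚ 𝔥 × 𝔥) :
    (R.rPair k z).1 = z.1 - z.1 (R.coroot k) • R.root k := R.r_apply k z.1

theorem rPair_fst' (k : I) (z : Dual ℚ 𝔥 × 𝔥) : (R.rPair k z).1 = R.r k z.1 := rfl

theorem rPair_snd (k : I) (z : Dual ℚ 𝔥 × 𝔥) :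
    (R.rPair k z).2 = z.2 - R.root k z.2 • R.coroot k := rfl

theorem root_coroot_self {k : I} (hk : A k k = 2) : R.root k (R.coroot k) = 2 := by
  rw [R.root_coroot, hk]; norm_num

theorem r_r {k : I} (hk : A k k = 2) (x : Dual ℚ 𝔥) : R.r k (R.r k x) = x := by
  simp only [r_apply, LinearMap.sub_apply, LinearMap.smul_apply, root_coroot_self hk]
  module

theorem rPair_rPair {k : I} (hk : A k k = 2) (z : Dual ℚ 𝔥 × 𝔥) :
    R.rPair k (R.rPair k z) = z := by
  ext1
  · exact r_r hk z.1
  · simp only [rPair_snd, map_sub, map_smul, root_coroot_self hk]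
    module

/-- Reflections preserve the pairing of `𝔥*` and `𝔥`. -/
theorem r_apply_rPair {k : I} (hk : A k k = 2) (x : Dual ℚ 𝔥) (z : Dual ℚ 𝔥 × 𝔥) :
    R.r k x (R.rPair k z).2 = x z.2 := by
  simp only [r_apply, rPair_snd, map_sub, map_smul, LinearMap.sub_apply, LinearMap.smul_apply,
    root_coroot_self hk, smul_eq_mul]
  ring

theorem r_coroot {k : I} (hk : A k k = 2) (x : Dual ℚ 𝔥) :
    R.r k x (R.coroot k) = - x (R.coroot k) := by
  simp only [r_apply, LinearMap.sub_apply, LinearMap.smul_apply, root_coroot_self hk, smul_eq_mul]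
  ring

theorem rPair_simplePair {k : I} (hk : A k k = 2) :
    R.rPair k (R.simplePair k) = - R.simplePair k := by
  ext1
  · simp only [rPair_fst, simplePair, root_coroot_self hk, Prod.fst_neg]
    module
  · simp only [rPair_snd, simplePair, root_coroot_self hk, Prod.snd_neg]
    module

/-- The pairs `(β, β^∨)` obtained from the simple ones by real simple reflections that increase
the height. It turns out that these are exactly the pairs with `β` a positive root in `WΠ`. -/
inductive PosPair (R : Realization A 𝔥) : Dual ℚ 𝔥 × 𝔥 → Prop
  | simple (i : I) : PosPair R (R.simplePair i)
  | refl {k : I} {z : Dual ℚ 𝔥 × 𝔥} (hk : A k k = 2) (hz : PosPair R z)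
      (hneg : z.1 (R.coroot k) < 0) : PosPair R (R.rPair k z)

theorem PosPair.mem_posRootLattice {z : Dual ℚ 𝔥 × 𝔥} (hz : PosPair R z) :
    z.1 ∈ R.posRootLattice := by
  induction hz with
  | simple i => exact root_mem_posRootLattice i
  | @refl k z hk hz hneg ih =>
    obtain ⟨n, hn⟩ := exists_int_coroot ih k
    rw [hn] at hneg
    have h0 : n < 0 := by exact_mod_cast hneg
    rw [rPair_fst, hn, sub_eq_add_neg, ← neg_smul]
    have : (-(n : ℚ)) • R.root k = n.natAbs • R.root k := by
      rw [← Nat.cast_smul_eq_nsmul ℚ]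
      congr 1
      have : ((n.natAbs : ℤ) : ℚ) = ((-n : ℤ) : ℚ) := by
        rw [Int.ofNat_natAbs_of_nonpos h0.le]
      push_cast at this
      simpa using this.symm
    rw [this]
    exact add_mem ih (nsmul_mem (root_mem_posRootLattice k) _)

theorem PosPair.mem_posCone {z : Dual ℚ 𝔥 × 𝔥} (hz : PosPair R z) : z.1 ∈ R.posCone :=
  posRootLattice_le_posCone hz.mem_posRootLattice

theorem PosPair.ne_zero {z : Dual ℚ 𝔥 × 𝔥} (hz : PosPair R z) : z.1 ≠ 0 := by
  induction hz with
  | simple i => exact root_ne_zero i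
  | @refl k z hk hz hneg ih =>
    intro h
    have := congrArg (R.r k) h
    rw [rPair_fst', r_r hk, map_zero] at this
    exact ih this

theorem PosPair.diag {z : Dual ℚ 𝔥 × 𝔥} (hz : PosPair R z) : ∃ i, z.1 z.2 = A i i := by
  induction hz with
  | simple i => exact ⟨i, R.root_coroot i i⟩
  | refl hk hz hneg ih =>
    obtain ⟨i, hi⟩ := ih
    exact ⟨i, by rw [rPair_fst', r_apply_rPair hk, hi]⟩

/-- A positive root proportional to a simple root is that simple root, with its coroot. -/
theorem PosPair.eq_simplePair {z : Dual ℚ 𝔥 × 𝔥} (hz : PosPair R z) {q : ℚ} {i : I}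
    (h : z.1 = q • R.root i) : z = R.simplePair i := by
  cases hz with
  | simple j =>
    have h' : (1 : ℚ) • R.root j = q • R.root i := by simpa [simplePair] using h
    rw [(smul_root_eq h' one_ne_zero).1]
  | @refl k z hk hz hneg =>
    exfalso
    rw [rPair_fst, sub_eq_add_neg, ← neg_smul] at h
    have hc := smul_mem_posCone (neg_pos.2 hneg).le (R.root_mem_posCone k)
    have h1 := eq_smul_root_of_add hz.mem_posCone hc h
    have h2 := eq_smul_root_of_add hc hz.mem_posCone (by rw [add_comm]; exact h)
    obtain ⟨rfl, -⟩ := smul_root_eq h2 (neg_pos.2 hneg).ne'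
    have h3 := hz.mem_posCone.2 k
    rw [h1, LinearMap.smul_apply, root_coroot_self hk, smul_eq_mul] at hneg
    linarith

theorem PosPair.not_neg {z : Dual ℚ 𝔥 × 𝔥} (hz : PosPair R z) : -z.1 ∉ R.posCone :=
  fun h => hz.ne_zero (eq_zero_of_neg_mem hz.mem_posCone h)

theorem PosPair.coord_coroot {z : Dual ℚ 𝔥 × 𝔥} (hz : PosPair R z) (hA : IsBorcherdsCartan A)
    {i : I} (hi : A i i ≠ 2) (h : z.1 (R.coroot i) = 0) : R.root i z.2 = 0 := by
  induction hz with
  | simple k =>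
    simp only [simplePair, R.root_coroot] at h ⊢
    exact_mod_cast (hA.zero_iff i k).1 (by exact_mod_cast h)
  | @refl k z hk hz hneg ih =>
    have hik : i ≠ k := by rintro rfl; exact hi hk
    have h1 := posCone_coroot_nonpos hA hi hz.mem_posCone
    have h2 := posCone_coroot_nonpos hA hi (R.root_mem_posCone k)
    rw [rPair_fst, LinearMap.sub_apply, LinearMap.smul_apply, smul_eq_mul] at h
    have h3 := mul_nonneg_of_nonpos_of_nonpos hneg.le h2
    have h4 : z.1 (R.coroot i) = 0 := by linarith
    have h5 : R.root k (R.coroot i) = 0 := by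
      have : z.1 (R.coroot k) * R.root k (R.coroot i) = 0 := by linarith
      exact (mul_eq_zero.1 this).resolve_left hneg.ne
    rw [R.root_coroot] at h5
    have h6 : A k i = 0 := (hA.zero_iff i k).1 (by exact_mod_cast h5)
    rw [rPair_snd, map_sub, map_smul, ih h4, R.root_coroot, h6]
    simp

end Realization
end BorcherdsPath

namespace BorcherdsPath

/-! ### Orbits of two involutions -/

/-- The words `x, f x, g (f x), f (g (f x)), …` of alternating operators, `f` acting first. -/
def alternate {X : Type*} (f g : X → X) (x : X) : ℕ → X
  | 0 => x
  | n + 1 => alternate g f (f x) n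

/-- The orbit of `x` under the monoid generated by `f` and `g`. -/
inductive PairOrbit {X : Type*} (f g : X → X) (x : X) : X → Prop
  | base : PairOrbit f g x x
  | left {y : X} (h : PairOrbit f g x y) : PairOrbit f g x (f y)
  | right {y : X} (h : PairOrbit f g x y) : PairOrbit f g x (g y)

theorem PairOrbit.trans {X : Type*} {f g : X → X} {x y z : X} (h : PairOrbit f g x y)
    (h' : PairOrbit f g y z) : PairOrbit f g x z := by
  induction h' with
  | base => exact h
  | left _ ih => exact ih.left
  | right _ ih => exact ih.right

theorem PairOrbit.symm {X : Type*} {f g : X → X} (hf : Function.Involutive f)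
    (hg : Function.Involutive g) {x y : X} (h : PairOrbit f g x y) : PairOrbit f g y x := by
  induction h with
  | base => exact .base
  | @left y _ ih =>
    have h1 : PairOrbit f g (f y) (f (f y)) := .left .base
    rw [hf y] at h1
    exact h1.trans ih
  | @right y _ ih =>
    have h1 : PairOrbit f g (g y) (g (g y)) := .right .base
    rw [hg y] at h1
    exact h1.trans ih

theorem alternate_step {X : Type*} (n : ℕ) : ∀ {f g : X → X} (_ : Function.Involutive f)
    (_ : Function.Involutive g) (x : X),
    (Even n → f (alternate f g x n) = alternate f g x (n + 1) ∧
      ∀ l, n = l + 1 → g (alternate f g x n) = alternate f g x l) ∧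
    (Odd n → g (alternate f g x n) = alternate f g x (n + 1) ∧
      ∀ l, n = l + 1 → f (alternate f g x n) = alternate f g x l) := by
  induction n with
  | zero => exact fun hf hg x => ⟨fun _ => ⟨rfl, fun l hl => by omega⟩, fun h => by simp at h⟩
  | succ n ih =>
    intro f g hf hg x
    obtain ⟨h1, h2⟩ := ih hg hf (f x)
    refine ⟨fun hn => ?_, fun hn => ?_⟩
    · have hn' : Odd n := by
        by_contra h
        rw [Nat.not_odd_iff_even] at h
        exact (Nat.not_even_iff_odd.2 h.add_one) hn
      refine ⟨(h2 hn').1, fun l hl => ?_⟩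
      obtain rfl : l = n := by omega
      obtain _ | l := l
      · simp at hn'
      · exact (h2 hn').2 l rfl
    · have hn' : Even n := by
        by_contra h
        rw [Nat.not_even_iff_odd] at h
        exact (Nat.not_odd_iff_even.2 h.add_one) hn
      refine ⟨(h1 hn').1, fun l hl => ?_⟩
      obtain rfl : l = n := by omega
      obtain _ | l := l
      · exact hf x
      · exact (h1 hn').2 l rfl

/-- If the two alternating words of length `m` agree on `x` (no condition if `m = ∞`), then the
orbit of `x` consists of the values of the alternating words of length at most `m`. -/
theorem PairOrbit.forall_of_alternate {X : Type*} {f g : X → X} (hf : Function.Involutive f)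
    (hg : Function.Involutive g) {x : X} {P : X → Prop} {m : ℕ∞} (hm : 1 ≤ m)
    (hfg : ∀ n : ℕ, (n : ℕ∞) ≤ m → P (alternate f g x n))
    (hgf : ∀ n : ℕ, (n : ℕ∞) ≤ m → P (alternate g f x n))
    (hmeet : ∀ n : ℕ, m = n → alternate f g x n = alternate g f x n) {y : X}
    (hy : PairOrbit f g x y) : P y := by
  -- The set of these values is stable under both involutions.
  have key : ∀ {f g : X → X}, Function.Involutive f → Function.Involutive g →
      (∀ n : ℕ, m = n → alternate f g x n = alternate g f x n) → ∀ {n : ℕ}, (n : ℕ∞) ≤ m →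
      ∀ {z}, z = alternate f g x n →
      (∃ l : ℕ, (l : ℕ∞) ≤ m ∧ (f z = alternate f g x l ∨ f z = alternate g f x l)) ∧
      (∃ l : ℕ, (l : ℕ∞) ≤ m ∧ (g z = alternate f g x l ∨ g z = alternate g f x l)) := by
    intro f g hf hg hmeet n hn z hz
    obtain ⟨h1, h2⟩ := alternate_step n hf hg x
    obtain ⟨h3, h4⟩ := alternate_step n hg hf x
    have hpred : ∀ l : ℕ, n = l + 1 → (l : ℕ∞) ≤ m := fun l hl =>
      le_trans (by rw [hl]; exact_mod_cast Nat.le_succ l) hn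
    obtain rfl | ⟨l, rfl⟩ : n = 0 ∨ ∃ l, n = l + 1 := by cases n <;> simp
    · subst hz
      exact ⟨⟨1, by simpa using hm, Or.inl rfl⟩, ⟨1, by simpa using hm, Or.inr rfl⟩⟩
    · rcases hn.lt_or_eq with hlt | heq
      · have hs : ((l + 1 + 1 : ℕ) : ℕ∞) ≤ m := by
          have := Order.add_one_le_of_lt hlt
          exact_mod_cast this
        subst hz
        rcases Nat.even_or_odd (l + 1) with h | h
        · exact ⟨⟨_, hs, Or.inl (h1 h).1⟩, ⟨_, hpred l rfl, Or.inl ((h1 h).2 l rfl)⟩⟩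
        · exact ⟨⟨_, hpred l rfl, Or.inl ((h2 h).2 l rfl)⟩, ⟨_, hs, Or.inl (h2 h).1⟩⟩
      · have hz' : z = alternate g f x (l + 1) := by rw [hz, hmeet _ heq.symm]
        rcases Nat.even_or_odd (l + 1) with h | h
        · refine ⟨⟨_, hpred l rfl, Or.inr ?_⟩, ⟨_, hpred l rfl, Or.inl ?_⟩⟩
          · rw [hz', (h3 h).2 l rfl]
          · rw [hz, (h1 h).2 l rfl]
        · refine ⟨⟨_, hpred l rfl, Or.inl ?_⟩, ⟨_, hpred l rfl, Or.inr ?_⟩⟩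
          · rw [hz, (h2 h).2 l rfl]
          · rw [hz', (h4 h).2 l rfl]
  have main : ∃ n : ℕ, (n : ℕ∞) ≤ m ∧ (y = alternate f g x n ∨ y = alternate g f x n) := by
    induction hy with
    | base => exact ⟨0, by simp, Or.inl rfl⟩
    | left _ ih =>
      obtain ⟨n, hn, h | h⟩ := ih
      · exact (key hf hg hmeet hn h).1
      · obtain ⟨l, hl, h⟩ := (key hg hf (fun n hn => (hmeet n hn).symm) hn h).2
        exact ⟨l, hl, h.symm⟩
    | right _ ih =>
      obtain ⟨n, hn, h | h⟩ := ih
      · exact (key hf hg hmeet hn h).2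
      · obtain ⟨l, hl, h⟩ := (key hg hf (fun n hn => (hmeet n hn).symm) hn h).1
        exact ⟨l, hl, h.symm⟩
  obtain ⟨n, hn, rfl | rfl⟩ := main
  · exact hfg n hn
  · exact hgf n hn

/-! ### Numbers of the same sign -/

/-- Two numbers are both zero or both positive. -/
def SameNonneg (x y : ℚ) : Prop := (x = 0 ∧ y = 0) ∨ (0 < x ∧ 0 < y)

/-- Two numbers have the same sign. -/
def SameSign (x y : ℚ) : Prop := SameNonneg x y ∨ (x < 0 ∧ y < 0)

theorem SameNonneg.add {x y x' y' : ℚ} (h : SameNonneg x y) (h' : SameNonneg x' y') :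
    SameNonneg (x + x') (y + y') := by
  rcases h with ⟨rfl, rfl⟩ | ⟨h1, h2⟩ <;> rcases h' with ⟨rfl, rfl⟩ | ⟨h3, h4⟩
  · left; simp
  · right; simpa using ⟨h3, h4⟩
  · right; simpa using ⟨h1, h2⟩
  · right; constructor <;> linarith

theorem SameNonneg.mul {x y x' y' : ℚ} (h : SameNonneg x y) (h' : SameNonneg x' y') :
    SameNonneg (x * x') (y * y') := by
  rcases h with ⟨rfl, rfl⟩ | ⟨h1, h2⟩
  · left; simp
  · rcases h' with ⟨rfl, rfl⟩ | ⟨h3, h4⟩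
    · left; simp
    · right; exact ⟨mul_pos h1 h3, mul_pos h2 h4⟩

theorem SameNonneg.of_pos {x y : ℚ} (hx : 0 < x) (hy : 0 < y) : SameNonneg x y := Or.inr ⟨hx, hy⟩

theorem SameNonneg.nonneg {x y : ℚ} (h : SameNonneg x y) : 0 ≤ x := by
  rcases h with ⟨rfl, -⟩ | ⟨h1, -⟩
  · exact le_rfl
  · exact h1.le

theorem SameNonneg.symm {x y : ℚ} (h : SameNonneg x y) : SameNonneg y x := by
  rcases h with ⟨h1, h2⟩ | ⟨h1, h2⟩
  · exact Or.inl ⟨h2, h1⟩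
  · exact Or.inr ⟨h2, h1⟩

theorem SameSign.neg {x y : ℚ} (h : SameSign x y) : SameSign (-x) (-y) := by
  rcases h with (⟨rfl, rfl⟩ | ⟨h1, h2⟩) | ⟨h1, h2⟩
  · exact Or.inl (Or.inl (by simp))
  · exact Or.inr ⟨by linarith, by linarith⟩
  · exact Or.inl (Or.inr ⟨by linarith, by linarith⟩)

theorem SameSign.pos {x y : ℚ} (h : SameSign x y) (hx : 0 < x) : 0 < y := by
  rcases h with (⟨rfl, rfl⟩ | ⟨h1, h2⟩) | ⟨h1, h2⟩
  · exact hx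
  · exact h2
  · linarith

theorem SameSign.neg_of_nonpos {x y : ℚ} (h : SameSign x y) (hx : x ≤ 0) :
    SameNonneg (-x) (-y) := by
  rcases h with (⟨rfl, rfl⟩ | ⟨h1, h2⟩) | ⟨h1, h2⟩
  · exact Or.inl (by simp)
  · linarith
  · exact Or.inr ⟨by linarith, by linarith⟩

namespace Realization

variable {I : Type*} {A : Matrix I I ℤ} {𝔥 : Type*} [AddCommGroup 𝔥] [Module ℚ 𝔥]
  {R : Realization A 𝔥}

/-! ### Rank two -/

variable (R) in
/-- A pair in `PosPair` whose pairings with `α_j` and `α_k`, on the side of the root and on the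
side of the coroot, have the same signs. -/
def GoodPair (j k : I) (z : Dual ℚ 𝔥 × 𝔥) : Prop :=
  PosPair R z ∧ SameSign (z.1 (R.coroot j)) (R.root j z.2) ∧
    SameSign (z.1 (R.coroot k)) (R.root k z.2)

theorem GoodPair.swap {j k : I} {z : Dual ℚ 𝔥 × 𝔥} (h : R.GoodPair j k z) : R.GoodPair k j z :=
  ⟨h.1, h.2.2, h.2.1⟩

variable (R) in
/-- A pair in `PosPair` with prescribed pairings: `e` with `α_i` and `-g` with `α_i'` on the side
of the root, and likewise `e'`, `-g'` on the side of the coroot. -/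
structure Pairings (i i' : I) (e g e' g' : ℚ) (z : Dual ℚ 𝔥 × 𝔥) : Prop where
  pos : PosPair R z
  fst : z.1 (R.coroot i) = e
  fst' : z.1 (R.coroot i') = -g
  snd : R.root i z.2 = e'
  snd' : R.root i' z.2 = -g'

theorem Pairings.good {i i' : I} {e g e' g' : ℚ} {z : Dual ℚ 𝔥 × 𝔥}
    (h : R.Pairings i i' e g e' g' z) (he : SameSign e e') (hg : SameSign g g') :
    R.GoodPair i i' z := by
  refine ⟨h.pos, ?_, ?_⟩
  · rw [h.fst, h.snd]; exact he
  · rw [h.fst', h.snd']; exact hg.neg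

theorem rPair_eq_self {i : I} {z : Dual ℚ 𝔥 × 𝔥} (h : z.1 (R.coroot i) = 0)
    (h' : R.root i z.2 = 0) : R.rPair i z = z := by
  ext1
  · rw [rPair_fst, h, zero_smul, sub_zero]
  · rw [rPair_snd, h', zero_smul, sub_zero]

theorem Pairings.step {i i' : I} {e g e' g' G G' : ℚ} {z : Dual ℚ 𝔥 × 𝔥}
    (h : R.Pairings i i' e g e' g' z) (hi' : A i' i' = 2) (hg : SameNonneg g g')
    (hG : G = -(A i i') * g - e) (hG' : G' = -(A i' i) * g' - e') :
    R.Pairings i' i g G g' G' (R.rPair i' z) := by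
  obtain ⟨hpos, h1, h2, h3, h4⟩ := h
  refine ⟨?_, ?_, ?_, ?_, ?_⟩
  · rcases hg with ⟨rfl, rfl⟩ | ⟨hg, -⟩
    · rw [rPair_eq_self]
      · exact hpos
      · simpa using h2
      · simpa using h4
    · exact hpos.refl hi' (by rw [h2]; linarith)
  · rw [rPair_fst', r_coroot hi', h2, neg_neg]
  · rw [rPair_fst, LinearMap.sub_apply, LinearMap.smul_apply, h1, h2, R.root_coroot, hG,
      smul_eq_mul]
    ring
  · rw [rPair_snd, map_sub, map_smul, root_coroot_self hi', h4, smul_eq_mul]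
    ring
  · rw [rPair_snd, map_sub, map_smul, h3, h4, R.root_coroot, hG', smul_eq_mul]
    ring

/-- If `a_ij a_ji ≥ 4`, then the height increases forever along an alternating word. -/
theorem Pairings.good_alternate (n : ℕ) : ∀ {i i' : I} {e g e' g' : ℚ} {z : Dual ℚ 𝔥 × 𝔥}
    (_ : R.Pairings i i' e g e' g' z) (_ : A i i = 2) (_ : A i' i' = 2)
    (_ : A i i' < 0) (_ : A i' i < 0) (_ : 4 ≤ A i i' * A i' i) (_ : SameNonneg g g')
    (_ : SameNonneg e e') (_ : 2 * e ≤ -(A i i') * g) (_ : 2 * e' ≤ -(A i' i) * g'),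
    R.GoodPair i i' (alternate (R.rPair i') (R.rPair i) z n) := by
  induction n with
  | zero => exact fun h _ _ _ _ _ hg he _ _ => h.good (Or.inl he) (Or.inl hg)
  | succ n ih =>
    intro i i' e g e' g' z h hi hi' hn hn' h4 hg he h2 h2'
    have hs := h.step hi' hg rfl rfl
    have q1 : (A i i' : ℚ) < 0 := by exact_mod_cast hn
    have q2 : (A i' i : ℚ) < 0 := by exact_mod_cast hn'
    have q4 : (4 : ℚ) ≤ A i i' * A i' i := by exact_mod_cast h4
    refine (ih hs hi' hi hn' hn (by rw [mul_comm]; exact h4) ?_ hg ?_ ?_).swap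
    · rcases hg with ⟨rfl, rfl⟩ | ⟨hg, hg'⟩
      · have h5 := he.nonneg
        have h6 := he.symm.nonneg
        left
        constructor <;> linarith
      · right
        have := mul_pos_of_neg_of_neg q1 (neg_lt_zero.2 hg)
        have := mul_pos_of_neg_of_neg q2 (neg_lt_zero.2 hg')
        constructor <;> linarith
    · have h5 := hg.nonneg
      nlinarith [mul_nonneg (sub_nonneg.2 q4) h5, mul_nonneg (neg_pos.2 q2).le (sub_nonneg.2 h2)]
    · have h5 := hg.symm.nonneg
      nlinarith [mul_nonneg (sub_nonneg.2 q4) h5, mul_nonneg (neg_pos.2 q1).le (sub_nonneg.2 h2')]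

variable (R) in
/-- The translate of `z` by `u α_j + v α_k` and `u' α_j^∨ + v' α_k^∨`. -/
def translate (j k : I) (z : Dual ℚ 𝔥 × 𝔥) (u v u' v' : ℚ) : Dual ℚ 𝔥 × 𝔥 :=
  (z.1 + u • R.root j + v • R.root k, z.2 + u' • R.coroot j + v' • R.coroot k)

theorem rPair_translate_left {j : I} (k : I) (hj : A j j = 2) (z : Dual ℚ 𝔥 × 𝔥)
    (u v u' v' : ℚ) :
    R.rPair j (R.translate j k z u v u' v') = R.translate j k z
      (-z.1 (R.coroot j) - u - A j k * v) v (-R.root j z.2 - u' - A k j * v') v' := by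
  ext1
  · simp only [translate, rPair_fst, LinearMap.add_apply, LinearMap.smul_apply,
      root_coroot_self hj, R.root_coroot j k, smul_eq_mul]
    module
  · simp only [translate, rPair_snd, map_add, map_smul, root_coroot_self hj, R.root_coroot k j,
      smul_eq_mul]
    module

theorem rPair_translate_right (j : I) {k : I} (hk : A k k = 2) (z : Dual ℚ 𝔥 × 𝔥)
    (u v u' v' : ℚ) :
    R.rPair k (R.translate j k z u v u' v') = R.translate j k z
      u (-z.1 (R.coroot k) - v - A k j * u) u' (-R.root k z.2 - v' - A j k * u') := by
  ext1
  · simp only [translate, rPair_fst, LinearMap.add_apply, LinearMap.smul_apply,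
      root_coroot_self hk, R.root_coroot k j, smul_eq_mul]
    module
  · simp only [translate, rPair_snd, map_add, map_smul, root_coroot_self hk, R.root_coroot j k,
      smul_eq_mul]
    module

/-- The order of the product of two real reflections. -/
inductive DihedralOrder (A : Matrix I I ℤ) (j k : I) : ℕ∞ → Prop
  | two (h : A j k = 0) (h' : A k j = 0) : DihedralOrder A j k 2
  | three (h : A j k = -1) (h' : A k j = -1) : DihedralOrder A j k 3
  | four (h : A j k < 0) (h' : A k j < 0) (h2 : A j k * A k j = 2) : DihedralOrder A j k 4
  | six (h : A j k < 0) (h' : A k j < 0) (h3 : A j k * A k j = 3) : DihedralOrder A j k 6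
  | top (h : A j k < 0) (h' : A k j < 0) (h4 : 4 ≤ A j k * A k j) : DihedralOrder A j k ⊤

theorem DihedralOrder.symm {j k : I} {m : ℕ∞} (h : DihedralOrder A j k m) :
    DihedralOrder A k j m := by
  cases h with
  | two h h' => exact .two h' h
  | three h h' => exact .three h' h
  | four h h' h2 => exact .four h' h (by rw [mul_comm]; exact h2)
  | six h h' h2 => exact .six h' h (by rw [mul_comm]; exact h2)
  | top h h' h2 => exact .top h' h (by rw [mul_comm]; exact h2)

theorem DihedralOrder.one_le {j k : I} {m : ℕ∞} (h : DihedralOrder A j k m) : 1 ≤ m := by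
  cases h <;> norm_num

theorem exists_dihedralOrder (hA : IsBorcherdsCartan A) {j k : I} (hjk : j ≠ k) :
    ∃ m, DihedralOrder A j k m := by
  rcases (hA.off_diag j k hjk).lt_or_eq with h | h
  · have h' : A k j < 0 := lt_of_le_of_ne (hA.off_diag k j hjk.symm) fun h' =>
      h.ne ((hA.zero_iff j k).2 h')
    have hp := mul_pos_of_neg_of_neg h h'
    obtain h1 | h1 | h1 | h1 : A j k * A k j = 1 ∨ A j k * A k j = 2 ∨ A j k * A k j = 3 ∨
      4 ≤ A j k * A k j := by omega
    · refine ⟨3, .three ?_ ?_⟩ <;> nlinarith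
    · exact ⟨4, .four h h' h1⟩
    · exact ⟨6, .six h h' h1⟩
    · exact ⟨⊤, .top h h' h1⟩
  · exact ⟨2, .two h ((hA.zero_iff j k).1 h)⟩

/-- The braid relations. -/
theorem braid {j k : I} (hj : A j j = 2) (hk : A k k = 2) {m : ℕ∞} (h : DihedralOrder A j k m)
    (z : Dual ℚ 𝔥 × 𝔥) (n : ℕ) (hn : m = n) :
    alternate (R.rPair j) (R.rPair k) z n = alternate (R.rPair k) (R.rPair j) z n := by
  have hz : z = R.translate j k z 0 0 0 0 := by simp [translate]
  cases h with
  | two h h' =>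
    obtain rfl : n = 2 := by exact_mod_cast hn.symm
    have q : (A j k : ℚ) = 0 := by exact_mod_cast h
    have q' : (A k j : ℚ) = 0 := by exact_mod_cast h'
    conv_lhs => rw [hz]
    conv_rhs => rw [hz]
    simp only [alternate, rPair_translate_left k hj, rPair_translate_right j hk]
    congr 1 <;> simp [q, q']
  | three h h' =>
    obtain rfl : n = 3 := by exact_mod_cast hn.symm
    have q : (A j k : ℚ) = -1 := by exact_mod_cast h
    have q' : (A k j : ℚ) = -1 := by exact_mod_cast h'
    conv_lhs => rw [hz]
    conv_rhs => rw [hz]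
    simp only [alternate, rPair_translate_left k hj, rPair_translate_right j hk]
    congr 1 <;> rw [q, q'] <;> ring
  | four h h' h2 =>
    obtain rfl : n = 4 := by exact_mod_cast hn.symm
    conv_lhs => rw [hz]
    conv_rhs => rw [hz]
    simp only [alternate, rPair_translate_left k hj, rPair_translate_right j hk]
    have hb : -2 ≤ A j k := by nlinarith
    obtain ⟨q, q'⟩ | ⟨q, q'⟩ : (A j k = -1 ∧ A k j = -2) ∨ (A j k = -2 ∧ A k j = -1) := by
      generalize A j k = c at *
      interval_cases c <;> omega
    all_goals
      rw [q, q']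
      push_cast
      congr 1 <;> ring
  | six h h' h3 =>
    obtain rfl : n = 6 := by exact_mod_cast hn.symm
    conv_lhs => rw [hz]
    conv_rhs => rw [hz]
    simp only [alternate, rPair_translate_left k hj, rPair_translate_right j hk]
    have hb : -3 ≤ A j k := by nlinarith
    obtain ⟨q, q'⟩ | ⟨q, q'⟩ : (A j k = -1 ∧ A k j = -3) ∨ (A j k = -3 ∧ A k j = -1) := by
      generalize A j k = c at *
      interval_cases c <;> omega
    all_goals
      rw [q, q']
      push_cast
      congr 1 <;> ring
  | top h h' h4 => simp at hn

/-- The alternating words shorter than the order of the product of the two reflections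
increase the height when they are applied to an antidominant pair. -/
theorem good_alternate_of_antidominant {j k : I} (hj : A j j = 2) (hk : A k k = 2) {m : ℕ∞}
    (h : DihedralOrder A j k m) {z : Dual ℚ 𝔥 × 𝔥} {a b a' b' : ℚ}
    (hz : R.Pairings k j (-b) a (-b') a' z) (ha : SameNonneg a a') (hb : SameNonneg b b') (n : ℕ)
    (hn : (n : ℕ∞) ≤ m) : R.GoodPair j k (alternate (R.rPair j) (R.rPair k) z n) := by
  have g0 : R.GoodPair j k z := (hz.good (SameSign.neg (Or.inl hb)) (Or.inl ha)).swap
  cases h with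
  | two h h' =>
    have hn : n ≤ 2 := by exact_mod_cast hn
    have s1 := hz.step hj ha (G := b) (G' := b') (by simp [h']) (by simp [h])
    have s2 := s1.step hk hb (G := -a) (G' := -a') (by simp [h]) (by simp [h'])
    interval_cases n
    · exact g0
    · exact s1.good (Or.inl ha) (Or.inl hb)
    · exact (s2.good (Or.inl hb) (SameSign.neg (Or.inl ha))).swap
  | three h h' =>
    have hn : n ≤ 3 := by exact_mod_cast hn
    have s1 := hz.step hj ha (G := a + b) (G' := a' + b') (by simp [h']) (by simp [h])
    have s2 := s1.step hk (ha.add hb) (G := b) (G' := b') (by simp [h]) (by simp [h'])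
    have s3 := s2.step hj hb (G := -a) (G' := -a') (by simp [h']) (by simp [h])
    interval_cases n
    · exact g0
    · exact s1.good (Or.inl ha) (Or.inl (ha.add hb))
    · exact (s2.good (Or.inl (ha.add hb)) (Or.inl hb)).swap
    · exact s3.good (Or.inl hb) (SameSign.neg (Or.inl ha))
  | four h h' h2 =>
    have hn : n ≤ 4 := by exact_mod_cast hn
    have q : (A j k : ℚ) * A k j = 2 := by exact_mod_cast h2
    have hc : (0 : ℚ) < -A j k := by simpa using h
    have hd : (0 : ℚ) < -A k j := by simpa using h'
    have hdc := SameNonneg.of_pos hd hc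
    have h1 := (hdc.mul ha).add hb
    have h2 := (hdc.symm.mul hb).add ha
    have s1 := hz.step hj ha (G := -A k j * a + b) (G' := -A j k * a' + b') (by ring) (by ring)
    have s2 := s1.step hk h1 (G := -A j k * b + a) (G' := -A k j * b' + a')
      (by linear_combination (-a) * q) (by linear_combination (-a') * q)
    have s3 := s2.step hj h2 (G := b) (G' := b')
      (by linear_combination (-b) * q) (by linear_combination (-b') * q)
    have s4 := s3.step hk hb (G := -a) (G' := -a') (by ring) (by ring)
    interval_cases n
    · exact g0
    · exact s1.good (Or.inl ha) (Or.inl h1)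
    · exact (s2.good (Or.inl h1) (Or.inl h2)).swap
    · exact s3.good (Or.inl h2) (Or.inl hb)
    · exact (s4.good (Or.inl hb) (SameSign.neg (Or.inl ha))).swap
  | six h h' h3 =>
    have hn : n ≤ 6 := by exact_mod_cast hn
    have q : (A j k : ℚ) * A k j = 3 := by exact_mod_cast h3
    have hc : (0 : ℚ) < -A j k := by simpa using h
    have hd : (0 : ℚ) < -A k j := by simpa using h'
    have hdc := SameNonneg.of_pos hd hc
    have h1 := (hdc.mul ha).add hb
    have h2 := ((hdc.symm.mul hb).add ha).add ha
    have h3 := ((hdc.mul ha).add hb).add hb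
    have h4 := (hdc.symm.mul hb).add ha
    have s1 := hz.step hj ha (G := -A k j * a + b) (G' := -A j k * a' + b') (by ring) (by ring)
    have s2 := s1.step hk h1 (G := -A j k * b + a + a) (G' := -A k j * b' + a' + a')
      (by linear_combination (-a) * q) (by linear_combination (-a') * q)
    have s3 := s2.step hj h2 (G := -A k j * a + b + b) (G' := -A j k * a' + b' + b')
      (by linear_combination (-b) * q) (by linear_combination (-b') * q)
    have s4 := s3.step hk h3 (G := -A j k * b + a) (G' := -A k j * b' + a')
      (by linear_combination (-a) * q) (by linear_combination (-a') * q)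
    have s5 := s4.step hj h4 (G := b) (G' := b')
      (by linear_combination (-b) * q) (by linear_combination (-b') * q)
    have s6 := s5.step hk hb (G := -a) (G' := -a') (by ring) (by ring)
    interval_cases n
    · exact g0
    · exact s1.good (Or.inl ha) (Or.inl h1)
    · exact (s2.good (Or.inl h1) (Or.inl h2)).swap
    · exact s3.good (Or.inl h2) (Or.inl h3)
    · exact (s4.good (Or.inl h3) (Or.inl h4)).swap
    · exact s5.good (Or.inl h4) (Or.inl hb)
    · exact (s6.good (Or.inl hb) (SameSign.neg (Or.inl ha))).swap
  | top h h' h4 =>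
    obtain _ | n := n
    · exact g0
    · have hc : (0 : ℚ) < -A j k := by simpa using h
      have hd : (0 : ℚ) < -A k j := by simpa using h'
      have q4 : (4 : ℚ) ≤ A j k * A k j := by exact_mod_cast h4
      have s1 := hz.step hj ha (G := -A k j * a + b) (G' := -A j k * a' + b') (by ring) (by ring)
      refine Pairings.good_alternate n s1 hj hk h h' h4
        (((SameNonneg.of_pos hd hc).mul ha).add hb) ha ?_ ?_
      · nlinarith [mul_nonneg (sub_nonneg.2 q4) ha.nonneg, mul_nonneg hc.le hb.nonneg, ha.nonneg]
      · nlinarith [mul_nonneg (sub_nonneg.2 q4) ha.symm.nonneg, mul_nonneg hd.le hb.symm.nonneg,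
          ha.symm.nonneg]

theorem simplePair_pairings (i i' : I) (hi : A i i = 2) :
    R.Pairings i i' 2 (-A i' i) 2 (-A i i') (R.simplePair i) :=
  ⟨.simple i, root_coroot_self hi, by simp [simplePair, R.root_coroot], root_coroot_self hi,
    by simp [simplePair, R.root_coroot]⟩

theorem sameNonneg_of_isBorcherdsCartan (hA : IsBorcherdsCartan A) {i j : I} (hij : i ≠ j) :
    SameNonneg (-(A i j : ℚ)) (-(A j i : ℚ)) := by
  rcases (hA.off_diag i j hij).lt_or_eq with h | h
  · refine .of_pos (by simpa using h) ?_
    have := lt_of_le_of_ne (hA.off_diag j i hij.symm) fun h' => h.ne ((hA.zero_iff i j).2 h')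
    simpa using this
  · left
    simp [h, (hA.zero_iff i j).1 h]

/-- Along the alternating words shorter than the order of the product of the two reflections, a
simple root stays positive. -/
theorem good_alternate_simplePair (hA : IsBorcherdsCartan A) {j k : I} (hjk : j ≠ k)
    (hj : A j j = 2) (hk : A k k = 2) {m : ℕ∞}
    (h : DihedralOrder A j k m) (n : ℕ) (hn : (n : ℕ∞) < m) :
    R.GoodPair j k (alternate (R.rPair k) (R.rPair j) (R.simplePair j) n) := by
  have s0 := simplePair_pairings (R := R) j k hj
  have two : SameNonneg 2 2 := .of_pos two_pos two_pos
  have h0 := sameNonneg_of_isBorcherdsCartan hA hjk.symm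
  have g0 : R.GoodPair j k (R.simplePair j) := s0.good (Or.inl two) (Or.inl h0)
  cases h with
  | two h h' =>
    have hn : n < 2 := by exact_mod_cast hn
    have e1 : R.rPair k (R.simplePair j) = R.simplePair j :=
      rPair_eq_self (by simp [s0.fst', h']) (by simp [s0.snd', h])
    interval_cases n
    · exact g0
    · change R.GoodPair j k (R.rPair k (R.simplePair j))
      rw [e1]
      exact g0
  | three h h' =>
    have hn : n < 3 := by exact_mod_cast hn
    have s1 := s0.step hk h0 (G := -1) (G' := -1) (by simp [h, h']; norm_num)
      (by simp [h, h']; norm_num)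
    have e2 : R.rPair j (R.rPair k (R.simplePair j)) = R.simplePair k := by
      have p : (A j k : ℚ) = -1 := by exact_mod_cast h
      have p' : (A k j : ℚ) = -1 := by exact_mod_cast h'
      ext1
      · rw [rPair_fst j, s1.fst', rPair_fst, s0.fst', p']
        simp only [simplePair]
        module
      · rw [rPair_snd j, s1.snd', rPair_snd, s0.snd', p]
        simp only [simplePair]
        module
    interval_cases n
    · exact g0
    · exact (s1.good (Or.inl h0) (SameSign.neg (Or.inl (.of_pos one_pos one_pos)))).swap
    · change R.GoodPair j k (R.rPair j (R.rPair k (R.simplePair j)))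
      rw [e2]
      exact ((simplePair_pairings k j hk).good (Or.inl two) (Or.inl h0.symm)).swap
  | four h h' h2 =>
    have hn : n < 4 := by exact_mod_cast hn
    have q : (A j k : ℚ) * A k j = 2 := by exact_mod_cast h2
    have s1 := s0.step hk h0 (G := 0) (G' := 0) (by linear_combination -q)
      (by linear_combination -q)
    have g1 := (s1.good (Or.inl h0) (Or.inl (Or.inl ⟨rfl, rfl⟩))).swap
    have e2 : R.rPair j (R.rPair k (R.simplePair j)) = R.rPair k (R.simplePair j) :=
      rPair_eq_self (by simp [s1.fst']) (by simp [s1.snd'])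
    interval_cases n
    · exact g0
    · exact g1
    · change R.GoodPair j k (R.rPair j (R.rPair k (R.simplePair j)))
      rw [e2]
      exact g1
    · change R.GoodPair j k (R.rPair k (R.rPair j (R.rPair k (R.simplePair j))))
      rw [e2, rPair_rPair hk]
      exact g0
  | six h h' h3 =>
    have hn : n < 6 := by exact_mod_cast hn
    have q : (A j k : ℚ) * A k j = 3 := by exact_mod_cast h3
    have one : SameNonneg 1 1 := .of_pos one_pos one_pos
    have s1 := s0.step hk h0 (G := 1) (G' := 1) (by linear_combination -q)
      (by linear_combination -q)
    have s2 := s1.step hj one (G := 0) (G' := 0) (by ring) (by ring)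
    have g1 := (s1.good (Or.inl h0) (Or.inl one)).swap
    have g2 := s2.good (Or.inl one) (Or.inl (Or.inl ⟨rfl, rfl⟩))
    have e3 : R.rPair k (R.rPair j (R.rPair k (R.simplePair j))) =
        R.rPair j (R.rPair k (R.simplePair j)) :=
      rPair_eq_self (by simp [s2.fst']) (by simp [s2.snd'])
    interval_cases n
    · exact g0
    · exact g1
    · exact g2
    · change R.GoodPair j k (R.rPair k (R.rPair j (R.rPair k (R.simplePair j))))
      rw [e3]
      exact g2
    · change R.GoodPair j k (R.rPair j (R.rPair k (R.rPair j (R.rPair k (R.simplePair j)))))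
      rw [e3, rPair_rPair hj]
      exact g1
    · change R.GoodPair j k (R.rPair k (R.rPair j (R.rPair k (R.rPair j
        (R.rPair k (R.simplePair j))))))
      rw [e3, rPair_rPair hj, rPair_rPair hk]
      exact g0
  | top h h' h4 =>
    have q4 : (4 : ℚ) ≤ A j k * A k j := by exact_mod_cast h4
    exact Pairings.good_alternate n s0 hj hk h h' h4 h0 two (by linarith) (by linarith)

theorem alternate_neg (n : ℕ) : ∀ (j k : I) (z : Dual ℚ 𝔥 × 𝔥),
    alternate (R.rPair j) (R.rPair k) (-z) n = - alternate (R.rPair j) (R.rPair k) z n := by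
  induction n with
  | zero => exact fun _ _ _ => rfl
  | succ n ih =>
    intro j k z
    simp only [alternate, map_neg, ih]

theorem GoodPair.of_orbit_of_antidominant {j k : I} (hA : IsBorcherdsCartan A) (hjk : j ≠ k)
    (hj : A j j = 2) (hk : A k k = 2) {z y : Dual ℚ 𝔥 × 𝔥} (hz : R.GoodPair j k z)
    (h : z.1 (R.coroot j) ≤ 0) (h' : z.1 (R.coroot k) ≤ 0)
    (hy : PairOrbit (R.rPair j) (R.rPair k) z y) : R.GoodPair j k y := by
  obtain ⟨m, hm⟩ := exists_dihedralOrder hA hjk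
  have ha := hz.2.1.neg_of_nonpos h
  have hb := hz.2.2.neg_of_nonpos h'
  refine PairOrbit.forall_of_alternate (rPair_rPair hj) (rPair_rPair hk) hm.one_le
    (good_alternate_of_antidominant hj hk hm ⟨hz.1, ?_, ?_, ?_, ?_⟩ ha hb)
    (fun n hn => (good_alternate_of_antidominant hk hj hm.symm
      ⟨hz.1, ?_, ?_, ?_, ?_⟩ hb ha n hn).swap)
    (braid hj hk hm z) hy <;> simp

theorem GoodPair.of_orbit_simplePair {j k : I} (hA : IsBorcherdsCartan A) (hjk : j ≠ k)
    (hj : A j j = 2) (hk : A k k = 2) {y : Dual ℚ 𝔥 × 𝔥}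
    (hy : PairOrbit (R.rPair j) (R.rPair k) (R.simplePair j) y) :
    R.GoodPair j k y ∨ R.GoodPair j k (-y) := by
  obtain ⟨m, hm⟩ := exists_dihedralOrder hA hjk
  have down : ∀ n : ℕ, ((n + 1 : ℕ) : ℕ∞) ≤ m → R.GoodPair j k
      (-alternate (R.rPair j) (R.rPair k) (R.simplePair j) (n + 1)) := by
    intro n hn
    rw [alternate, rPair_simplePair hj, alternate_neg, neg_neg]
    refine good_alternate_simplePair hA hjk hj hk hm n (lt_of_lt_of_le ?_ hn)
    exact_mod_cast n.lt_succ_self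
  refine PairOrbit.forall_of_alternate (P := fun y => R.GoodPair j k y ∨ R.GoodPair j k (-y))
    (rPair_rPair hj) (rPair_rPair hk) hm.one_le ?_ ?_ (braid hj hk hm _) hy
  · intro n hn
    obtain _ | n := n
    · exact Or.inl (good_alternate_simplePair hA hjk hj hk hm 0
        (lt_of_lt_of_le (by simp) hm.one_le))
    · exact Or.inr (down n hn)
  · intro n hn
    rcases hn.lt_or_eq with hn' | hn'
    · exact Or.inl (good_alternate_simplePair hA hjk hj hk hm n hn')
    · rw [← braid hj hk hm _ n hn'.symm]
      obtain _ | n := n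
      · subst hn'
        exact absurd hm.one_le (by simp)
      · exact Or.inr (down n hn)

end Realization
end BorcherdsPath

namespace BorcherdsPath
namespace Realization

variable {I : Type*} {A : Matrix I I ℤ} {𝔥 : Type*} [AddCommGroup 𝔥] [Module ℚ 𝔥]
  {R : Realization A 𝔥}

/-! ### Positive roots -/

theorem height_rPair (k : I) (z : Dual ℚ 𝔥 × 𝔥) :
    R.height (R.rPair k z).1 = R.height z.1 - z.1 (R.coroot k) := by
  rw [rPair_fst, map_sub, map_smul, height_root, smul_eq_mul, mul_one]

/-- The two properties of positive roots stated in `PosPair.sameSign` and `PosPair.rPair`, by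
induction on the height. If `z = r_j w` is higher than `w` and `k ≠ j`, then an element of minimal
height in the orbit of `w` under `r_j` and `r_k` is antidominant or simple, so that the orbit is known
from the rank two computations. -/
theorem posPair_induction (hA : IsBorcherdsCartan A) (N : ℕ) : ∀ z : Dual ℚ 𝔥 × 𝔥, PosPair R z →
    R.height z.1 ≤ N → ∀ k, A k k = 2 → SameSign (z.1 (R.coroot k)) (R.root k z.2) ∧
      (0 < z.1 (R.coroot k) → z = R.simplePair k ∨ PosPair R (R.rPair k z)) := by
  induction N with
  | zero =>
    intro z hz hN
    refine absurd (eq_zero_of_height hz.mem_posCone (le_antisymm ?_ (height_nonneg hz.mem_posCone)))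
      hz.ne_zero
    simpa using hN
  | succ N ih =>
    intro z hz hN k hk
    cases hz with
    | simple i =>
      by_cases hik : i = k
      · subst hik
        refine ⟨?_, fun _ => Or.inl rfl⟩
        simp only [simplePair, root_coroot_self hk]
        exact Or.inl (.of_pos two_pos two_pos)
      · have h := sameNonneg_of_isBorcherdsCartan hA (Ne.symm hik)
        have h2 := h.nonneg
        simp only [simplePair, R.root_coroot]
        refine ⟨?_, fun h' => by linarith⟩
        simpa using SameSign.neg (Or.inl h)
    | @refl j w hj hw hneg =>
      have hwN : R.height w.1 ≤ N := by
        obtain ⟨n, hn⟩ := exists_int_coroot hw.mem_posRootLattice j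
        obtain ⟨l, hl⟩ := exists_nat_height hw.mem_posRootLattice
        rw [height_rPair, hn, hl] at hN
        rw [hn] at hneg
        rw [hl]
        have h1 : n < 0 := by exact_mod_cast hneg
        have h2 : (l : ℤ) - n ≤ N + 1 := by exact_mod_cast hN
        have : (l : ℤ) ≤ N := by omega
        exact_mod_cast this
      by_cases hjk : j = k
      · subst hjk
        have h1 := (ih w hw hwN j hk).1
        refine ⟨?_, fun _ => Or.inr (by rwa [rPair_rPair hk])⟩
        rw [rPair_fst', r_coroot hk, rPair_snd, map_sub, map_smul, root_coroot_self hk]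
        have : R.root j w.2 - R.root j w.2 • (2 : ℚ) = - R.root j w.2 := by
          rw [smul_eq_mul]; ring
        rw [this]
        exact h1.neg
      -- An element of minimal height in the orbit under the two reflections.
      · classical
        let S : Set ℕ := {n | ∃ y, PairOrbit (R.rPair j) (R.rPair k) w y ∧ PosPair R y ∧
          R.height y.1 = n}
        have hS : S.Nonempty := by
          obtain ⟨l, hl⟩ := exists_nat_height hw.mem_posRootLattice
          exact ⟨l, w, .base, hw, hl⟩
        obtain ⟨y, hwy, hy, hyn⟩ := Nat.sInf_mem hS
        have hmin : ∀ y', PairOrbit (R.rPair j) (R.rPair k) w y' → PosPair R y' →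
            R.height y.1 ≤ R.height y'.1 := by
          intro y' h1 h2
          obtain ⟨l, hl⟩ := exists_nat_height h2.mem_posRootLattice
          rw [hyn, hl]
          exact_mod_cast Nat.sInf_le (show l ∈ S from ⟨y', h1, h2, hl⟩)
        have hyN : R.height y.1 ≤ N := (hmin w .base hw).trans hwN
        have hj' := ih y hy hyN j hj
        have hk' := ih y hy hyN k hk
        have hz : PairOrbit (R.rPair j) (R.rPair k) y (R.rPair j w) :=
          (hwy.symm (rPair_rPair hj) (rPair_rPair hk)).left
        have hjmin : 0 < y.1 (R.coroot j) → y = R.simplePair j := fun h =>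
          (hj'.2 h).resolve_right fun hp => by
            have := hmin _ hwy.left hp
            rw [height_rPair] at this
            linarith
        have hkmin : 0 < y.1 (R.coroot k) → y = R.simplePair k := fun h =>
          (hk'.2 h).resolve_right fun hp => by
            have := hmin _ hwy.right hp
            rw [height_rPair] at this
            linarith
        have main : ∀ x, PairOrbit (R.rPair j) (R.rPair k) y x →
            R.GoodPair j k x ∨ R.GoodPair j k (-x) := by
          intro x hx
          by_cases h1 : 0 < y.1 (R.coroot j)
          · rw [hjmin h1] at hx
            exact GoodPair.of_orbit_simplePair hA hjk hj hk hx
          · by_cases h2 : 0 < y.1 (R.coroot k)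
            · rw [hkmin h2] at hx
              have hx' : PairOrbit (R.rPair k) (R.rPair j) (R.simplePair k) x := by
                clear * - hx
                induction hx with
                | base => exact .base
                | left _ ih => exact ih.right
                | right _ ih => exact ih.left
              exact (GoodPair.of_orbit_simplePair hA (Ne.symm hjk) hk hj hx').imp
                GoodPair.swap GoodPair.swap
            · exact Or.inl (GoodPair.of_orbit_of_antidominant hA hjk hj hk ⟨hy, hj'.1, hk'.1⟩
                (not_lt.1 h1) (not_lt.1 h2) hx)
        have hzpos : PosPair R (R.rPair j w) := hw.refl hj hneg
        constructor
        · rcases main _ hz with h | h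
          · exact h.2.2
          · exact absurd h.1.mem_posCone hzpos.not_neg
        · intro hpos
          rcases main _ hz.right with h | h
          · exact Or.inr h.1
          · left
            have h1 : (R.rPair j w).1 + (-R.rPair k (R.rPair j w)).1 =
                (R.rPair j w).1 (R.coroot k) • R.root k := by
              rw [Prod.fst_neg, rPair_fst k]
              abel
            exact hzpos.eq_simplePair (eq_smul_root_of_add hzpos.mem_posCone h.1.mem_posCone h1)

/-- A positive root and its coroot have pairings of the same sign with a real simple root. -/
theorem PosPair.sameSign (hA : IsBorcherdsCartan A) {z : Dual ℚ 𝔥 × 𝔥} (hz : PosPair R z) {k : I}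
    (hk : A k k = 2) : SameSign (z.1 (R.coroot k)) (R.root k z.2) := by
  obtain ⟨n, hn⟩ := exists_nat_height hz.mem_posRootLattice
  exact (posPair_induction hA n z hz hn.le k hk).1

/-- A real simple reflection permutes the positive roots different from its simple root. -/
theorem PosPair.rPair (hA : IsBorcherdsCartan A) {z : Dual ℚ 𝔥 × 𝔥} (hz : PosPair R z) {k : I}
    (hk : A k k = 2) (hzk : z ≠ R.simplePair k) : PosPair R (R.rPair k z) := by
  obtain ⟨n, hn⟩ := exists_nat_height hz.mem_posRootLattice
  obtain ⟨h1, h2⟩ := posPair_induction hA n z hz hn.le k hk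
  rcases lt_trichotomy (z.1 (R.coroot k)) 0 with h | h | h
  · exact hz.refl hk h
  · rwa [rPair_eq_self h]
    have := h1.neg_of_nonpos h.le
    rw [h] at this
    rcases this with ⟨-, h'⟩ | ⟨h', -⟩
    · simpa using h'
    · simp at h'
  · exact (h2 h).resolve_left hzk

/-- The coroot of a positive root is a sum of simple coroots. -/
theorem PosPair.snd_mem (hA : IsBorcherdsCartan A) {z : Dual ℚ 𝔥 × 𝔥} (hz : PosPair R z) :
    z.2 ∈ AddSubmonoid.closure (Set.range R.coroot) ∧ ∀ k, ∃ n : ℤ, R.root k z.2 = n := by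
  induction hz with
  | simple i =>
    exact ⟨AddSubmonoid.subset_closure (Set.mem_range_self i), fun k => ⟨A i k, R.root_coroot i k⟩⟩
  | @refl k z hk hz hneg ih =>
    obtain ⟨ih1, ih2⟩ := ih
    obtain ⟨n, hn⟩ := ih2 k
    have h0 : n ≤ 0 := by
      have h1 := (hz.sameSign hA hk).neg_of_nonpos hneg.le
      have h2 := h1.symm.nonneg
      rw [hn] at h2
      have : (n : ℚ) ≤ 0 := by linarith
      exact_mod_cast this
    obtain ⟨m, rfl⟩ : ∃ m : ℕ, n = -m := ⟨n.natAbs, by omega⟩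
    refine ⟨?_, fun j => ?_⟩
    · have : R.root k z.2 • R.coroot k = -(m • R.coroot k) := by
        rw [hn, ← Nat.cast_smul_eq_nsmul ℚ]
        push_cast
        rw [neg_smul]
      rw [rPair_snd, this, sub_neg_eq_add]
      exact add_mem ih1 (nsmul_mem (AddSubmonoid.subset_closure (Set.mem_range_self k)) _)
    · obtain ⟨l, hl⟩ := ih2 j
      refine ⟨l + m * A k j, ?_⟩
      rw [rPair_snd, map_sub, map_smul, hl, hn, R.root_coroot]
      push_cast
      rw [smul_eq_mul]
      ring

theorem PosPair.apply_nonneg (hA : IsBorcherdsCartan A) {z : Dual ℚ 𝔥 × 𝔥} (hz : PosPair R z)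
    {μ : Dual ℚ 𝔥} (hμ : ∀ i, 0 ≤ μ (R.coroot i)) : 0 ≤ μ z.2 := by
  have := (hz.snd_mem hA).1
  generalize z.2 = x at this
  induction this using AddSubmonoid.closure_induction with
  | mem x hx =>
    obtain ⟨i, rfl⟩ := hx
    exact hμ i
  | zero => simp
  | add x y _ _ hx hy => rw [map_add]; exact add_nonneg hx hy

variable (R) in
/-- A real simple reflection of `𝔥`. -/
def reflEquiv {k : I} (hk : A k k = 2) : 𝔥 ≃ₗ[ℚ] 𝔥 :=
  LinearEquiv.ofInvolutive
    (LinearMap.id - (R.root k).smulRight (R.coroot k))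
    (fun x => by
      simp only [LinearMap.sub_apply, LinearMap.id_apply, LinearMap.smulRight_apply, map_sub,
        map_smul, root_coroot_self hk]
      module)

theorem reflEquiv_apply {k : I} (hk : A k k = 2) (x : 𝔥) :
    R.reflEquiv hk x = x - R.root k x • R.coroot k := rfl

theorem reflEquiv_mem {k : I} (hk : A k k = 2) : R.reflEquiv hk ∈ R.weylGroup :=
  Subgroup.subset_closure ⟨k, hk, fun x => reflEquiv_apply hk x⟩

theorem eq_reflEquiv {k : I} (hk : A k k = 2) {w : 𝔥 ≃ₗ[ℚ] 𝔥}
    (hw : ∀ x, w x = x - R.root k x • R.coroot k) : w = R.reflEquiv hk :=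
  LinearEquiv.ext hw

theorem reflEquiv_symm {k : I} (hk : A k k = 2) : (R.reflEquiv hk).symm = R.reflEquiv hk := rfl

theorem reflEquiv_dualMap {k : I} (hk : A k k = 2) (x : Dual ℚ 𝔥) :
    (R.reflEquiv hk).dualMap x = R.r k x := by
  ext h
  simp only [LinearEquiv.dualMap_apply, reflEquiv_apply, map_sub, map_smul, r_apply,
    LinearMap.sub_apply, LinearMap.smul_apply, smul_eq_mul]
  ring

theorem PosPair.exists_weyl {z : Dual ℚ 𝔥 × 𝔥} (hz : PosPair R z) : ∃ w ∈ R.weylGroup, ∃ i,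
    z.1 = w.symm.dualMap (R.root i) ∧ z.2 = w (R.coroot i) := by
  induction hz with
  | simple i => exact ⟨1, one_mem _, i, by ext; rfl, rfl⟩
  | @refl k z hk hz hneg ih =>
    obtain ⟨w, hw, i, h1, h2⟩ := ih
    refine ⟨R.reflEquiv hk * w, mul_mem (reflEquiv_mem hk) hw, i, ?_, ?_⟩
    · rw [rPair_fst', ← reflEquiv_dualMap hk, h1]
      ext h
      rfl
    · rw [rPair_snd, h2]
      rfl

/-- The pairs in `PosPair` and their negatives form a set that is stable under the Weyl group. -/
theorem posPair_or_neg_of_weyl (hA : IsBorcherdsCartan A) {w : 𝔥 ≃ₗ[ℚ] 𝔥}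
    (hw : w ∈ R.weylGroup) : ∀ z : Dual ℚ 𝔥 × 𝔥, (PosPair R z ∨ PosPair R (-z)) ↔
    (PosPair R (w.symm.dualMap z.1, w z.2) ∨ PosPair R (-(w.symm.dualMap z.1, w z.2))) := by
  have step : ∀ {k : I} (hk : A k k = 2) (z : Dual ℚ 𝔥 × 𝔥), PosPair R z →
      (PosPair R (R.rPair k z) ∨ PosPair R (-R.rPair k z)) := by
    intro k hk z hz
    by_cases h : z = R.simplePair k
    · right
      rw [h, rPair_simplePair hk, neg_neg]
      exact .simple k
    · exact Or.inl (hz.rPair hA hk h)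
  have refl : ∀ {k : I} (hk : A k k = 2) (z : Dual ℚ 𝔥 × 𝔥), (PosPair R z ∨ PosPair R (-z)) →
      (PosPair R (R.rPair k z) ∨ PosPair R (-R.rPair k z)) := by
    intro k hk z hz
    rcases hz with hz | hz
    · exact step hk z hz
    · have := step hk _ hz
      rwa [map_neg, neg_neg, or_comm] at this
  induction hw using Subgroup.closure_induction with
  | mem w hw =>
    obtain ⟨k, hk, hw⟩ := hw
    rw [eq_reflEquiv hk hw]
    intro z
    have e : ((R.reflEquiv hk).symm.dualMap z.1, R.reflEquiv hk z.2) = R.rPair k z := by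
      ext1
      · rw [reflEquiv_symm, reflEquiv_dualMap, rPair_fst']
      · rfl
    rw [e]
    refine ⟨refl hk z, fun hz => ?_⟩
    have := refl hk _ hz
    rwa [rPair_rPair hk] at this
  | one => exact fun z => Iff.rfl
  | mul v w _ _ hv hw => exact fun z => (hw z).trans (hv _)
  | inv w hw ih =>
    intro z
    have := (ih (w⁻¹.symm.dualMap z.1, w⁻¹ z.2)).symm
    have e : (w.symm.dualMap (w⁻¹.symm.dualMap z.1), w (w⁻¹ z.2)) = z := by
      ext1
      · ext h
        change z.1 (w (w.symm h)) = z.1 h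
        rw [w.apply_symm_apply]
      · exact w.apply_symm_apply z.2
    rwa [e] at this

theorem isPosRoot_iff (hA : IsBorcherdsCartan A) {z : Dual ℚ 𝔥 × 𝔥} :
    R.IsPosRoot z.1 z.2 ↔ PosPair R z := by
  constructor
  · rintro ⟨⟨w, hw, i, h1, h2⟩, hpos⟩
    have := (posPair_or_neg_of_weyl hA hw (R.simplePair i)).1 (Or.inl (.simple i))
    have e : (w.symm.dualMap (R.simplePair i).1, w (R.simplePair i).2) = z := by
      ext1
      · exact h1.symm
      · exact h2.symm
    rw [e] at this
    refine this.resolve_right fun h => h.not_neg ?_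
    simpa using posRootLattice_le_posCone hpos
  · exact fun hz => ⟨hz.exists_weyl, hz.mem_posRootLattice⟩

end Realization
end BorcherdsPath

namespace BorcherdsPath
namespace Realization

variable {I : Type*} {A : Matrix I I ℤ} {𝔥 : Type*} [AddCommGroup 𝔥] [Module ℚ 𝔥]
  {R : Realization A 𝔥}

open Relation

/-! ### The order on weights -/

variable (R) in
/-- One step of the order: `μ = r_β ν` and `β^∨(ν) > 0` for a positive root `β`. -/
def StepRel (μ ν : Dual ℚ 𝔥) : Prop :=
  ∃ z, PosPair R z ∧ μ = ν - ν z.2 • z.1 ∧ 0 < ν z.2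

theorem stepRel_iff (hA : IsBorcherdsCartan A) {μ ν : Dual ℚ 𝔥} :
    R.StepRel μ ν ↔ ∃ β βv, R.Step β βv μ ν := by
  constructor
  · rintro ⟨z, hz, h1, h2⟩
    exact ⟨z.1, z.2, (isPosRoot_iff hA).2 hz, h1, h2⟩
  · rintro ⟨β, βv, h, h1, h2⟩
    exact ⟨(β, βv), (isPosRoot_iff hA).1 h, h1, h2⟩

theorem StepSeq.transGen (hA : IsBorcherdsCartan A) {s : ℕ} {μ ν : Dual ℚ 𝔥}
    (h : R.StepSeq s μ ν) : TransGen R.StepRel μ ν := by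
  induction h with
  | single h => exact .single ((stepRel_iff hA).2 ⟨_, _, h⟩)
  | cons h _ ih => exact .head ((stepRel_iff hA).2 ⟨_, _, h⟩) ih

theorem above_iff (hA : IsBorcherdsCartan A) {μ ν : Dual ℚ 𝔥} :
    R.Above μ ν ↔ TransGen R.StepRel μ ν := by
  constructor
  · rintro ⟨s, h⟩
    exact h.transGen hA
  · intro h
    induction h using TransGen.head_induction_on with
    | single h =>
      obtain ⟨β, βv, h⟩ := (stepRel_iff hA).1 h
      exact ⟨1, .single h⟩
    | head h _ ih =>
      obtain ⟨β, βv, h⟩ := (stepRel_iff hA).1 h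
      obtain ⟨s, hs⟩ := ih
      exact ⟨s + 1, .cons h hs⟩

theorem StepSeq.add {m n : ℕ} {μ κ ν : Dual ℚ 𝔥} (h : R.StepSeq m μ κ) (h' : R.StepSeq n κ ν) :
    R.StepSeq (n + m) μ ν := by
  induction h with
  | single h => exact .cons h h'
  | cons h _ ih => exact .cons h (ih h')

theorem StepSeq.pos {m : ℕ} {μ ν : Dual ℚ 𝔥} (h : R.StepSeq m μ ν) : 0 < m := by
  cases h <;> omega

variable (R) in
/-- `μ` is obtained from `ν` by the reflection in the positive root `z`, and there is no weight
strictly between `μ` and `ν`. -/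
structure Cover (z : Dual ℚ 𝔥 × 𝔥) (μ ν : Dual ℚ 𝔥) : Prop where
  posPair : PosPair R z
  eq : μ = ν - ν z.2 • z.1
  pos : 0 < ν z.2
  no_mid : ∀ κ, TransGen R.StepRel μ κ → TransGen R.StepRel κ ν → False

theorem covers_iff (hA : IsBorcherdsCartan A) {β : Dual ℚ 𝔥} {βv : 𝔥} {μ ν : Dual ℚ 𝔥} :
    R.Covers β βv μ ν ↔ R.Cover (β, βv) μ ν := by
  constructor
  · rintro ⟨⟨h, h1, h2⟩, hd⟩
    refine ⟨(isPosRoot_iff hA).1 h, h1, h2, fun κ hμ hν => ?_⟩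
    obtain ⟨m, hm⟩ := (above_iff hA).2 hμ
    obtain ⟨n, hn⟩ := (above_iff hA).2 hν
    have h3 : ((n + m : ℕ) : ℕ∞) ≤ R.dist μ ν :=
      le_iSup₂ (f := fun (s : ℕ) (_ : R.StepSeq s μ ν) => (s : ℕ∞)) _ (hm.add hn)
    rw [hd] at h3
    have h4 : n + m ≤ 1 := by exact_mod_cast h3
    have := hm.pos
    have := hn.pos
    omega
  · rintro ⟨h, h1, h2, h3⟩
    have hs : R.Step β βv μ ν := ⟨(isPosRoot_iff hA).2 h, h1, h2⟩
    refine ⟨hs, le_antisymm (iSup₂_le fun s hs => ?_) ?_⟩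
    · cases hs with
      | single _ => simp
      | @cons s β βv μ κ ν h t =>
        exact (h3 κ (.single ((stepRel_iff hA).2 ⟨_, _, h⟩)) (t.transGen hA)).elim
    · exact le_iSup₂ (f := fun (s : ℕ) (_ : R.StepSeq s μ ν) => (s : ℕ∞)) 1 (.single hs)

theorem Cover.stepRel {z : Dual ℚ 𝔥 × 𝔥} {μ ν : Dual ℚ 𝔥} (h : R.Cover z μ ν) : R.StepRel μ ν :=
  ⟨z, h.posPair, h.eq, h.pos⟩

theorem StepRel.sub_mem {μ ν : Dual ℚ 𝔥} (h : R.StepRel μ ν) : ν - μ ∈ R.posCone := by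
  obtain ⟨z, hz, rfl, hpos⟩ := h
  rw [sub_sub_cancel]
  exact smul_mem_posCone hpos.le hz.mem_posCone

theorem StepRel.ne {μ ν : Dual ℚ 𝔥} (h : R.StepRel μ ν) : ν - μ ≠ 0 := by
  obtain ⟨z, hz, rfl, hpos⟩ := h
  rw [sub_sub_cancel]
  exact smul_ne_zero hpos.ne' hz.ne_zero

theorem sub_mem_of_reflTransGen {μ ν : Dual ℚ 𝔥} (h : ReflTransGen R.StepRel μ ν) :
    ν - μ ∈ R.posCone := by
  induction h with
  | refl => rw [sub_self]; exact zero_mem _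
  | @tail b c _ h ih =>
    have := add_mem ih h.sub_mem
    rwa [add_comm, sub_add_sub_cancel] at this

theorem transGen_irrefl {μ : Dual ℚ 𝔥} : ¬ TransGen R.StepRel μ μ := by
  intro h
  obtain ⟨κ, h1, h2⟩ := TransGen.head'_iff.1 h
  refine h1.ne (eq_zero_of_neg_mem h1.sub_mem ?_)
  rw [neg_sub]
  exact sub_mem_of_reflTransGen h2

theorem stepRel_simple {ν : Dual ℚ 𝔥} {i : I} (h : 0 < ν (R.coroot i)) :
    R.StepRel (R.r i ν) ν := ⟨R.simplePair i, .simple i, R.r_apply i ν, h⟩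

theorem stepRel_r {μ : Dual ℚ 𝔥} {i : I} (hi : A i i = 2) (h : μ (R.coroot i) < 0) :
    R.StepRel μ (R.r i μ) := by
  have := stepRel_simple (R := R) (ν := R.r i μ) (i := i) (by rw [r_coroot hi]; linarith)
  rwa [r_r hi] at this

theorem r_eq_self {μ : Dual ℚ 𝔥} {i : I} (h : μ (R.coroot i) = 0) : R.r i μ = μ := by
  rw [r_apply, h, zero_smul, sub_zero]

theorem ge_of_nonneg {ν : Dual ℚ 𝔥} {i : I} (h : 0 ≤ ν (R.coroot i)) :
    ReflTransGen R.StepRel (R.r i ν) ν := by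
  rcases h.eq_or_lt with h | h
  · rw [r_eq_self h.symm]
  · exact .single (stepRel_simple h)

theorem r_step_eq {z : Dual ℚ 𝔥 × 𝔥} {μ ν : Dual ℚ 𝔥} {i : I} (hi : A i i = 2)
    (h : μ = ν - ν z.2 • z.1) :
    R.r i μ = R.r i ν - R.r i ν (R.rPair i z).2 • (R.rPair i z).1 := by
  rw [r_apply_rPair hi, h, map_sub, map_smul, rPair_fst']

theorem StepRel.r (hA : IsBorcherdsCartan A) {μ ν : Dual ℚ 𝔥} {i : I} (hi : A i i = 2)
    (h : R.StepRel μ ν) : μ = R.r i ν ∨ R.StepRel (R.r i μ) (R.r i ν) := by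
  obtain ⟨z, hz, h1, h2⟩ := h
  by_cases hzi : z = R.simplePair i
  · left
    rw [h1, hzi, r_apply]
    rfl
  · exact Or.inr ⟨R.rPair i z, hz.rPair hA hi hzi, r_step_eq hi h1, by rwa [r_apply_rPair hi]⟩

/-- The lifting property of the order. -/
theorem reflTransGen_flip (hA : IsBorcherdsCartan A) {μ ν : Dual ℚ 𝔥} {i : I} (hi : A i i = 2)
    (h : ReflTransGen R.StepRel μ ν) : ReflTransGen R.StepRel (R.r i μ) (R.r i ν) ∨
      (ReflTransGen R.StepRel (R.r i μ) ν ∧ ReflTransGen R.StepRel μ (R.r i ν)) := by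
  induction h using ReflTransGen.head_induction_on with
  | refl => exact Or.inl .refl
  | @head μ κ h hκ ih =>
    rcases h.r hA hi with rfl | h'
    · right
      rw [r_r hi]
      refine ⟨hκ, ?_⟩
      rcases ih with ih | ih
      · exact ih
      · exact .head h ih.2
    · rcases ih with ih | ih
      · exact Or.inl (.head h' ih)
      · exact Or.inr ⟨.head h' ih.1, .head h ih.2⟩

theorem transGen_flip (hA : IsBorcherdsCartan A) {μ ν : Dual ℚ 𝔥} {i : I} (hi : A i i = 2)
    (h : TransGen R.StepRel μ ν) : TransGen R.StepRel (R.r i μ) (R.r i ν) ∨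
      (ReflTransGen R.StepRel (R.r i μ) ν ∧ ReflTransGen R.StepRel μ (R.r i ν)) := by
  obtain ⟨κ, h1, h2⟩ := TransGen.head'_iff.1 h
  rcases h1.r hA hi with rfl | h'
  · right
    rw [r_r hi]
    refine ⟨h2, ?_⟩
    rcases reflTransGen_flip hA hi h2 with h3 | h3
    · exact h3
    · exact .head h1 h3.2
  · rcases reflTransGen_flip hA hi h2 with h3 | h3
    · exact Or.inl (.head' h' h3)
    · exact Or.inr ⟨.head h' h3.1, .head h1 h3.2⟩

/-! ### Covers -/

/-- A cover along which the pairing with a real simple root changes sign is the reflection in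
this simple root. -/
theorem Cover.eq_simplePair (hA : IsBorcherdsCartan A) {z : Dual ℚ 𝔥 × 𝔥} {μ ν : Dual ℚ 𝔥}
    (h : R.Cover z μ ν) {i : I} (hi : A i i = 2) (hμ : μ (R.coroot i) ≤ 0)
    (hν : 0 ≤ ν (R.coroot i)) (hne : μ (R.coroot i) < 0 ∨ 0 < ν (R.coroot i)) :
    z = R.simplePair i := by
  by_contra hz
  have hr : R.StepRel (R.r i μ) (R.r i ν) :=
    ⟨R.rPair i z, h.posPair.rPair hA hi hz, r_step_eq hi h.eq, by
      rw [r_apply_rPair hi]; exact h.pos⟩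
  -- `μ ≥ r_i μ > r_i ν ≥ ν`, and one of the outer relations is strict
  rcases hne with hne | hne
  · exact h.no_mid _ (.single (stepRel_r hi hne)) (.head' hr (ge_of_nonneg hν))
  · refine h.no_mid _ (.tail' ?_ hr) (.single (stepRel_simple hne))
    have := ge_of_nonneg (R := R) (ν := R.r i μ) (i := i) (by rw [r_coroot hi]; linarith)
    rwa [r_r hi] at this

/-- Covers that do not change the sign of the pairing with a real simple root are preserved by
its reflection. -/
theorem Cover.r (hA : IsBorcherdsCartan A) {z : Dual ℚ 𝔥 × 𝔥} {μ ν : Dual ℚ 𝔥}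
    (h : R.Cover z μ ν) {i : I} (hi : A i i = 2)
    (hs : (0 < μ (R.coroot i) ∧ 0 < ν (R.coroot i)) ∨
      (μ (R.coroot i) < 0 ∧ ν (R.coroot i) < 0)) :
    R.Cover (R.rPair i z) (R.r i μ) (R.r i ν) := by
  have hz : z ≠ R.simplePair i := by
    rintro rfl
    have h1 : μ = R.r i ν := by rw [h.eq, r_apply]; rfl
    have h2 := r_coroot (R := R) hi ν
    rw [← h1] at h2
    rcases hs with hs | hs <;> linarith [hs.1, hs.2]
  refine ⟨h.posPair.rPair hA hi hz, r_step_eq hi h.eq, by rw [r_apply_rPair hi]; exact h.pos,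
    fun κ h1 h2 => ?_⟩
  have f1 := transGen_flip hA hi h1
  have f2 := transGen_flip hA hi h2
  rw [r_r hi] at f1 f2
  rcases hs with ⟨hμ, hν⟩ | ⟨hμ, hν⟩
  · have hs := stepRel_simple hν
    rcases f2 with f2 | f2
    · rcases f1 with f1 | f1
      · exact h.no_mid _ f1 f2
      · exact h.no_mid _ (TransGen.trans_right f1.1 h2) (.single hs)
    · rcases f1 with f1 | f1
      · exact h.no_mid _ (f1.trans_left f2.1) (.single hs)
      · exact h.no_mid _ (TransGen.trans_right f1.1 h2) (.single hs)
  · have hs := stepRel_r hi hμ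
    rcases f2 with f2 | f2
    · rcases f1 with f1 | f1
      · exact h.no_mid _ f1 f2
      · exact h.no_mid _ (.single hs) (TransGen.trans_right f1.2 f2)
    · exact h.no_mid _ (.single hs) (h1.trans_left f2.2)

theorem cover_simple {ν : Dual ℚ 𝔥} {i : I} (h : 0 < ν (R.coroot i)) :
    R.Cover (R.simplePair i) (R.r i ν) ν := by
  refine ⟨.simple i, R.r_apply i ν, h, fun κ h1 h2 => ?_⟩
  -- The last step from `κ` to `ν` subtracts a multiple of `α_i`, so it is already `r_i`.
  obtain ⟨κ', h3, h4⟩ := TransGen.tail'_iff.1 h2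
  have h5 := sub_mem_of_reflTransGen (h1.to_reflTransGen.trans h3)
  have h6 : (ν - κ') + (κ' - R.r i ν) = ν (R.coroot i) • R.root i := by
    rw [r_apply]; abel
  have h7 := eq_smul_root_of_add h4.sub_mem h5 h6
  obtain ⟨z, hz, h8, h9⟩ := h4
  have h10 : z.1 = ((ν z.2)⁻¹ * R.coord (ν - κ') i) • R.root i := by
    rw [mul_smul, ← h7, h8, sub_sub_cancel, inv_smul_smul₀ h9.ne']
  have h11 : κ' = R.r i ν := by
    rw [h8, hz.eq_simplePair h10, r_apply]
    rfl
  rw [h11] at h3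
  exact transGen_irrefl (h1.trans_left h3)

theorem reflTransGen_coroot_le (hA : IsBorcherdsCartan A) {i : I} (hi : A i i ≠ 2)
    {μ ν : Dual ℚ 𝔥} (h : ReflTransGen R.StepRel μ ν) : ν (R.coroot i) ≤ μ (R.coroot i) := by
  have := posCone_coroot_nonpos hA hi (sub_mem_of_reflTransGen h)
  rw [LinearMap.sub_apply] at this
  linarith

/-- For imaginary `i`, steps that do not change the pairing with `α_i` commute with translations
by multiples of `α_i`. -/
theorem stepRel_add_smul (hA : IsBorcherdsCartan A) {i : I} (hi : A i i ≠ 2) {z : Dual ℚ 𝔥 × 𝔥}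
    {μ ν : Dual ℚ 𝔥} (hz : PosPair R z) (h : μ = ν - ν z.2 • z.1) (hpos : 0 < ν z.2)
    (heq : μ (R.coroot i) = ν (R.coroot i)) (q : ℚ) :
    (ν + q • R.root i) z.2 = ν z.2 ∧
    μ + q • R.root i = ν + q • R.root i - (ν + q • R.root i) z.2 • z.1 := by
  have h1 : z.1 (R.coroot i) = 0 := by
    rw [h, LinearMap.sub_apply, LinearMap.smul_apply, smul_eq_mul] at heq
    have : ν z.2 * z.1 (R.coroot i) = 0 := by linarith
    exact (mul_eq_zero.1 this).resolve_left hpos.ne'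
  have h2 : (ν + q • R.root i) z.2 = ν z.2 := by
    rw [LinearMap.add_apply, LinearMap.smul_apply, hz.coord_coroot hA hi h1, smul_zero, add_zero]
  refine ⟨h2, ?_⟩
  rw [h2, h]
  abel

theorem transGen_add_smul (hA : IsBorcherdsCartan A) {i : I} (hi : A i i ≠ 2)
    {μ ν : Dual ℚ 𝔥} (h : TransGen R.StepRel μ ν) (heq : μ (R.coroot i) = ν (R.coroot i)) (q : ℚ) :
    TransGen R.StepRel (μ + q • R.root i) (ν + q • R.root i) := by
  induction h using TransGen.head_induction_on with
  | @single μ h =>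
    obtain ⟨z, hz, h1, h2⟩ := h
    obtain ⟨h3, h4⟩ := stepRel_add_smul hA hi hz h1 h2 heq q
    exact .single ⟨z, hz, h4, by rwa [h3]⟩
  | @head μ κ h hκ ih =>
    have e1 := reflTransGen_coroot_le hA hi (.single h)
    have e2 := reflTransGen_coroot_le hA hi hκ.to_reflTransGen
    have e3 : κ (R.coroot i) = ν (R.coroot i) := by linarith
    obtain ⟨z, hz, h1, h2⟩ := h
    obtain ⟨h3, h4⟩ := stepRel_add_smul hA hi hz h1 h2 (by linarith) q
    exact .head ⟨z, hz, h4, by rwa [h3]⟩ (ih e3)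

theorem r_coroot_im {i : I} (x : Dual ℚ 𝔥) :
    R.r i x (R.coroot i) = (1 - A i i) * x (R.coroot i) := by
  simp only [r_apply, LinearMap.sub_apply, LinearMap.smul_apply, R.root_coroot, smul_eq_mul]
  ring

/-- Covers that do not change the pairing with an imaginary simple root `α_i` are preserved by
`r_i`. -/
theorem Cover.r_im (hA : IsBorcherdsCartan A) {z : Dual ℚ 𝔥 × 𝔥} {μ ν : Dual ℚ 𝔥}
    (h : R.Cover z μ ν) {i : I} (hi : A i i ≠ 2) (heq : μ (R.coroot i) = ν (R.coroot i)) :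
    R.Cover z (R.r i μ) (R.r i ν) ∧ R.r i ν z.2 = ν z.2 := by
  have e1 : R.r i μ = μ + (-ν (R.coroot i)) • R.root i := by rw [r_apply, heq]; module
  have e2 : R.r i ν = ν + (-ν (R.coroot i)) • R.root i := by rw [r_apply]; module
  obtain ⟨h1, h2⟩ := stepRel_add_smul hA hi h.posPair h.eq h.pos heq (-ν (R.coroot i))
  rw [e1, e2]
  refine ⟨⟨h.posPair, h2, by rw [h1]; exact h.pos, fun κ h3 h4 => ?_⟩, h1⟩
  have l1 := reflTransGen_coroot_le hA hi h3.to_reflTransGen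
  have l2 := reflTransGen_coroot_le hA hi h4.to_reflTransGen
  simp only [LinearMap.add_apply, heq] at l1 l2
  have t1 := transGen_add_smul hA hi h3 (by simp only [LinearMap.add_apply, heq]; linarith)
    (ν (R.coroot i))
  have t2 := transGen_add_smul hA hi h4 (by simp only [LinearMap.add_apply]; linarith)
    (ν (R.coroot i))
  refine h.no_mid (κ + ν (R.coroot i) • R.root i) ?_ ?_
  · convert t1 using 1; module
  · convert t2 using 1; module

/-! ### The orbit of a dominant weight -/

theorem r_mem_orbit {lam μ : Dual ℚ 𝔥} (h : μ ∈ R.orbit lam) (i : I) : R.r i μ ∈ R.orbit lam := by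
  obtain ⟨τ, hτ, rfl⟩ := h
  exact ⟨R.r i * τ, mul_mem (Submonoid.subset_closure ⟨i, rfl⟩) hτ, rfl⟩

theorem self_mem_orbit (lam : Dual ℚ 𝔥) : lam ∈ R.orbit lam := ⟨1, one_mem _, rfl⟩

theorem orbit_ge (hA : IsBorcherdsCartan A) {lam : Dual ℚ 𝔥} (hlam : lam ∈ R.dominantWeights)
    {μ : Dual ℚ 𝔥} (h : μ ∈ R.orbit lam) : ReflTransGen R.StepRel μ lam := by
  obtain ⟨τ, hτ, rfl⟩ := h
  induction hτ using Submonoid.closure_induction_left with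
  | one => exact .refl
  | mul_left x hx τ hτ ih =>
    obtain ⟨i, rfl⟩ := hx
    rw [Module.End.mul_apply]
    generalize τ lam = μ at ih
    rcases le_or_gt 0 (μ (R.coroot i)) with h | h
    · exact (ge_of_nonneg h).trans ih
    · by_cases hi : A i i = 2
      · rcases reflTransGen_flip hA hi ih with h1 | h1
        · exact h1.trans (ge_of_nonneg (hlam.2 i))
        · exact h1.1
      · have := reflTransGen_coroot_le hA hi ih
        linarith [hlam.2 i]

theorem orbit_coroot_nonneg (hA : IsBorcherdsCartan A) {lam : Dual ℚ 𝔥}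
    (hlam : lam ∈ R.dominantWeights) {μ : Dual ℚ 𝔥} (h : μ ∈ R.orbit lam) {i : I}
    (hi : A i i ≠ 2) : 0 ≤ μ (R.coroot i) :=
  (hlam.2 i).trans (reflTransGen_coroot_le hA hi (orbit_ge hA hlam h))

theorem orbit_posPair_nonneg (hA : IsBorcherdsCartan A) {lam : Dual ℚ 𝔥}
    (hlam : lam ∈ R.dominantWeights) {z : Dual ℚ 𝔥 × 𝔥} (hz : PosPair R z) (him : z.1 z.2 ≠ 2) :
    ∀ {μ : Dual ℚ 𝔥}, μ ∈ R.orbit lam → 0 ≤ μ z.2 := by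
  induction hz with
  | simple i =>
    refine fun h => orbit_coroot_nonneg hA hlam h fun h' => him ?_
    exact root_coroot_self h'
  | @refl k z hk hz _ ih =>
    intro μ hμ
    rw [rPair_fst', r_apply_rPair hk] at him
    have := ih him (r_mem_orbit hμ k)
    have e := r_apply_rPair (R := R) hk (R.r k μ) z
    rw [r_r hk] at e
    rwa [e]

/-- If a weight of the orbit is dominant, then the covers below it are the reflections in
imaginary simple roots. -/
theorem Cover.exists_imaginary (hA : IsBorcherdsCartan A) {lam : Dual ℚ 𝔥}
    (hlam : lam ∈ R.dominantWeights) {z : Dual ℚ 𝔥 × 𝔥} {μ ν : Dual ℚ 𝔥} (h : R.Cover z μ ν)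
    (hμo : μ ∈ R.orbit lam) (hνo : ν ∈ R.orbit lam)
    (hμ : ∀ i, A i i = 2 → 0 ≤ μ (R.coroot i)) : ∃ i, A i i ≠ 2 ∧ z = R.simplePair i := by
  have hμ' : ∀ i, 0 ≤ μ (R.coroot i) := fun i => by
    by_cases hi : A i i = 2
    · exact hμ i hi
    · exact orbit_coroot_nonneg hA hlam hμo hi
  have him : z.1 z.2 ≠ 2 := by
    intro h2
    have h3 := h.posPair.apply_nonneg hA hμ'
    rw [h.eq, LinearMap.sub_apply, LinearMap.smul_apply, h2, smul_eq_mul] at h3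
    linarith [h.pos]
  have hz := h.posPair
  cases hz with
  | simple i => exact ⟨i, fun h' => him (root_coroot_self h'), rfl⟩
  | @refl j w hj hw hneg =>
    exfalso
    set z := R.rPair j w with hzdef
    obtain ⟨k, hk⟩ := exists_int_coroot h.posPair.mem_posRootLattice j
    obtain ⟨m, hm⟩ := (h.posPair.snd_mem hA).2 j
    have hkpos : 0 < z.1 (R.coroot j) := by
      rw [hzdef, rPair_fst', r_coroot hj]; linarith
    have hmpos : 0 < R.root j z.2 := (h.posPair.sameSign hA hj).pos hkpos
    have hk1 : 1 ≤ z.1 (R.coroot j) := by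
      rw [hk] at hkpos ⊢
      have : 0 < k := by exact_mod_cast hkpos
      exact_mod_cast this
    have hm1 : 1 ≤ R.root j z.2 := by
      rw [hm] at hmpos ⊢
      have : 0 < m := by exact_mod_cast hmpos
      exact_mod_cast this
    have hw2 : w.2 = z.2 - R.root j z.2 • R.coroot j := by
      rw [← rPair_snd, hzdef, rPair_rPair hj]
    have him' : w.1 w.2 ≠ 2 := by
      rwa [hzdef, rPair_fst', r_apply_rPair hj] at him
    have hn := orbit_posPair_nonneg hA hlam hw him' hνo
    rw [hw2, map_sub, map_smul, smul_eq_mul] at hn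
    have hμj := hμ' j
    have hμj' : μ (R.coroot j) = ν (R.coroot j) - ν z.2 * z.1 (R.coroot j) := by
      rw [h.eq, LinearMap.sub_apply, LinearMap.smul_apply, smul_eq_mul]
    have hpos := h.pos
    have hνj : 0 < ν (R.coroot j) := by nlinarith
    have hzero : μ (R.coroot j) = 0 := by nlinarith
    have hne : z ≠ R.simplePair j := fun h' => him (by rw [h']; exact root_coroot_self hj)
    have hs : R.StepRel μ (R.r j ν) := by
      rw [← r_eq_self hzero]
      exact ⟨R.rPair j z, h.posPair.rPair hA hj hne, r_step_eq hj h.eq, by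
        rw [r_apply_rPair hj]; exact hpos⟩
    exact h.no_mid _ (.single hs) (.single (stepRel_simple hνj))

end Realization
end BorcherdsPath

namespace BorcherdsPath
namespace Realization

variable {I : Type*} {A : Matrix I I ℤ} {𝔥 : Type*} [AddCommGroup 𝔥] [Module ℚ 𝔥]
  {R : Realization A 𝔥}

open Relation

/-! ### Chains -/

theorem link_iff (hA : IsBorcherdsCartan A) {lam : Dual ℚ 𝔥} {a : ℚ} {μ ν : Dual ℚ 𝔥} :
    R.Link lam a μ ν ↔ μ ∈ R.orbit lam ∧ ν ∈ R.orbit lam ∧ ∃ z, R.Cover z μ ν ∧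
      (z.1 z.2 = 2 → ∃ n : ℕ, 0 < n ∧ a * ν z.2 = n) ∧ (z.1 z.2 ≤ 0 → a * ν z.2 = 1) := by
  simp only [Link, covers_iff hA, Prod.exists]

theorem exists_nat_of_cover (hA : IsBorcherdsCartan A) {a : ℚ} {z : Dual ℚ 𝔥 × 𝔥}
    {μ ν : Dual ℚ 𝔥} (h : R.Cover z μ ν) (h2 : z.1 z.2 = 2 → ∃ n : ℕ, 0 < n ∧ a * ν z.2 = n)
    (h0 : z.1 z.2 ≤ 0 → a * ν z.2 = 1) : ∃ n : ℕ, a * ν z.2 = n := by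
  obtain ⟨i, hi⟩ := h.posPair.diag
  rcases hA.diag i with h' | h'
  · obtain ⟨n, -, hn⟩ := h2 (by rw [hi, h']; norm_num)
    exact ⟨n, hn⟩
  · exact ⟨1, by rw [h0 (by rw [hi]; exact_mod_cast h')]; norm_num⟩

section Link

variable {lam : Dual ℚ 𝔥} {a : ℚ} {μ ν : Dual ℚ 𝔥}

theorem Link.stepRel (hA : IsBorcherdsCartan A) (h : R.Link lam a μ ν) : R.StepRel μ ν := by
  obtain ⟨-, -, z, h, -⟩ := (link_iff hA).1 h
  exact h.stepRel

theorem Link.smul_sub_mem (hA : IsBorcherdsCartan A) (h : R.Link lam a μ ν) :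
    a • (ν - μ) ∈ R.posRootLattice := by
  obtain ⟨-, -, z, h, h1, h2⟩ := (link_iff hA).1 h
  obtain ⟨n, hn⟩ := exists_nat_of_cover hA h h1 h2
  rw [h.eq, sub_sub_cancel, smul_smul, hn, Nat.cast_smul_eq_nsmul]
  exact nsmul_mem h.posPair.mem_posRootLattice n

theorem chain_ge (hA : IsBorcherdsCartan A) (h : ReflTransGen (R.Link lam a) μ ν) :
    ReflTransGen R.StepRel μ ν :=
  ReflTransGen.mono (fun _ _ h => h.stepRel hA) _ _ h

theorem chain_smul_sub_mem (hA : IsBorcherdsCartan A) (h : ReflTransGen (R.Link lam a) μ ν) :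
    a • (ν - μ) ∈ R.posRootLattice := by
  induction h with
  | refl => rw [sub_self, smul_zero]; exact zero_mem _
  | @tail b c _ h ih =>
    have := add_mem ih (h.smul_sub_mem hA)
    rwa [← smul_add, add_comm, sub_add_sub_cancel] at this

theorem chain_exists_int (hA : IsBorcherdsCartan A) (h : ReflTransGen (R.Link lam a) μ ν)
    (i : I) : ∃ n : ℤ, a * ν (R.coroot i) - a * μ (R.coroot i) = n := by
  obtain ⟨n, hn⟩ := exists_int_coroot (chain_smul_sub_mem hA h) i
  refine ⟨n, ?_⟩
  rw [← hn, LinearMap.smul_apply, LinearMap.sub_apply, smul_eq_mul]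
  ring

theorem chain_mem_orbit (h : ReflTransGen (R.Link lam a) μ ν) (hν : ν ∈ R.orbit lam) :
    μ ∈ R.orbit lam := by
  obtain rfl | ⟨κ, h, -⟩ := ReflTransGen.cases_head h
  · exact hν
  · exact h.1

/-- Across a link along which the pairing with a real simple root changes sign. -/
theorem Link.eq_r (hA : IsBorcherdsCartan A) {i : I} (hi : A i i = 2) (h : R.Link lam a μ ν)
    (hμ : μ (R.coroot i) ≤ 0) (hν : 0 ≤ ν (R.coroot i))
    (hne : μ (R.coroot i) < 0 ∨ 0 < ν (R.coroot i)) :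
    μ = R.r i ν ∧ ∃ n : ℤ, a * ν (R.coroot i) = n := by
  obtain ⟨-, -, z, h, h1, h2⟩ := (link_iff hA).1 h
  obtain ⟨n, hn⟩ := exists_nat_of_cover hA h h1 h2
  obtain rfl := h.eq_simplePair hA hi hμ hν hne
  exact ⟨by rw [r_apply]; exact h.eq, n, by exact_mod_cast hn⟩

theorem Link.r (hA : IsBorcherdsCartan A) {i : I} (hi : A i i = 2) (h : R.Link lam a μ ν)
    (hs : (0 < μ (R.coroot i) ∧ 0 < ν (R.coroot i)) ∨
      (μ (R.coroot i) < 0 ∧ ν (R.coroot i) < 0)) : R.Link lam a (R.r i μ) (R.r i ν) := by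
  obtain ⟨ho, ho', z, h, h1, h2⟩ := (link_iff hA).1 h
  refine (link_iff hA).2 ⟨r_mem_orbit ho i, r_mem_orbit ho' i, _, h.r hA hi hs, ?_⟩
  rw [rPair_fst', r_apply_rPair hi, r_apply_rPair hi]
  exact ⟨h1, h2⟩

theorem link_simple (hA : IsBorcherdsCartan A) {i : I} (ho : ν ∈ R.orbit lam)
    (hν : 0 < ν (R.coroot i)) (h2 : A i i = 2 → ∃ n : ℕ, 0 < n ∧ a * ν (R.coroot i) = n)
    (h0 : A i i ≠ 2 → a * ν (R.coroot i) = 1) : R.Link lam a (R.r i ν) ν := by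
  refine (link_iff hA).2 ⟨r_mem_orbit ho i, ho, _, cover_simple hν, fun h => h2 ?_,
    fun h => h0 ?_⟩
  · rw [simplePair, R.root_coroot] at h
    exact_mod_cast h
  · rw [simplePair, R.root_coroot] at h
    intro h'
    rw [h'] at h
    norm_num at h

/-- At a change of sign of the pairing with a real simple root, the value of `a` times the
pairing is an integer. -/
theorem chain_int_of_nonpos_of_nonneg (hA : IsBorcherdsCartan A) {i : I} (hi : A i i = 2)
    (h : ReflTransGen (R.Link lam a) μ ν) (hμ : μ (R.coroot i) ≤ 0) (hν : 0 ≤ ν (R.coroot i)) :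
    ∃ n : ℤ, a * ν (R.coroot i) = n := by
  induction h using ReflTransGen.head_induction_on with
  | refl => exact ⟨0, by simp [le_antisymm hμ hν]⟩
  | @head μ κ h hκ ih =>
    rcases le_or_gt (κ (R.coroot i)) 0 with hk | hk
    · exact ih hk
    · obtain ⟨-, n, hn⟩ := h.eq_r hA hi hμ hk.le (Or.inr hk)
      obtain ⟨m, hm⟩ := chain_exists_int hA hκ i
      exact ⟨m + n, by push_cast; linarith⟩

theorem chain_r_of_pos (hA : IsBorcherdsCartan A) {i : I} (hi : A i i = 2)
    (h : ReflTransGen (R.Link lam a) μ ν) (hν : 0 < ν (R.coroot i))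
    (hint : ∀ n : ℤ, a * ν (R.coroot i) ≠ n) :
    0 < μ (R.coroot i) ∧ ReflTransGen (R.Link lam a) (R.r i μ) (R.r i ν) := by
  induction h using ReflTransGen.head_induction_on with
  | refl => exact ⟨hν, .refl⟩
  | @head μ κ h hκ ih =>
    obtain ⟨ih1, ih2⟩ := ih
    have hμ : 0 < μ (R.coroot i) := by
      by_contra hμ
      obtain ⟨-, n, hn⟩ := h.eq_r hA hi (not_lt.1 hμ) ih1.le (Or.inr ih1)
      obtain ⟨m, hm⟩ := chain_exists_int hA hκ i
      exact hint (m + n) (by push_cast; linarith)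
    exact ⟨hμ, .head (h.r hA hi (Or.inl ⟨hμ, ih1⟩)) ih2⟩

theorem chain_r_of_neg (hA : IsBorcherdsCartan A) {i : I} (hi : A i i = 2)
    (h : ReflTransGen (R.Link lam a) μ ν) (hμ : μ (R.coroot i) < 0)
    (hint : ∀ n : ℤ, a * μ (R.coroot i) ≠ n) :
    ν (R.coroot i) < 0 ∧ ReflTransGen (R.Link lam a) (R.r i μ) (R.r i ν) := by
  induction h with
  | refl => exact ⟨hμ, .refl⟩
  | @tail κ ν hκ h ih =>
    obtain ⟨ih1, ih2⟩ := ih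
    have hν : ν (R.coroot i) < 0 := by
      by_contra hν
      obtain ⟨-, n, hn⟩ := h.eq_r hA hi ih1.le (not_lt.1 hν) (Or.inl ih1)
      obtain ⟨m, hm⟩ := chain_exists_int hA (hκ.tail h) i
      exact hint (n - m) (by push_cast; linarith)
    exact ⟨hν, .tail ih2 (h.r hA hi (Or.inr ⟨ih1, hν⟩))⟩

theorem chain_r_right (hA : IsBorcherdsCartan A) {i : I} (hi : A i i = 2)
    (h : ReflTransGen (R.Link lam a) μ ν) (hμ : μ (R.coroot i) ≤ 0) (hν : 0 < ν (R.coroot i)) :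
    ReflTransGen (R.Link lam a) μ (R.r i ν) := by
  have key : ReflTransGen (R.Link lam a) μ (R.r i ν) ∨
      (0 < μ (R.coroot i) ∧ ReflTransGen (R.Link lam a) (R.r i μ) (R.r i ν)) := by
    clear hμ
    induction h using ReflTransGen.head_induction_on with
    | refl => exact Or.inr ⟨hν, .refl⟩
    | @head μ κ h hκ ih =>
      rcases ih with ih | ⟨ih1, ih2⟩
      · exact Or.inl (.head h ih)
      · rcases lt_or_ge 0 (μ (R.coroot i)) with hμ | hμ
        · exact Or.inr ⟨hμ, .head (h.r hA hi (Or.inl ⟨hμ, ih1⟩)) ih2⟩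
        · rw [(h.eq_r hA hi hμ ih1.le (Or.inr ih1)).1]
          exact Or.inl ih2
  exact key.resolve_right fun h => absurd h.1 (not_lt.2 hμ)

theorem chain_r_left (hA : IsBorcherdsCartan A) {i : I} (hi : A i i = 2)
    (h : ReflTransGen (R.Link lam a) μ ν) (hμ : μ (R.coroot i) < 0) (hν : 0 ≤ ν (R.coroot i)) :
    ReflTransGen (R.Link lam a) (R.r i μ) ν := by
  have key : ReflTransGen (R.Link lam a) (R.r i μ) ν ∨
      (ν (R.coroot i) < 0 ∧ ReflTransGen (R.Link lam a) (R.r i μ) (R.r i ν)) := by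
    clear hν
    induction h with
    | refl => exact Or.inr ⟨hμ, .refl⟩
    | @tail κ ν hκ h ih =>
      rcases ih with ih | ⟨ih1, ih2⟩
      · exact Or.inl (.tail ih h)
      · rcases lt_or_ge (ν (R.coroot i)) 0 with hν | hν
        · exact Or.inr ⟨hν, .tail ih2 (h.r hA hi (Or.inr ⟨ih1, hν⟩))⟩
        · rw [(h.eq_r hA hi ih1.le hν (Or.inl ih1)).1, r_r hi] at ih2
          exact Or.inl ih2
  exact key.resolve_right fun h => absurd h.1 (not_lt.2 hν)

theorem chain_coroot_le (hA : IsBorcherdsCartan A) {i : I} (hi : A i i ≠ 2)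
    (h : ReflTransGen (R.Link lam a) μ ν) : ν (R.coroot i) ≤ μ (R.coroot i) :=
  reflTransGen_coroot_le hA hi (chain_ge hA h)

theorem chain_r_im (hA : IsBorcherdsCartan A) {i : I} (hi : A i i ≠ 2)
    (h : ReflTransGen (R.Link lam a) μ ν) (heq : μ (R.coroot i) = ν (R.coroot i)) :
    ReflTransGen (R.Link lam a) (R.r i μ) (R.r i ν) := by
  induction h using ReflTransGen.head_induction_on with
  | refl => exact .refl
  | @head μ κ h hκ ih =>
    have e1 := chain_coroot_le hA hi (.single h)
    have e2 := chain_coroot_le hA hi hκ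
    have e3 : κ (R.coroot i) = ν (R.coroot i) := by linarith
    refine .head ?_ (ih e3)
    obtain ⟨ho, ho', z, h, h1, h2⟩ := (link_iff hA).1 h
    obtain ⟨h3, h4⟩ := h.r_im hA hi (by linarith)
    refine (link_iff hA).2 ⟨r_mem_orbit ho i, r_mem_orbit ho' i, z, h3, ?_⟩
    rw [h4]
    exact ⟨h1, h2⟩

/-- The first link of a chain that starts at a weight which is dominant for the real simple roots
is the reflection in an imaginary simple root. -/
theorem Link.exists_imaginary (hA : IsBorcherdsCartan A) (hlam : lam ∈ R.dominantWeights)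
    (h : R.Link lam a μ ν) (hμ : ∀ i, A i i = 2 → 0 ≤ μ (R.coroot i)) :
    ∃ i, A i i ≠ 2 ∧ μ = R.r i ν ∧ 0 < ν (R.coroot i) ∧ a * ν (R.coroot i) = 1 := by
  obtain ⟨ho, ho', z, h, h1, h2⟩ := (link_iff hA).1 h
  obtain ⟨i, hi, rfl⟩ := h.exists_imaginary hA hlam ho ho' hμ
  refine ⟨i, hi, by rw [r_apply]; exact h.eq, h.pos, h2 ?_⟩
  rw [simplePair, R.root_coroot]
  exact_mod_cast IsBorcherdsCartan.le_zero_of_ne_two hA hi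

end Link

end Realization
end BorcherdsPath

namespace BorcherdsPath

/-! ### Piecewise linear maps -/

/-- `π` has velocity `v j` between the consecutive break points `a j` and `a (j + 1)`, where
`0 = a 0 < a 1 < ⋯ < a s = 1`. -/
structure PiecewiseLinear {E : Type*} [AddCommGroup E] [Module ℚ E] (π : UnitQ → E) (s : ℕ)
    (v : ℕ → E) (a : ℕ → ℚ) : Prop where
  a_zero : a 0 = 0
  a_last : a s = 1
  a_lt : ∀ j, j < s → a j < a (j + 1)
  lin : ∀ j, j < s → ∀ t u : UnitQ, a j ≤ t → (t : ℚ) ≤ a (j + 1) → a j ≤ u →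
    (u : ℚ) ≤ a (j + 1) → π u = π t + ((u : ℚ) - t) • v j

/-- The break point `a j` as an element of the unit interval. -/
def node (a : ℕ → ℚ) (j : ℕ) : UnitQ := Set.projIcc 0 1 zero_le_one (a j)

namespace PiecewiseLinear

theorem exists_lt_le {a : ℕ → ℚ} {t : ℚ} {x y : ℕ} (hxy : x < y) (h1 : a x ≤ t)
    (h2 : t ≤ a y) : ∃ j, x ≤ j ∧ j < y ∧ a j ≤ t ∧ t ≤ a (j + 1) := by
  induction y, hxy using Nat.le_induction with
  | base => exact ⟨x, le_rfl, by omega, h1, h2⟩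
  | succ y hxy ih =>
    rcases le_total t (a y) with h3 | h3
    · obtain ⟨j, h4, h5, h6⟩ := ih h3
      exact ⟨j, h4, by omega, h6⟩
    · exact ⟨y, by omega, by omega, h3, h2⟩

section Module

variable {E : Type*} [AddCommGroup E] [Module ℚ E] {π : UnitQ → E} {s : ℕ} {v : ℕ → E} {a : ℕ → ℚ}

theorem a_strict (h : PiecewiseLinear π s v a) {i j : ℕ} (hij : i < j) (hj : j ≤ s) :
    a i < a j := by
  induction j, hij using Nat.le_induction with
  | base => exact h.a_lt i hj
  | succ k hk ih => exact (ih (by omega)).trans (h.a_lt k hj)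

theorem a_mono (h : PiecewiseLinear π s v a) {i j : ℕ} (hij : i ≤ j) (hj : j ≤ s) :
    a i ≤ a j := by
  rcases hij.eq_or_lt with rfl | hij
  · exact le_rfl
  · exact (h.a_strict hij hj).le

theorem a_lt_iff (h : PiecewiseLinear π s v a) {i j : ℕ} (hi : i ≤ s) (hj : j ≤ s) :
    a i < a j ↔ i < j := by
  refine ⟨fun h' => ?_, fun h' => h.a_strict h' hj⟩
  by_contra hij
  exact absurd (h.a_mono (not_lt.1 hij) hi) (not_le.2 h')

theorem a_le_iff (h : PiecewiseLinear π s v a) {i j : ℕ} (hi : i ≤ s) (hj : j ≤ s) :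
    a i ≤ a j ↔ i ≤ j := by
  rw [← not_lt, h.a_lt_iff hj hi, not_lt]

theorem coe_node (h : PiecewiseLinear π s v a) {j : ℕ} (hj : j ≤ s) : (node a j : ℚ) = a j := by
  have h0 : 0 ≤ a j := h.a_zero ▸ h.a_mono (Nat.zero_le j) hj
  have h1 : a j ≤ 1 := h.a_last ▸ h.a_mono hj le_rfl
  rw [node, Set.coe_projIcc, min_eq_right h1, max_eq_right h0]

theorem node_zero (h : PiecewiseLinear π s v a) : node a 0 = 0 :=
  Subtype.ext (by rw [h.coe_node (Nat.zero_le s), h.a_zero]; rfl)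

theorem node_last (h : PiecewiseLinear π s v a) : node a s = 1 :=
  Subtype.ext (by rw [h.coe_node le_rfl, h.a_last]; rfl)

theorem s_pos (h : PiecewiseLinear π s v a) : 0 < s := by
  rcases Nat.eq_zero_or_pos s with rfl | hs
  · have := h.a_zero.symm.trans h.a_last
    norm_num at this
  · exact hs

theorem node_succ (h : PiecewiseLinear π s v a) {j : ℕ} (hj : j < s) :
    π (node a (j + 1)) = π (node a j) + (a (j + 1) - a j) • v j := by
  have := h.lin j hj (node a j) (node a (j + 1)) (h.coe_node hj.le).ge
    ((h.coe_node hj.le).trans_le (h.a_lt j hj).le)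
    ((h.coe_node (j := j + 1) hj).symm ▸ (h.a_lt j hj).le) (h.coe_node hj).le
  rwa [h.coe_node hj, h.coe_node hj.le] at this

theorem lin_left (h : PiecewiseLinear π s v a) {j : ℕ} (hj : j < s) {t : UnitQ}
    (h1 : a j ≤ t) (h2 : (t : ℚ) ≤ a (j + 1)) : π t = π (node a j) + (t - a j) • v j := by
  have := h.lin j hj (node a j) t (h.coe_node hj.le).ge
    ((h.coe_node hj.le).trans_le (h.a_lt j hj).le) h1 h2
  rwa [h.coe_node hj.le] at this

theorem lin_right (h : PiecewiseLinear π s v a) {j : ℕ} (hj : j < s) {t : UnitQ}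
    (h1 : a j ≤ t) (h2 : (t : ℚ) ≤ a (j + 1)) :
    π t = π (node a (j + 1)) + (t - a (j + 1)) • v j := by
  rw [h.lin_left hj h1 h2, h.node_succ hj]
  module

theorem exists_piece (h : PiecewiseLinear π s v a) (t : UnitQ) :
    ∃ j, j < s ∧ a j ≤ t ∧ (t : ℚ) ≤ a (j + 1) := by
  obtain ⟨j, -, h1, h2⟩ := exists_lt_le (a := a) (t := t) h.s_pos
    (by rw [h.a_zero]; exact t.2.1) (by rw [h.a_last]; exact t.2.2)
  exact ⟨j, h1, h2⟩

theorem map (h : PiecewiseLinear π s v a) {F : Type*} [AddCommGroup F] [Module ℚ F]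
    (g : E →ₗ[ℚ] F) : PiecewiseLinear (fun t => g (π t)) s (fun j => g (v j)) a where
  a_zero := h.a_zero
  a_last := h.a_last
  a_lt := h.a_lt
  lin j hj t u h1 h2 h3 h4 := by
    rw [h.lin j hj t u h1 h2 h3 h4, map_add, map_smul]

/-- A new break point `t` is inserted between `a j` and `a (j + 1)`. -/
theorem insert (h : PiecewiseLinear π s v a) {j : ℕ} (hj : j < s) {t : ℚ} (h1 : a j < t)
    (h2 : t < a (j + 1)) : PiecewiseLinear π (s + 1) (fun k => if k ≤ j then v k else v (k - 1))
      (fun k => if k ≤ j then a k else if k = j + 1 then t else a (k - 1)) where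
  a_zero := by simp [h.a_zero]
  a_last := by
    rw [if_neg (by omega), if_neg (by omega)]
    exact h.a_last
  a_lt k hk := by
    rcases lt_trichotomy k j with hkj | rfl | hkj
    · rw [if_pos hkj.le, if_pos (by omega)]
      exact h.a_lt k (by omega)
    · rwa [if_pos le_rfl, if_neg (by omega), if_pos rfl]
    · obtain rfl | hkj : k = j + 1 ∨ j + 1 < k := by omega
      · rwa [if_neg (by omega), if_pos rfl, if_neg (by omega), if_neg (by omega)]
      · rw [if_neg (by omega), if_neg (by omega), if_neg (by omega), if_neg (by omega)]
        exact h.a_strict (by omega) (by omega)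
  lin k hk t' u := by
    rcases lt_trichotomy k j with hkj | rfl | hkj
    · rw [if_pos hkj.le, if_pos (by omega), if_pos hkj.le]
      exact h.lin k (by omega) t' u
    · rw [if_pos le_rfl, if_neg (by omega), if_pos rfl, if_pos le_rfl]
      intro h3 h4 h5 h6
      exact h.lin k hj t' u h3 (h4.trans h2.le) h5 (h6.trans h2.le)
    · obtain ⟨l, rfl⟩ : ∃ l, k = l + 1 := ⟨k - 1, by omega⟩
      obtain rfl | hkj : l = j ∨ j < l := by omega
      · rw [if_neg (by omega), if_pos rfl, if_neg (by omega), if_neg (by omega),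
          if_neg (by omega)]
        intro h3 h4 h5 h6
        exact h.lin l hj t' u (h1.le.trans h3) h4 (h1.le.trans h5) h6
      · rw [if_neg (by omega), if_neg (by omega), if_neg (by omega), if_neg (by omega),
          if_neg (by omega)]
        exact h.lin l (by omega) t' u

/-- The break point `a (j + 1)` is removed if the velocity does not change there. -/
theorem remove (h : PiecewiseLinear π s v a) {j : ℕ} (hj : j + 1 < s) (hv : v j = v (j + 1)) :
    PiecewiseLinear π (s - 1) (fun k => if k ≤ j then v k else v (k + 1))
      (fun k => if k ≤ j then a k else a (k + 1)) where
  a_zero := by simp [h.a_zero]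
  a_last := by
    rw [if_neg (by omega), Nat.sub_add_cancel (by omega), h.a_last]
  a_lt k hk := by
    rcases lt_trichotomy k j with hkj | rfl | hkj
    · rw [if_pos hkj.le, if_pos (by omega)]
      exact h.a_lt k (by omega)
    · rw [if_pos le_rfl, if_neg (by omega)]
      exact h.a_strict (by omega) (by omega)
    · rw [if_neg (by omega), if_neg (by omega)]
      exact h.a_lt _ (by omega)
  lin k hk t u := by
    rcases lt_trichotomy k j with hkj | rfl | hkj
    · rw [if_pos hkj.le, if_pos (by omega), if_pos hkj.le]
      exact h.lin k (by omega) t u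
    · rw [if_pos le_rfl, if_neg (by omega), if_pos le_rfl]
      have key : ∀ t : UnitQ, a k ≤ t → (t : ℚ) ≤ a (k + 1 + 1) →
          π t = π (node a (k + 1)) + (t - a (k + 1)) • v k := by
        intro t h1 h2
        rcases le_total (t : ℚ) (a (k + 1)) with h3 | h3
        · exact h.lin_right (by omega) h1 h3
        · rw [hv]
          exact h.lin_left hj h3 h2
      intro h1 h2 h3 h4
      rw [key t h1 h2, key u h3 h4]
      module
    · rw [if_neg (by omega), if_neg (by omega), if_neg (by omega)]
      exact h.lin (k + 1) (by omega) t u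

end Module

section Scalar

variable {H : UnitQ → ℚ} {s : ℕ} {c : ℕ → ℚ} {a : ℕ → ℚ}

theorem exists_eq_of_piece (h : PiecewiseLinear H s c a) {j : ℕ} (hj : j < s) {t u : UnitQ}
    (htu : t ≤ u) (h1 : a j ≤ t) (h2 : (u : ℚ) ≤ a (j + 1)) {N : ℚ}
    (hN : (H t ≤ N ∧ N ≤ H u) ∨ (H u ≤ N ∧ N ≤ H t)) :
    ∃ w, t ≤ w ∧ w ≤ u ∧ H w = N := by
  have htu' : (t : ℚ) ≤ u := htu
  have e := h.lin j hj t u h1 (htu'.trans h2) (h1.trans htu') h2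
  rw [smul_eq_mul] at e
  rcases eq_or_ne (H t) N with h0 | h0
  · exact ⟨t, le_rfl, htu, h0⟩
  have hc : c j ≠ 0 := by
    intro hc
    rw [hc, mul_zero, add_zero] at e
    rcases hN with hN | hN <;> exact h0 (by linarith)
  -- the solution of the linear equation
  have h3 : 0 ≤ (N - H t) / c j ∧ (N - H t) / c j ≤ u - t := by
    rcases lt_or_gt_of_ne hc with hc | hc
    · rw [le_div_iff_of_neg hc, div_le_iff_of_neg hc]
      rcases hN with hN | hN
      · have := mul_nonpos_of_nonneg_of_nonpos (sub_nonneg.2 htu') hc.le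
        exact absurd (by linarith) h0
      · constructor <;> linarith
    · rw [le_div_iff₀ hc, div_le_iff₀ hc]
      rcases hN with hN | hN
      · constructor <;> linarith
      · have := mul_nonneg (sub_nonneg.2 htu') hc.le
        exact absurd (by linarith) h0
  have h4 := t.2.1
  have h5 := u.2.2
  let w : UnitQ := ⟨t + (N - H t) / c j, by constructor <;> linarith⟩
  have hw : (w : ℚ) = t + (N - H t) / c j := rfl
  have hw1 : (t : ℚ) ≤ w := by rw [hw]; linarith
  have hw2 : (w : ℚ) ≤ u := by rw [hw]; linarith
  refine ⟨w, hw1, hw2, ?_⟩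
  rw [h.lin j hj t w h1 (htu'.trans h2) (h1.trans hw1) (hw2.trans h2), hw, smul_eq_mul]
  field_simp
  ring

/-- The intermediate value theorem for piecewise linear functions. -/
theorem exists_eq (h : PiecewiseLinear H s c a) {t u : UnitQ} (htu : t ≤ u) {N : ℚ}
    (hN : (H t ≤ N ∧ N ≤ H u) ∨ (H u ≤ N ∧ N ≤ H t)) : ∃ w, t ≤ w ∧ w ≤ u ∧ H w = N := by
  have key : ∀ j, j ≤ s → ∀ u : UnitQ, t ≤ u → (u : ℚ) ≤ a j →
      (H t ≤ N ∧ N ≤ H u) ∨ (H u ≤ N ∧ N ≤ H t) → ∃ w, t ≤ w ∧ w ≤ u ∧ H w = N := by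
    intro j
    induction j with
    | zero =>
      intro _ u htu hu hN
      have h1 : (u : ℚ) ≤ 0 := by rwa [h.a_zero] at hu
      have h2 : t = u := le_antisymm htu (show (u : ℚ) ≤ t from h1.trans t.2.1)
      subst h2
      refine ⟨t, le_rfl, le_rfl, ?_⟩
      rcases hN with hN | hN <;> linarith
    | succ j ih =>
      intro hj u htu hu hN
      rcases le_total (u : ℚ) (a j) with h1 | h1
      · exact ih (by omega) u htu h1 hN
      · rcases le_total (a j) (t : ℚ) with h2 | h2
        · exact h.exists_eq_of_piece hj htu h2 hu hN
        · have hn := h.coe_node (j := j) (by omega)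
          have h3 : t ≤ node a j := show (t : ℚ) ≤ node a j by rwa [hn]
          have h4 : node a j ≤ u := show (node a j : ℚ) ≤ u by rwa [hn]
          by_cases h5 : (H t ≤ N ∧ N ≤ H (node a j)) ∨ (H (node a j) ≤ N ∧ N ≤ H t)
          · obtain ⟨w, hw1, hw2, hw3⟩ := ih (by omega) _ h3 hn.le h5
            exact ⟨w, hw1, hw2.trans h4, hw3⟩
          · obtain ⟨w, hw1, hw2, hw3⟩ := h.exists_eq_of_piece hj (N := N) h4 hn.ge hu (by
              rcases le_total (H (node a j)) N with h6 | h6 <;> rcases hN with hN | hN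
              · exact Or.inl ⟨h6, hN.2⟩
              · exact absurd (Or.inr ⟨h6, hN.2⟩) h5
              · exact absurd (Or.inl ⟨hN.1, h6⟩) h5
              · exact Or.inr ⟨hN.1, h6⟩)
            exact ⟨w, h3.trans hw1, hw2, hw3⟩
  exact key s le_rfl u htu (by rw [h.a_last]; exact u.2.2) hN

theorem le_of_nodes (h : PiecewiseLinear H s c a) {j : ℕ} (hj : j < s) {t : UnitQ} (h1 : a j ≤ t)
    (h2 : (t : ℚ) ≤ a (j + 1)) {B : ℚ} (hB : B ≤ H (node a j)) (hB' : B ≤ H (node a (j + 1))) :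
    B ≤ H t := by
  rcases le_total 0 (c j) with hc | hc
  · have := mul_nonneg (sub_nonneg.2 h1) hc
    rw [h.lin_left hj h1 h2, smul_eq_mul]
    linarith
  · have := mul_nonneg_of_nonpos_of_nonpos (sub_nonpos.2 h2) hc
    rw [h.lin_right hj h1 h2, smul_eq_mul]
    linarith

theorem exists_lower_bound (h : PiecewiseLinear H s c a) : ∃ B, ∀ t, B ≤ H t := by
  obtain ⟨k, -, hk⟩ := Finset.exists_min_image (Finset.range (s + 1)) (fun k => H (node a k))
    ⟨0, by simp⟩
  refine ⟨H (node a k), fun t => ?_⟩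
  obtain ⟨j, hj, h1, h2⟩ := h.exists_piece t
  exact h.le_of_nodes hj h1 h2 (hk j (by simp; omega)) (hk (j + 1) (by simp; omega))

theorem eq_of_piece (h : PiecewiseLinear H s c a) {j : ℕ} (hj : j < s) (hc : c j ≠ 0)
    {t u : UnitQ} (h1 : a j ≤ t) (h2 : (t : ℚ) ≤ a (j + 1)) (h3 : a j ≤ u)
    (h4 : (u : ℚ) ≤ a (j + 1)) (htu : H t = H u) : t = u := by
  have e := h.lin j hj t u h1 h2 h3 h4
  rw [htu, smul_eq_mul] at e
  have : ((u : ℚ) - t) * c j = 0 := by linarith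
  exact Subtype.ext (by linarith [(mul_eq_zero.1 this).resolve_right hc])

theorem exists_isGreatest (h : PiecewiseLinear H s c a) {N : ℚ} {j : ℕ} (hj : j ≤ s)
    (hne : ∃ t : UnitQ, (t : ℚ) ≤ a j ∧ H t = N) :
    ∃ p, IsGreatest {t : UnitQ | (t : ℚ) ≤ a j ∧ H t = N} p := by
  induction j with
  | zero =>
    obtain ⟨t, ht⟩ := hne
    refine ⟨t, ht, fun u hu => ?_⟩
    have := hu.1
    rw [h.a_zero] at this
    exact show (u : ℚ) ≤ t from this.trans t.2.1
  | succ j ih =>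
    by_cases hp : ∃ t : UnitQ, a j ≤ t ∧ (t : ℚ) ≤ a (j + 1) ∧ H t = N
    · obtain ⟨t, h1, h2, h3⟩ := hp
      by_cases hc : c j = 0
      · refine ⟨node a (j + 1), ⟨(h.coe_node hj).le, ?_⟩, fun u hu => ?_⟩
        · rw [← h3, h.lin_right hj h1 h2, hc, smul_zero, add_zero]
        · exact show (u : ℚ) ≤ node a (j + 1) by rw [h.coe_node hj]; exact hu.1
      · refine ⟨t, ⟨h2, h3⟩, fun u hu => ?_⟩
        rcases le_total (a j) (u : ℚ) with h4 | h4
        · exact (h.eq_of_piece hj hc h4 hu.1 h1 h2 (hu.2.trans h3.symm)).le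
        · exact show (u : ℚ) ≤ t from h4.trans h1
    · obtain ⟨t, ht1, ht2⟩ := hne
      have hlt : ∀ t : UnitQ, (t : ℚ) ≤ a (j + 1) → H t = N → (t : ℚ) ≤ a j := by
        intro t h1 h2
        by_contra h3
        exact hp ⟨t, (not_le.1 h3).le, h1, h2⟩
      obtain ⟨p, hp1, hp2⟩ := ih (by omega) ⟨t, hlt t ht1 ht2, ht2⟩
      exact ⟨p, ⟨hp1.1.trans (h.a_lt j hj).le, hp1.2⟩, fun u hu => hp2 ⟨hlt u hu.1 hu.2, hu.2⟩⟩

theorem exists_isLeast (h : PiecewiseLinear H s c a) {N : ℚ} (hne : ∃ t : UnitQ, H t = N) :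
    ∃ p, IsLeast {t : UnitQ | H t = N} p := by
  have key : ∀ j, j ≤ s → (∃ t : UnitQ, (t : ℚ) ≤ a j ∧ H t = N) →
      ∃ p, IsLeast {t : UnitQ | H t = N} p := by
    intro j
    induction j with
    | zero =>
      rintro - ⟨t, ht1, ht2⟩
      refine ⟨t, ht2, fun u _ => ?_⟩
      rw [h.a_zero] at ht1
      exact show (t : ℚ) ≤ u from ht1.trans u.2.1
    | succ j ih =>
      rintro hj ⟨t, ht1, ht2⟩
      by_cases hp : ∃ t : UnitQ, (t : ℚ) ≤ a j ∧ H t = N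
      · exact ih (by omega) hp
      · have hlt : ∀ u : UnitQ, H u = N → a j < u := fun u hu => by
          by_contra h3
          exact hp ⟨u, not_lt.1 h3, hu⟩
        have hc : c j ≠ 0 := by
          intro hc
          refine hp ⟨node a j, (h.coe_node (by omega)).le, ?_⟩
          rw [← ht2, h.lin_left hj (hlt t ht2).le ht1, hc, smul_zero, add_zero]
        refine ⟨t, ht2, fun u hu => ?_⟩
        rcases le_total (u : ℚ) (a (j + 1)) with h4 | h4
        · exact (h.eq_of_piece hj hc (hlt t ht2).le ht1 (hlt u hu).le h4 (ht2.trans hu.symm)).le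
        · exact show (t : ℚ) ≤ u from ht1.trans h4
  obtain ⟨t, ht⟩ := hne
  exact key s le_rfl ⟨t, by rw [h.a_last]; exact t.2.2, ht⟩

end Scalar

end PiecewiseLinear

end BorcherdsPath

namespace BorcherdsPath
namespace Realization

variable {I : Type*} {A : Matrix I I ℤ} {𝔥 : Type*} [AddCommGroup 𝔥] [Module ℚ 𝔥]
  {R : Realization A 𝔥}

open Relation

/-! ### Weak data of generalized Lakshmibai-Seshadri paths -/

variable (R) in
/-- Weak data of a generalized Lakshmibai-Seshadri path: consecutive velocities need not be
distinct, the velocities are numbered from `0`, and `lam` is added as a last one. -/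
structure PathData (lam : Dual ℚ 𝔥) (π : PathMap 𝔥) (s : ℕ) (v : ℕ → Dual ℚ 𝔥) (a : ℕ → ℚ) :
    Prop extends PiecewiseLinear π s v a where
  map_zero : π 0 = 0
  v_last : v s = lam
  chain : ∀ j, j < s → ReflTransGen (R.Link lam (a (j + 1))) (v j) (v (j + 1))

namespace PathData

variable {lam : Dual ℚ 𝔥} {π : PathMap 𝔥} {s : ℕ} {v : ℕ → Dual ℚ 𝔥} {a : ℕ → ℚ}

theorem mem_orbit (h : R.PathData lam π s v a) {j : ℕ} (hj : j ≤ s) : v j ∈ R.orbit lam := by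
  induction hj using Nat.decreasingInduction with
  | self => rw [h.v_last]; exact self_mem_orbit lam
  | of_succ k hk ih => exact chain_mem_orbit (h.chain k hk) ih

theorem insert (h : R.PathData lam π s v a) {j : ℕ} (hj : j < s) {t : ℚ} (h1 : a j < t)
    (h2 : t < a (j + 1)) : R.PathData lam π (s + 1) (fun k => if k ≤ j then v k else v (k - 1))
      (fun k => if k ≤ j then a k else if k = j + 1 then t else a (k - 1)) where
  toPiecewiseLinear := h.toPiecewiseLinear.insert hj h1 h2
  map_zero := h.map_zero
  v_last := by
    rw [if_neg (by omega)]
    exact h.v_last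
  chain k hk := by
    rcases lt_trichotomy k j with hkj | rfl | hkj
    · rw [if_pos (by omega), if_pos (by omega), if_pos (by omega)]
      exact h.chain k (by omega)
    · rw [if_pos le_rfl, if_neg (by omega), if_pos rfl, if_neg (by omega), Nat.add_sub_cancel]
    · obtain ⟨l, rfl⟩ : ∃ l, k = l + 1 := ⟨k - 1, by omega⟩
      rw [if_neg (by omega), if_neg (by omega), if_neg (by omega), if_neg (by omega)]
      exact h.chain l (by omega)

theorem remove (h : R.PathData lam π s v a) {j : ℕ} (hj : j + 1 < s) (hv : v j = v (j + 1)) :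
    R.PathData lam π (s - 1) (fun k => if k ≤ j then v k else v (k + 1))
      (fun k => if k ≤ j then a k else a (k + 1)) where
  toPiecewiseLinear := h.toPiecewiseLinear.remove hj hv
  map_zero := h.map_zero
  v_last := by
    rw [if_neg (by omega), Nat.sub_add_cancel (by omega), h.v_last]
  chain k hk := by
    rcases lt_trichotomy k j with hkj | rfl | hkj
    · rw [if_pos (by omega), if_pos (by omega), if_pos (by omega)]
      exact h.chain k (by omega)
    · rw [if_pos le_rfl, if_neg (by omega), if_neg (by omega), hv]
      exact h.chain (k + 1) hj
    · rw [if_neg (by omega), if_neg (by omega), if_neg (by omega)]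
      exact h.chain (k + 1) (by omega)

theorem exists_break (h : R.PathData lam π s v a) (p : UnitQ) :
    ∃ s' v' a', R.PathData lam π s' v' a' ∧ (∃ x ≤ s', a' x = p) ∧
      ∀ x ≤ s, ∃ x' ≤ s', a' x' = a x := by
  obtain ⟨j, hj, h1, h2⟩ := h.exists_piece p
  rcases h1.eq_or_lt with h1 | h1
  · exact ⟨s, v, a, h, ⟨j, hj.le, h1⟩, fun x hx => ⟨x, hx, rfl⟩⟩
  rcases h2.eq_or_lt with h2 | h2
  · exact ⟨s, v, a, h, ⟨j + 1, hj, h2.symm⟩, fun x hx => ⟨x, hx, rfl⟩⟩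
  refine ⟨_, _, _, h.insert hj h1 h2, ⟨j + 1, by omega, by simp⟩, fun x hx => ?_⟩
  rcases le_or_gt x j with h3 | h3
  · exact ⟨x, by omega, by simp [h3]⟩
  · exact ⟨x + 1, by omega, by
      rw [if_neg (by omega), if_neg (by omega), Nat.add_sub_cancel]⟩

/-- Given points may be assumed to be break points. -/
theorem exists_breaks (h : R.PathData lam π s v a) (p q : UnitQ) :
    ∃ s' v' a', R.PathData lam π s' v' a' ∧ ∃ x ≤ s', ∃ y ≤ s', a' x = p ∧ a' y = q := by
  obtain ⟨s1, v1, a1, h1, ⟨x, hx, hxp⟩, -⟩ := h.exists_break p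
  obtain ⟨s2, v2, a2, h2, ⟨y, hy, hyq⟩, h3⟩ := h1.exists_break q
  obtain ⟨x', hx', hxx⟩ := h3 x hx
  exact ⟨s2, v2, a2, h2, x', hx', y, hy, hxx.trans hxp, hyq⟩

/-- Consecutive velocities may be assumed to be distinct. -/
theorem exists_strict (h : R.PathData lam π s v a) :
    ∃ s' v' a', R.PathData lam π s' v' a' ∧ ∀ j, j + 1 < s' → v' j ≠ v' (j + 1) := by
  induction s using Nat.strong_induction_on generalizing v a with
  | _ s ih =>
    by_cases hs : ∃ j, j + 1 < s ∧ v j = v (j + 1)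
    · obtain ⟨j, hj, hv⟩ := hs
      exact ih (s - 1) (by omega) (h.remove hj hv)
    · exact ⟨s, v, a, h, fun j hj hv => hs ⟨j, hj, hv⟩⟩

end PathData

theorem exists_pathData_of_mem {lam : Dual ℚ 𝔥} {π : PathMap 𝔥} (h : π ∈ R.glsPaths lam) :
    ∃ s v a, R.PathData lam π s v a := by
  obtain ⟨s, l, a, h, hπ⟩ := h
  have hv : ∀ j, j < s → (if j < s then l (j + 1) else lam) = l (j + 1) := fun j hj => if_pos hj
  refine ⟨s, fun j => if j < s then l (j + 1) else lam, a,
    ⟨h.a_zero, h.a_last, h.a_lt, ?_⟩, ?_, ?_, ?_⟩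
  · intro j hj t u h1 h2 h3 h4
    have e1 := hπ (j + 1) (by omega) hj t h1 h2
    have e2 := hπ (j + 1) (by omega) hj u h3 h4
    rw [e1, e2, hv j hj, Nat.add_sub_cancel]
    module
  · have h0 : ((0 : UnitQ) : ℚ) = a 0 := h.a_zero.symm
    have := hπ 1 le_rfl h.one_le 0 h0.ge (by
      rw [h0]; exact (h.a_lt 0 h.one_le).le)
    rw [this, h0]
    simp
  · exact if_neg (lt_irrefl s)
  · intro j hj
    rw [hv j hj]
    by_cases hj' : j + 1 < s
    · rw [hv _ hj']
      exact (h.chain (j + 1) (by omega) hj').to_reflTransGen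
    · obtain rfl : s = j + 1 := by omega
      rw [if_neg (lt_irrefl _), h.a_last]
      by_cases hl : l (j + 1) = lam
      · rw [hl]
      · exact (h.chain_last hl).to_reflTransGen

theorem PathData.mem_glsPaths (hA : IsBorcherdsCartan A) {lam : Dual ℚ 𝔥} {π : PathMap 𝔥} {s : ℕ}
    {v : ℕ → Dual ℚ 𝔥} {a : ℕ → ℚ} (h : R.PathData lam π s v a) : π ∈ R.glsPaths lam := by
  obtain ⟨s, v, a, h, hs⟩ := h.exists_strict
  have htrans : ∀ j, 1 ≤ j → j < s → R.HasChain lam (a j) (v (j - 1)) (v j) := by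
    intro j h1 h2
    obtain ⟨j, rfl⟩ : ∃ k, j = k + 1 := ⟨j - 1, by omega⟩
    exact ((reflTransGen_iff_eq_or_transGen.1 (h.chain j (by omega))).resolve_left
      (hs j h2).symm)
  refine ⟨s, fun j => v (j - 1), a, ⟨h.s_pos, h.a_zero, h.a_last, h.a_lt, ?_, ?_, ?_, ?_⟩, ?_⟩
  · exact fun j h1 h2 => h.mem_orbit (by omega)
  · intro j h1 h2
    refine (above_iff hA).2 (TransGen.mono (fun _ _ h => h.stepRel hA) _ _ (htrans j h1 h2))
  · exact htrans
  · intro hne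
    have := h.s_pos
    have h1 := h.chain (s - 1) (by omega)
    rw [Nat.sub_add_cancel (by omega), h.a_last, h.v_last] at h1
    exact (reflTransGen_iff_eq_or_transGen.1 h1).resolve_left (Ne.symm hne)
  · have key : ∀ j, j ≤ s →
        π (node a j) = ∑ i ∈ Finset.Ico 1 (j + 1), (a i - a (i - 1)) • v (i - 1) := by
      intro j
      induction j with
      | zero => intro _; simp [h.node_zero, h.map_zero]
      | succ j ih =>
        intro hj
        rw [Finset.sum_Ico_succ_top (by omega), ← ih (by omega), h.node_succ hj,
          Nat.add_sub_cancel]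
    intro j h1 h2 t h3 h4
    obtain ⟨j, rfl⟩ : ∃ k, j = k + 1 := ⟨j - 1, by omega⟩
    rw [Nat.add_sub_cancel] at h3 ⊢
    rw [← key j (by omega), h.lin_left h2 h3 h4]
    simp only [Nat.add_sub_cancel]

namespace PathData

variable {lam : Dual ℚ 𝔥} {π : PathMap 𝔥} {s : ℕ} {v : ℕ → Dual ℚ 𝔥} {a : ℕ → ℚ}

/-! ### Integrality of the height functions -/

theorem ht_linear (h : R.PathData lam π s v a) (i : I) :
    PiecewiseLinear (R.ht i π) s (fun j => v j (R.coroot i)) a :=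
  h.toPiecewiseLinear.map (Dual.eval ℚ 𝔥 (R.coroot i))

theorem ht_zero (h : R.PathData lam π s v a) (i : I) : R.ht i π 0 = 0 := by
  simp [ht, h.map_zero]

theorem ht_node (hA : IsBorcherdsCartan A) (h : R.PathData lam π s v a) (i : I) {j : ℕ}
    (hj : j ≤ s) : ∃ n : ℤ, R.ht i π (node a j) = a j * v j (R.coroot i) + n := by
  induction j with
  | zero => exact ⟨0, by rw [h.node_zero, h.ht_zero, h.a_zero]; simp⟩
  | succ j ih =>
    obtain ⟨n, hn⟩ := ih (by omega)
    obtain ⟨m, hm⟩ := chain_exists_int hA (h.chain j hj) i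
    refine ⟨n - m, ?_⟩
    rw [(h.ht_linear i).node_succ hj, hn, smul_eq_mul]
    push_cast
    linarith

theorem ht_one (hA : IsBorcherdsCartan A) (hlam : lam ∈ R.dominantWeights)
    (h : R.PathData lam π s v a) (i : I) : ∃ n : ℤ, R.ht i π 1 = n := by
  obtain ⟨n, hn⟩ := h.ht_node hA i le_rfl
  obtain ⟨m, hm⟩ := hlam.1 i
  rw [h.node_last, h.v_last, h.a_last, hm] at hn
  exact ⟨m + n, by rw [hn]; push_cast; ring⟩

/-- The values at local minima are integers. -/
theorem ht_int_of_min (hA : IsBorcherdsCartan A) (h : R.PathData lam π s v a) {i : I}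
    (hi : A i i = 2) {j : ℕ} (hj : j < s) (h1 : v j (R.coroot i) ≤ 0)
    (h2 : 0 ≤ v (j + 1) (R.coroot i)) : ∃ n : ℤ, R.ht i π (node a (j + 1)) = n := by
  obtain ⟨n, hn⟩ := h.ht_node hA i (j := j + 1) hj
  obtain ⟨m, hm⟩ := chain_int_of_nonpos_of_nonneg hA hi (h.chain j hj) h1 h2
  exact ⟨m + n, by rw [hn, hm]; push_cast; ring⟩

/-- The minimum of the height function on an interval is attained at an end point or is an
integer. -/
theorem exists_int_le (hA : IsBorcherdsCartan A) (h : R.PathData lam π s v a) {i : I}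
    (hi : A i i = 2) {p t q : UnitQ} (hpt : p ≤ t) (htq : t ≤ q) :
    ∃ w, p ≤ w ∧ w ≤ q ∧ R.ht i π w ≤ R.ht i π t ∧ (w = p ∨ w = q ∨ ∃ n : ℤ, R.ht i π w = n) := by
  obtain ⟨s, v, a, h, x, hx, y, hy, hxp, hyq⟩ := h.exists_breaks p q
  have hH := h.ht_linear i
  have hpt' : (p : ℚ) ≤ t := hpt
  have htq' : (t : ℚ) ≤ q := htq
  have hnx : node a x = p := Subtype.ext (by rw [h.coe_node hx, hxp])
  have hny : node a y = q := Subtype.ext (by rw [h.coe_node hy, hyq])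
  have hxy : x ≤ y := by
    rw [← h.a_le_iff hx hy, hxp, hyq]; exact hpt'.trans htq'
  rcases hxy.eq_or_lt with rfl | hxy
  · have h1 : t = p := le_antisymm (htq.trans (by rw [← hny, hnx])) hpt
    exact ⟨p, le_rfl, hpt.trans htq, by rw [h1], Or.inl rfl⟩
  obtain ⟨k, hk, hmin⟩ := Finset.exists_min_image (Finset.Icc x y) (fun k => R.ht i π (node a k))
    ⟨x, by simp; omega⟩
  rw [Finset.mem_Icc] at hk
  refine ⟨node a k, ?_, ?_, ?_, ?_⟩
  · rw [← hnx]
    exact show (node a x : ℚ) ≤ node a k by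
      rw [h.coe_node hx, h.coe_node (hk.2.trans hy)]; exact h.a_mono hk.1 (hk.2.trans hy)
  · rw [← hny]
    exact show (node a k : ℚ) ≤ node a y by
      rw [h.coe_node hy, h.coe_node (hk.2.trans hy)]; exact h.a_mono hk.2 hy
  · obtain ⟨j, h1, h2, h3, h4⟩ := PiecewiseLinear.exists_lt_le (a := a) (t := t) hxy (by rw [hxp]; exact hpt')
      (by rw [hyq]; exact htq')
    exact hH.le_of_nodes (by omega) h3 h4 (hmin j (by simp; omega)) (hmin (j + 1) (by simp; omega))
  · rcases hk.1.eq_or_lt with rfl | h1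
    · exact Or.inl hnx
    rcases hk.2.eq_or_lt with rfl | h2
    · exact Or.inr (Or.inl hny)
    refine Or.inr (Or.inr ?_)
    obtain ⟨k, rfl⟩ : ∃ l, k = l + 1 := ⟨k - 1, by omega⟩
    have e1 := hmin k (by simp; omega)
    have e2 := hmin (k + 1 + 1) (by simp; omega)
    have l1 := h.a_lt k (by omega)
    have l2 := h.a_lt (k + 1) (by omega)
    rw [hH.node_succ (by omega : k < s), smul_eq_mul] at e1
    rw [hH.node_succ (by omega : k + 1 < s), smul_eq_mul] at e2
    refine h.ht_int_of_min hA hi (by omega) ?_ ?_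
    · by_contra hc
      have := mul_pos (sub_pos.2 l1) (not_le.1 hc)
      linarith
    · by_contra hc
      have := mul_neg_of_pos_of_neg (sub_pos.2 l2) (not_le.1 hc)
      linarith

end PathData

/-- The least integer among the values of `h_i` is the minimum of `h_i` if this is an integer. -/
theorem minInt_eq {i : I} {π : PathMap 𝔥} {N : ℤ} {t : UnitQ} (ht : R.ht i π t = N)
    (hmin : ∀ u, (N : ℚ) ≤ R.ht i π u) : R.minInt i π = N := by
  refine IsLeast.csInf_eq ⟨⟨t, ht⟩, ?_⟩
  rintro n ⟨u, hu⟩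
  have := hmin u
  rw [hu] at this
  exact_mod_cast this

theorem PathData.minInt_spec (hA : IsBorcherdsCartan A) {lam : Dual ℚ 𝔥} {π : PathMap 𝔥} {s : ℕ}
    {v : ℕ → Dual ℚ 𝔥} {a : ℕ → ℚ} (hlam : lam ∈ R.dominantWeights)
    (h : R.PathData lam π s v a) {i : I} (hi : A i i = 2) :
    (∃ t, R.ht i π t = R.minInt i π) ∧ ∀ t, (R.minInt i π : ℚ) ≤ R.ht i π t := by
  obtain ⟨B, hB⟩ := (h.ht_linear i).exists_lower_bound
  have hbdd : BddBelow {n : ℤ | ∃ t, R.ht i π t = n} := by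
    refine ⟨⌊B⌋, ?_⟩
    rintro n ⟨t, ht⟩
    have := (Int.floor_le B).trans (hB t)
    rw [ht] at this
    exact_mod_cast this
  refine ⟨Int.csInf_mem (s := {n : ℤ | ∃ t, R.ht i π t = n})
    ⟨0, 0, by rw [h.ht_zero]; simp⟩ hbdd, fun t => ?_⟩
  obtain ⟨w, -, -, hw, hn⟩ := h.exists_int_le hA hi (p := 0) (q := 1) t.2.1 t.2.2
  have : ∃ n : ℤ, R.ht i π w = n := by
    rcases hn with rfl | rfl | hn
    · exact ⟨0, by rw [h.ht_zero]; simp⟩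
    · exact h.ht_one hA hlam i
    · exact hn
  obtain ⟨n, hn⟩ := this
  refine le_trans ?_ hw
  rw [hn]
  exact_mod_cast csInf_le hbdd (show n ∈ {n : ℤ | ∃ t, R.ht i π t = n} from ⟨w, hn⟩)

end Realization
end BorcherdsPath

namespace BorcherdsPath

section Bend

variable {𝔥 : Type*} [AddCommGroup 𝔥] [Module ℚ 𝔥] {π : PathMap 𝔥} {p q t : UnitQ}
  {g : Dual ℚ 𝔥 →ₗ[ℚ] Dual ℚ 𝔥} {c : Dual ℚ 𝔥}

/-! ### Bending a path -/

open Realization (bend)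

theorem bend_of_le {g : Dual ℚ 𝔥 → Dual ℚ 𝔥} (h : t ≤ p) : bend g c p q π t = π t := if_pos h

theorem bend_of_mem (h1 : p ≤ t) (h2 : t ≤ q) : bend g c p q π t = π p + g (π t - π p) := by
  rcases h1.eq_or_lt with rfl | h1
  · rw [bend_of_le le_rfl, sub_self, map_zero, add_zero]
  · rw [bend, if_neg (not_le.2 h1), if_pos h2]

theorem bend_of_ge (hpq : p ≤ q) (hc : g (π q - π p) = π q - π p + c) (h : q ≤ t) :
    bend g c p q π t = π t + c := by
  rcases h.eq_or_lt with rfl | h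
  · rw [bend_of_mem hpq le_rfl, hc]
    abel
  · rw [bend, if_neg (not_le.2 (hpq.trans_lt h)), if_neg (not_le.2 h)]

/-- Bending twice, by inverse maps and opposite translations, gives back the path. -/
theorem bend_bend {g' : Dual ℚ 𝔥 →ₗ[ℚ] Dual ℚ 𝔥} (hpq : p ≤ q)
    (hc : g (π q - π p) = π q - π p + c) (hg : ∀ x, g' (g x) = x) :
    π = bend g' (-c) p q (bend g c p q π) := by
  funext t
  rcases le_total t p with h1 | h1
  · rw [bend_of_le h1, bend_of_le h1]
  rcases le_total t q with h2 | h2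
  · rw [bend_of_mem h1 h2, bend_of_mem h1 h2, bend_of_mem le_rfl hpq, sub_self, map_zero, add_zero,
      add_sub_cancel_left, hg, add_sub_cancel]
  · rw [bend_of_ge hpq _ h2, bend_of_ge hpq hc h2, add_neg_cancel_right]
    rw [bend_of_mem hpq le_rfl, bend_of_mem le_rfl hpq, sub_self, map_zero, add_zero,
      add_sub_cancel_left, hg, hc]
    abel

theorem PiecewiseLinear.bend {s : ℕ} {v : ℕ → Dual ℚ 𝔥} {a : ℕ → ℚ}
    (h : PiecewiseLinear π s v a) {x y : ℕ} (hy : y ≤ s) (hxy : x ≤ y)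
    (hxp : a x = p) (hyq : a y = q) (hc : g (π q - π p) = π q - π p + c) :
    PiecewiseLinear (bend g c p q π) s (fun k => if x ≤ k ∧ k < y then g (v k) else v k) a where
  a_zero := h.a_zero
  a_last := h.a_last
  a_lt := h.a_lt
  lin j hj t u h1 h2 h3 h4 := by
    have hpq : p ≤ q := show (p : ℚ) ≤ q by rw [← hxp, ← hyq]; exact h.a_mono hxy hy
    have e := h.lin j hj t u h1 h2 h3 h4
    by_cases hjx : x ≤ j
    · have hx := h.a_mono hjx hj.le
      by_cases hjy : j < y
      · have hy := h.a_mono (i := j + 1) hjy hy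
        rw [hyq] at hy
        rw [hxp] at hx
        rw [if_pos ⟨hjx, hjy⟩, bend_of_mem (hx.trans h1) (h2.trans hy),
          bend_of_mem (hx.trans h3) (h4.trans hy), e, ← map_smul, add_assoc, ← map_add]
        congr 2
        abel
      · have hy := h.a_mono (not_lt.1 hjy) hj.le
        rw [hyq] at hy
        rw [if_neg (by omega), bend_of_ge hpq hc (hy.trans h1), bend_of_ge hpq hc (hy.trans h3), e]
        abel
    · have hx := h.a_mono (i := j + 1) (by omega) (hxy.trans hy)
      rw [hxp] at hx
      rw [if_neg (by omega), bend_of_le (h2.trans hx), bend_of_le (h4.trans hx), e]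

end Bend

namespace Realization

variable {I : Type*} {A : Matrix I I ℤ} {𝔥 : Type*} [AddCommGroup 𝔥] [Module ℚ 𝔥]
  {R : Realization A 𝔥}

open Relation

namespace PathData

variable {lam : Dual ℚ 𝔥} {π : PathMap 𝔥} {s : ℕ} {v : ℕ → Dual ℚ 𝔥} {a : ℕ → ℚ}
  {i : I} {p q : UnitQ}

/-- A path bent between two break points is again given by weak data, if the velocities on both
sides of the break points from `a x` to `a y` are still related by chains. -/
theorem bend (h : R.PathData lam π s v a) {g : Dual ℚ 𝔥 →ₗ[ℚ] Dual ℚ 𝔥} {c : Dual ℚ 𝔥} {x y : ℕ}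
    (hy : y ≤ s) (hxy : x ≤ y) (hxp : a x = p) (hyq : a y = q)
    (hc : g (π q - π p) = π q - π p + c)
    (hleft : ∀ j, j + 1 = x → x < y → ReflTransGen (R.Link lam (a (j + 1))) (v j) (g (v (j + 1))))
    (hmid : ∀ j, x ≤ j → j + 1 < y →
      ReflTransGen (R.Link lam (a (j + 1))) (g (v j)) (g (v (j + 1))))
    (hright : ∀ j, x ≤ j → j + 1 = y →
      ReflTransGen (R.Link lam (a (j + 1))) (g (v j)) (v (j + 1))) :
    R.PathData lam (bend g c p q π) s (fun k => if x ≤ k ∧ k < y then g (v k) else v k) a where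
  toPiecewiseLinear := h.toPiecewiseLinear.bend hy hxy hxp hyq hc
  map_zero := by rw [bend_of_le p.2.1, h.map_zero]
  v_last := by rw [if_neg (by omega), h.v_last]
  chain j hj := by
    by_cases h1 : x ≤ j ∧ j < y
    · rw [if_pos h1]
      by_cases h2 : j + 1 < y
      · rw [if_pos (by omega)]
        exact hmid j h1.1 h2
      · rw [if_neg (by omega)]
        exact hright j h1.1 (by omega)
    · rw [if_neg h1]
      by_cases h2 : x ≤ j + 1 ∧ j + 1 < y
      · rw [if_pos h2]
        exact hleft j (by omega) (by omega)
      · rw [if_neg h2]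
        exact h.chain j hj

/-! ### Real root operators -/

section Real

variable (hA : IsBorcherdsCartan A) (hlam : lam ∈ R.dominantWeights)
  (h : R.PathData lam π s v a) (hi : A i i = 2)

include hA hlam h hi

/-- The height function on, before and after the interval `[p, q]` where `f_i` acts. -/
theorem ht_f_interval (hp : IsGreatest {t | R.ht i π t = R.minInt i π} p)
    (hq : IsLeast {t | p ≤ t ∧ R.ht i π t = R.minInt i π + 1} q) :
    p < q ∧ (∀ t, p < t → R.minInt i π < R.ht i π t) ∧
      (∀ t, p ≤ t → t < q → R.ht i π t < R.minInt i π + 1) ∧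
      ∀ t, q ≤ t → R.minInt i π + 1 ≤ R.ht i π t := by
  obtain ⟨-, hmin⟩ := h.minInt_spec hA hlam hi
  have hp0 : R.ht i π p = R.minInt i π := hp.1
  have hq0 : R.ht i π q = R.minInt i π + 1 := hq.1.2
  have hpq : p < q := lt_of_le_of_ne hq.1.1 fun e => by rw [e, hq0] at hp0; linarith
  have h1 : ∀ t, p < t → R.minInt i π < R.ht i π t := fun t ht =>
    lt_of_le_of_ne (hmin t) fun e => absurd (hp.2 e.symm) (not_le.2 ht)
  refine ⟨hpq, h1, fun t h2 h3 => ?_, fun t ht => ?_⟩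
  · by_contra h4
    obtain ⟨w, hw1, hw2, hw3⟩ := (h.ht_linear i).exists_eq h2 (N := R.minInt i π + 1)
      (Or.inl ⟨by rw [hp0]; linarith, not_lt.1 h4⟩)
    exact absurd (hq.2 ⟨hw1, hw3⟩) (not_le.2 (hw2.trans_lt h3))
  · obtain ⟨w, hw1, -, hw3, hw4⟩ := h.exists_int_le hA hi (q := 1) ht t.2.2
    have : ∃ n : ℤ, R.ht i π w = n := by
      rcases hw4 with rfl | rfl | hn
      · exact ⟨R.minInt i π + 1, by rw [hq0]; push_cast; ring⟩
      · exact h.ht_one hA hlam i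
      · exact hn
    obtain ⟨n, hn⟩ := this
    have h5 := h1 w (hpq.trans_le hw1)
    rw [hn] at h5 hw3
    have h6 : R.minInt i π + 1 ≤ n := by exact_mod_cast h5
    have h7 : (R.minInt i π : ℚ) + 1 ≤ n := by exact_mod_cast h6
    linarith

/-- The height function on, before and after the interval `[p, q]` where `e_i` acts. -/
theorem ht_e_interval (hq : IsLeast {t | R.ht i π t = R.minInt i π} q)
    (hp : IsGreatest {t | t ≤ q ∧ R.ht i π t = R.minInt i π + 1} p) :
    p < q ∧ (∀ t, t < q → R.minInt i π < R.ht i π t) ∧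
      (∀ t, p < t → t ≤ q → R.ht i π t < R.minInt i π + 1) ∧
      ∀ t, t ≤ p → R.minInt i π + 1 ≤ R.ht i π t := by
  obtain ⟨-, hmin⟩ := h.minInt_spec hA hlam hi
  have hq0 : R.ht i π q = R.minInt i π := hq.1
  have hp0 : R.ht i π p = R.minInt i π + 1 := hp.1.2
  have hpq : p < q := lt_of_le_of_ne hp.1.1 fun e => by rw [e, hq0] at hp0; linarith
  have h1 : ∀ t, t < q → R.minInt i π < R.ht i π t := fun t ht =>
    lt_of_le_of_ne (hmin t) fun e => absurd (hq.2 e.symm) (not_le.2 ht)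
  refine ⟨hpq, h1, fun t h2 h3 => ?_, fun t ht => ?_⟩
  · by_contra h4
    obtain ⟨w, hw1, hw2, hw3⟩ := (h.ht_linear i).exists_eq h3 (N := R.minInt i π + 1)
      (Or.inr ⟨by rw [hq0]; linarith, not_lt.1 h4⟩)
    exact absurd (hp.2 ⟨hw2, hw3⟩) (not_le.2 (h2.trans_le hw1))
  · obtain ⟨w, -, hw2, hw3, hw4⟩ := h.exists_int_le hA hi (p := 0) t.2.1 ht
    have : ∃ n : ℤ, R.ht i π w = n := by
      rcases hw4 with rfl | rfl | hn
      · exact ⟨0, by rw [h.ht_zero]; simp⟩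
      · exact ⟨R.minInt i π + 1, by rw [hp0]; push_cast; ring⟩
      · exact hn
    obtain ⟨n, hn⟩ := this
    have h5 := h1 w (hw2.trans_lt hpq)
    rw [hn] at h5 hw3
    have h6 : R.minInt i π + 1 ≤ n := by exact_mod_cast h5
    have h7 : (R.minInt i π : ℚ) + 1 ≤ n := by exact_mod_cast h6
    linarith

end Real

end PathData

theorem r_sub_eq {i : I} (π : PathMap 𝔥) (p q : UnitQ) {x : ℚ} (hx : R.ht i π q - R.ht i π p = x) :
    R.r i (π q - π p) = π q - π p + -(x • R.root i) := by
  rw [r_apply, LinearMap.sub_apply, ← sub_eq_add_neg]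
  rw [← hx]
  rfl

theorem ht_def (i : I) (π : PathMap 𝔥) (t : UnitQ) : R.ht i π t = π t (R.coroot i) := rfl

theorem ht_add (i : I) (π : PathMap 𝔥) (t : UnitQ) (x : Dual ℚ 𝔥) :
    (π t + x) (R.coroot i) = R.ht i π t + x (R.coroot i) := rfl

theorem ht_r_bend {i : I} (hi : A i i = 2) (π : PathMap 𝔥) (p t : UnitQ) :
    (π p + R.r i (π t - π p)) (R.coroot i) = 2 * R.ht i π p - R.ht i π t := by
  rw [LinearMap.add_apply, r_coroot hi, LinearMap.sub_apply, ht, ht]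
  ring

section Real

variable {lam : Dual ℚ 𝔥} {π π' : PathMap 𝔥} {s : ℕ} {v : ℕ → Dual ℚ 𝔥} {a : ℕ → ℚ} {i : I}
  (hA : IsBorcherdsCartan A) (hlam : lam ∈ R.dominantWeights)
  (h : R.PathData lam π s v a) (hi : A i i = 2)

include hA hlam h hi

theorem FRel.eRealRel (hf : R.FRel i π π') : R.ERealRel i π' π := by
  obtain ⟨p, q, hp, hp1, hq, rfl⟩ := hf
  obtain ⟨hpq, h1, h2, h3⟩ := h.ht_f_interval hA hlam hi hp hq
  obtain ⟨-, hmin⟩ := h.minInt_spec hA hlam hi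
  set M := R.minInt i π with hM
  have hp0 : R.ht i π p = M := hp.1
  have hq0 : R.ht i π q = M + 1 := hq.1.2
  have hc : R.r i (π q - π p) = π q - π p + -R.root i := by
    rw [r_sub_eq π p q (x := 1) (by rw [hp0, hq0]; ring), one_smul]
  have ha : (-R.root i) (R.coroot i) = -2 := by
    rw [LinearMap.neg_apply, root_coroot_self hi]
  set π' := bend (R.r i) (-R.root i) p q π with hπ'
  have b1 : ∀ t, t ≤ p → R.ht i π' t = R.ht i π t := fun t ht => by
    rw [ht_def, hπ', bend_of_le ht]; rfl
  have b2 : ∀ t, p ≤ t → t ≤ q → R.ht i π' t = 2 * M - R.ht i π t := fun t ht ht' => by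
    rw [ht_def, hπ', bend_of_mem ht ht', ht_r_bend hi, hp0]
  have b3 : ∀ t, q ≤ t → R.ht i π' t = R.ht i π t - 2 := fun t ht => by
    rw [ht_def, hπ', bend_of_ge hpq.le hc ht, ht_add, ha]; ring
  have hM' : R.minInt i π' = M - 1 := by
    refine minInt_eq (t := q) ?_ fun t => ?_
    · rw [b2 q hpq.le le_rfl, hq0]; push_cast; ring
    · push_cast
      rcases le_total t p with ht | ht
      · rw [b1 t ht]; linarith [hmin t]
      rcases lt_or_ge t q with ht' | ht'
      · rw [b2 t ht ht'.le]; linarith [h2 t ht ht']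
      · rw [b3 t ht']; linarith [h3 t ht']
  refine ⟨p, q, ⟨?_, ?_⟩, lt_of_le_of_lt p.2.1 hpq, ⟨⟨hpq.le, ?_⟩, ?_⟩, ?_⟩
  · change R.ht i π' q = _
    rw [hM', b2 q hpq.le le_rfl, hq0]; push_cast; ring
  · intro t (ht : R.ht i π' t = _)
    rw [hM'] at ht
    push_cast at ht
    by_contra hlt
    rw [not_le] at hlt
    rcases le_total t p with ht' | ht'
    · rw [b1 t ht'] at ht; linarith [hmin t]
    · rw [b2 t ht' hlt.le] at ht; linarith [h2 t ht' hlt]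
  · rw [hM', b1 p le_rfl, hp0]; push_cast; ring
  · rintro t ⟨ht, ht'⟩
    rw [hM'] at ht'
    push_cast at ht'
    by_contra hlt
    rw [not_le] at hlt
    rw [b2 t hlt.le ht] at ht'
    linarith [h1 t hlt]
  · have := bend_bend (g' := R.r i) hpq.le hc (r_r hi)
    rwa [neg_neg] at this

theorem ERealRel.fRel (he : R.ERealRel i π π') :
    R.FRel i π' π ∧ R.minInt i π' = R.minInt i π + 1 := by
  obtain ⟨p, q, hq, hq0', hp, rfl⟩ := he
  obtain ⟨hpq, h1, h2, h3⟩ := h.ht_e_interval hA hlam hi hq hp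
  obtain ⟨-, hmin⟩ := h.minInt_spec hA hlam hi
  set M := R.minInt i π with hM
  have hq0 : R.ht i π q = M := hq.1
  have hp0 : R.ht i π p = M + 1 := hp.1.2
  have hc : R.r i (π q - π p) = π q - π p + R.root i := by
    rw [r_sub_eq π p q (x := -1) (by rw [hp0, hq0]; ring), neg_smul, one_smul, neg_neg]
  set π' := bend (R.r i) (R.root i) p q π with hπ'
  have b1 : ∀ t, t ≤ p → R.ht i π' t = R.ht i π t := fun t ht => by
    rw [ht_def, hπ', bend_of_le ht]; rfl
  have b2 : ∀ t, p ≤ t → t ≤ q → R.ht i π' t = 2 * (M + 1) - R.ht i π t := fun t ht ht' => by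
    rw [ht_def, hπ', bend_of_mem ht ht', ht_r_bend hi, hp0]
  have b3 : ∀ t, q ≤ t → R.ht i π' t = R.ht i π t + 2 := fun t ht => by
    rw [ht_def, hπ', bend_of_ge hpq.le hc ht, ht_add, root_coroot_self hi]
  have hM' : R.minInt i π' = M + 1 := by
    refine minInt_eq (t := p) ?_ fun t => ?_
    · rw [b1 p le_rfl, hp0]; push_cast; ring
    · push_cast
      rcases le_or_gt t p with ht | ht
      · rw [b1 t ht]; exact h3 t ht
      rcases le_total t q with ht' | ht'
      · rw [b2 t ht.le ht']; linarith [h2 t ht ht']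
      · rw [b3 t ht']; linarith [hmin t]
  refine ⟨⟨p, q, ⟨?_, ?_⟩, lt_of_lt_of_le hpq q.2.2, ⟨⟨hpq.le, ?_⟩, ?_⟩, ?_⟩, hM'⟩
  · change R.ht i π' p = _
    rw [hM', b1 p le_rfl, hp0]; push_cast; ring
  · intro t (ht : R.ht i π' t = _)
    rw [hM'] at ht
    push_cast at ht
    by_contra hlt
    rw [not_le] at hlt
    rcases le_total t q with ht' | ht'
    · rw [b2 t hlt.le ht'] at ht; linarith [h2 t hlt ht']
    · rw [b3 t ht'] at ht; linarith [hmin t]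
  · rw [hM', b2 q hpq.le le_rfl, hq0]; push_cast; ring
  · rintro t ⟨ht, ht'⟩
    rw [hM'] at ht'
    push_cast at ht'
    by_contra hlt
    rw [not_le] at hlt
    rw [b2 t ht hlt.le] at ht'
    linarith [h1 t hlt]
  · exact bend_bend (g' := R.r i) hpq.le hc (r_r hi)

end Real

end Realization
end BorcherdsPath

namespace BorcherdsPath
namespace Realization

variable {I : Type*} {A : Matrix I I ℤ} {𝔥 : Type*} [AddCommGroup 𝔥] [Module ℚ 𝔥]
  {R : Realization A 𝔥}

open Relation

namespace PathData

variable {lam : Dual ℚ 𝔥} {π π' : PathMap 𝔥} {s : ℕ} {v : ℕ → Dual ℚ 𝔥} {a : ℕ → ℚ} {i : I}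

theorem slope_pos (h : R.PathData lam π s v a) (i : I) {j : ℕ} (hj : j < s)
    (hlt : R.ht i π (node a j) < R.ht i π (node a (j + 1))) : 0 < v j (R.coroot i) := by
  rw [(h.ht_linear i).node_succ hj, smul_eq_mul] at hlt
  exact (pos_iff_pos_of_mul_pos (by linarith)).1 (sub_pos.2 (h.a_lt j hj))

theorem slope_neg (h : R.PathData lam π s v a) (i : I) {j : ℕ} (hj : j < s)
    (hlt : R.ht i π (node a (j + 1)) < R.ht i π (node a j)) : v j (R.coroot i) < 0 := by
  rw [(h.ht_linear i).node_succ hj, smul_eq_mul] at hlt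
  by_contra hc
  have := mul_nonneg (sub_pos.2 (h.a_lt j hj)).le (not_lt.1 hc)
  linarith

theorem slope_nonpos (h : R.PathData lam π s v a) (i : I) {j : ℕ} (hj : j < s)
    (hlt : R.ht i π (node a (j + 1)) ≤ R.ht i π (node a j)) : v j (R.coroot i) ≤ 0 := by
  by_contra hc
  rw [(h.ht_linear i).node_succ hj, smul_eq_mul] at hlt
  have := mul_pos (sub_pos.2 (h.a_lt j hj)) (not_le.1 hc)
  linarith

theorem slope_nonneg (h : R.PathData lam π s v a) (i : I) {j : ℕ} (hj : j < s)
    (hlt : R.ht i π (node a j) ≤ R.ht i π (node a (j + 1))) : 0 ≤ v j (R.coroot i) := by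
  by_contra hc
  rw [(h.ht_linear i).node_succ hj, smul_eq_mul] at hlt
  have := mul_neg_of_pos_of_neg (sub_pos.2 (h.a_lt j hj)) (not_le.1 hc)
  linarith

theorem node_lt (h : R.PathData lam π s v a) {j k : ℕ} (hjk : j < k) (hk : k ≤ s) :
    node a j < node a k :=
  show (node a j : ℚ) < node a k by
    rw [h.coe_node hk, h.coe_node (hjk.le.trans hk)]; exact h.a_strict hjk hk

theorem node_le (h : R.PathData lam π s v a) {j k : ℕ} (hjk : j ≤ k) (hk : k ≤ s) :
    node a j ≤ node a k :=
  show (node a j : ℚ) ≤ node a k by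
    rw [h.coe_node hk, h.coe_node (hjk.trans hk)]; exact h.a_mono hjk hk

/-- A non-integral value at a break point gives a non-integral pairing. -/
theorem coroot_not_int (hA : IsBorcherdsCartan A) (h : R.PathData lam π s v a) {j : ℕ}
    (hj : j ≤ s) {M : ℤ} (h1 : M < R.ht i π (node a j)) (h2 : R.ht i π (node a j) < M + 1) (n : ℤ) :
    a j * v j (R.coroot i) ≠ n := by
  intro hn
  obtain ⟨m, hm⟩ := h.ht_node hA i hj
  rw [hn] at hm
  rw [hm] at h1 h2
  have e1 : M < n + m := by exact_mod_cast h1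
  have e2 : n + m < M + 1 := by exact_mod_cast h2
  omega

theorem not_int_of_mem {x : ℚ} {M : ℤ} (h1 : M < x) (h2 : x < M + 1) : ¬ ∃ n : ℤ, x = n := by
  rintro ⟨n, rfl⟩
  have e1 : M < n := by exact_mod_cast h1
  have e2 : n < M + 1 := by exact_mod_cast h2
  omega

/-- The velocities between `p` and `q` are positive on `α_i^∨`, and the height function is not an
integer inside this interval, so `r_i` maps the chains there to chains. At `p` the chain starts at a
velocity that is nonpositive on `α_i^∨`, at `q` the reflection in `α_i` is a new first link. -/
theorem f_mem (hA : IsBorcherdsCartan A) (hlam : lam ∈ R.dominantWeights)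
    (h : R.PathData lam π s v a) (hi : A i i = 2) (hf : R.FRel i π π') : π' ∈ R.glsPaths lam := by
  obtain ⟨p, q, hp, hp1, hq, rfl⟩ := hf
  obtain ⟨hpq, h1, h2, h3⟩ := h.ht_f_interval hA hlam hi hp hq
  obtain ⟨-, hmin⟩ := h.minInt_spec hA hlam hi
  obtain ⟨s, v, a, h, x, hx, y, hy, hxp, hyq⟩ := h.exists_breaks p q
  set M := R.minInt i π with hM
  have hp0 : R.ht i π p = M := hp.1
  have hq0 : R.ht i π q = M + 1 := hq.1.2
  have hnx : node a x = p := Subtype.ext (by rw [h.coe_node hx, hxp])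
  have hny : node a y = q := Subtype.ext (by rw [h.coe_node hy, hyq])
  have hxy : x < y := by
    rw [← h.a_lt_iff hx hy, hxp, hyq]; exact hpq
  have hc : R.r i (π q - π p) = π q - π p + -R.root i := by
    rw [r_sub_eq π p q (x := 1) (by rw [hp0, hq0]; ring), one_smul]
  have inside : ∀ k, x < k → k < y →
      M < R.ht i π (node a k) ∧ R.ht i π (node a k) < M + 1 := by
    intro k hk1 hk2
    have l1 := h.node_lt hk1 (by omega)
    have l2 := h.node_lt hk2 hy
    rw [hnx] at l1
    rw [hny] at l2
    exact ⟨h1 _ l1, h2 _ l1.le l2⟩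
  -- the height function increases strictly between `p` and `q`
  have slope : ∀ k, k < y → x ≤ k → 0 < v k (R.coroot i) := by
    have last : 0 < v (y - 1) (R.coroot i) := by
      refine h.slope_pos i (by omega) ?_
      rw [Nat.sub_add_cancel (by omega), hny, hq0]
      have l2 := h.node_lt (show y - 1 < y by omega) hy
      have l1 := h.node_le (show x ≤ y - 1 by omega) (by omega)
      rw [hnx] at l1
      rw [hny] at l2
      exact h2 _ l1 l2
    intro k hk
    obtain ⟨d, hd⟩ : ∃ d, k + d = y - 1 := ⟨y - 1 - k, by omega⟩
    induction d generalizing k with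
    | zero =>
      intro _
      obtain rfl : k = y - 1 := hd
      exact last
    | succ d ih =>
      intro hxk
      have hk1 := ih (k + 1) (by omega) (by omega) (by omega)
      by_contra hk0
      have l := inside (k + 1) (by omega) (by omega)
      exact not_int_of_mem l.1 l.2
        (h.ht_int_of_min hA hi (by omega) (not_lt.1 hk0) hk1.le)
  refine (h.bend (g := R.r i) (c := -R.root i) hy hxy.le hxp hyq hc ?_ ?_ ?_).mem_glsPaths hA
  · rintro j rfl -
    refine chain_r_right hA hi (h.chain j (by omega)) ?_ (slope _ hxy le_rfl)
    refine h.slope_nonpos i (by omega) ?_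
    rw [hnx, hp0]
    exact hmin _
  · intro j hj1 hj2
    have l := inside (j + 1) (by omega) (by omega)
    exact (chain_r_of_pos hA hi (h.chain j (by omega)) (slope _ hj2 (by omega))
      (h.coroot_not_int hA (by omega) l.1 l.2)).2
  · rintro j hj rfl
    have hc := slope j (by omega) hj
    refine .head (link_simple hA (h.mem_orbit (by omega)) hc (fun _ => ?_) (absurd hi))
      (h.chain j (by omega))
    obtain ⟨n, hn⟩ := h.ht_node hA i hy
    obtain ⟨m, hm⟩ := chain_exists_int hA (h.chain j (by omega)) i
    rw [hny, hq0] at hn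
    have e : a (j + 1) * v j (R.coroot i) = ((M + 1 - n - m : ℤ) : ℚ) := by
      push_cast; linarith
    have hpos : 0 < a (j + 1) * v j (R.coroot i) :=
      mul_pos (by rw [← h.a_zero]; exact h.a_strict (by omega) hy) hc
    rw [e] at hpos ⊢
    have hpos' : 0 < M + 1 - n - m := by exact_mod_cast hpos
    exact ⟨(M + 1 - n - m).toNat, by omega, by
      rw [← Int.cast_natCast, Int.toNat_of_nonneg hpos'.le]⟩

/-- As for `f_mem`, with negative velocities between `p` and `q`, a new last link at `p`, and a
chain that ends at a velocity nonnegative on `α_i^∨` at `q`. -/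
theorem e_mem (hA : IsBorcherdsCartan A) (hlam : lam ∈ R.dominantWeights)
    (h : R.PathData lam π s v a) (hi : A i i = 2) (he : R.ERealRel i π π') :
    π' ∈ R.glsPaths lam := by
  obtain ⟨p, q, hq, hq1, hp, rfl⟩ := he
  obtain ⟨hpq, h1, h2, h3⟩ := h.ht_e_interval hA hlam hi hq hp
  obtain ⟨-, hmin⟩ := h.minInt_spec hA hlam hi
  obtain ⟨s, v, a, h, x, hx, y, hy, hxp, hyq⟩ := h.exists_breaks p q
  set M := R.minInt i π with hM
  have hq0 : R.ht i π q = M := hq.1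
  have hp0 : R.ht i π p = M + 1 := hp.1.2
  have hnx : node a x = p := Subtype.ext (by rw [h.coe_node hx, hxp])
  have hny : node a y = q := Subtype.ext (by rw [h.coe_node hy, hyq])
  have hxy : x < y := by
    rw [← h.a_lt_iff hx hy, hxp, hyq]; exact hpq
  have hc : R.r i (π q - π p) = π q - π p + R.root i := by
    rw [r_sub_eq π p q (x := -1) (by rw [hp0, hq0]; ring), neg_smul, one_smul, neg_neg]
  have inside : ∀ k, x < k → k < y →
      M < R.ht i π (node a k) ∧ R.ht i π (node a k) < M + 1 := by
    intro k hk1 hk2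
    have l1 := h.node_lt hk1 (by omega)
    have l2 := h.node_lt hk2 hy
    rw [hnx] at l1
    rw [hny] at l2
    exact ⟨h1 _ l2, h2 _ l1 l2.le⟩
  -- the height function decreases strictly between `p` and `q`
  have slope : ∀ k, x ≤ k → k < y → v k (R.coroot i) < 0 := by
    have first : v x (R.coroot i) < 0 := by
      refine h.slope_neg i (by omega) ?_
      rw [hnx, hp0]
      have l1 := h.node_lt (show x < x + 1 by omega) (by omega)
      have l2 := h.node_le (show x + 1 ≤ y by omega) hy
      rw [hnx] at l1
      rw [hny] at l2
      exact h2 _ l1 l2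
    intro k hk
    induction k, hk using Nat.le_induction with
    | base => exact fun _ => first
    | succ k hk ih =>
      intro hky
      have hk1 := ih (by omega)
      by_contra hk0
      have l := inside (k + 1) (by omega) hky
      exact not_int_of_mem l.1 l.2
        (h.ht_int_of_min hA hi (by omega) hk1.le (not_lt.1 hk0))
  refine (h.bend (g := R.r i) (c := R.root i) hy hxy.le hxp hyq hc ?_ ?_ ?_).mem_glsPaths hA
  · rintro j rfl -
    have hc := slope _ le_rfl hxy
    refine .tail (h.chain j (by omega)) ?_
    have hl := link_simple hA (i := i) (a := a (j + 1))
      (r_mem_orbit (h.mem_orbit (j := j + 1) (by omega)) i)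
      (by rw [r_coroot hi]; linarith) (fun _ => ?_) (absurd hi)
    · rwa [r_r hi] at hl
    · rw [r_coroot hi]
      obtain ⟨n, hn⟩ := h.ht_node hA i hx
      rw [hnx, hp0] at hn
      have e : a (j + 1) * -v (j + 1) (R.coroot i) = ((n - M - 1 : ℤ) : ℚ) := by
        push_cast; linarith
      have hpos : 0 < a (j + 1) * -v (j + 1) (R.coroot i) :=
        mul_pos (by rw [← h.a_zero]; exact h.a_strict (by omega) hx) (by linarith)
      rw [e] at hpos ⊢
      have hpos' : 0 < n - M - 1 := by exact_mod_cast hpos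
      exact ⟨(n - M - 1).toNat, by omega, by
        rw [← Int.cast_natCast, Int.toNat_of_nonneg hpos'.le]⟩
  · intro j hj1 hj2
    have l := inside (j + 1) (by omega) (by omega)
    have hj := slope j hj1 (by omega)
    refine (chain_r_of_neg hA hi (h.chain j (by omega)) hj fun n hn => ?_).2
    obtain ⟨m, hm⟩ := chain_exists_int hA (h.chain j (by omega)) i
    exact h.coroot_not_int hA (by omega) l.1 l.2 (n + m) (by push_cast; linarith)
  · rintro j hj rfl
    refine chain_r_left hA hi (h.chain j (by omega)) (slope j hj (by omega)) ?_
    rcases (show j + 1 = s ∨ j + 1 < s by omega) with hs | hs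
    · rw [hs, h.v_last]
      exact hlam.2 i
    · refine h.slope_nonneg i hs ?_
      rw [hny, hq0]
      exact hmin _

theorem exists_eRealRel (hA : IsBorcherdsCartan A) (hlam : lam ∈ R.dominantWeights)
    (h : R.PathData lam π s v a) (hi : A i i = 2) (hneg : v 0 (R.coroot i) < 0) :
    ∃ π', R.ERealRel i π π' := by
  obtain ⟨hatt, hmin⟩ := h.minInt_spec hA hlam hi
  have hH := h.ht_linear i
  have hM : R.minInt i π < 0 := by
    have h1 := hmin (node a 1)
    have h2 := hH.node_succ h.s_pos
    rw [h.node_zero, h.ht_zero, h.a_zero, smul_eq_mul] at h2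
    have h3 := h.a_lt 0 h.s_pos
    rw [h.a_zero] at h3
    rw [zero_add] at h2 h3
    have h4 := mul_neg_of_pos_of_neg h3 hneg
    have : (R.minInt i π : ℚ) < 0 := by linarith
    exact_mod_cast this
  obtain ⟨q, hq⟩ := hH.exists_isLeast hatt
  have hq0 : R.ht i π q = R.minInt i π := hq.1
  have hM1 : (R.minInt i π : ℚ) + 1 ≤ 0 := by exact_mod_cast hM
  have h0q : 0 < q := by
    refine lt_of_le_of_ne q.2.1 fun e => ?_
    rw [← e, h.ht_zero] at hq0
    linarith
  obtain ⟨w, hw1, hw2, hw3⟩ := hH.exists_eq (N := R.minInt i π + 1) h0q.le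
    (Or.inr ⟨by rw [hq0]; linarith, by rw [h.ht_zero]; exact hM1⟩)
  obtain ⟨s', v', a', h', -, -, y, hy, -, hyq⟩ := h.exists_breaks q q
  obtain ⟨p, hp⟩ := (h'.ht_linear i).exists_isGreatest (N := R.minInt i π + 1) hy
    ⟨w, by rw [hyq]; exact hw2, hw3⟩
  rw [hyq] at hp
  exact ⟨_, p, q, hq, h0q, hp, rfl⟩

end PathData

end Realization
end BorcherdsPath

namespace BorcherdsPath

theorem PiecewiseLinear.monotone {H : UnitQ → ℚ} {s : ℕ} {c : ℕ → ℚ} {a : ℕ → ℚ}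
    (h : PiecewiseLinear H s c a) (hc : ∀ j, j < s → 0 ≤ c j) : Monotone H := by
  have key : ∀ j, j ≤ s → ∀ t u : UnitQ, t ≤ u → (u : ℚ) ≤ a j → H t ≤ H u := by
    intro j
    induction j with
    | zero =>
      intro _ t u htu hu
      rw [h.a_zero] at hu
      rw [le_antisymm htu (show (u : ℚ) ≤ t from hu.trans t.2.1)]
    | succ j ih =>
      intro hj t u htu hu
      have htu' : (t : ℚ) ≤ u := htu
      rcases le_total (u : ℚ) (a j) with h1 | h1
      · exact ih (by omega) t u htu h1
      have h2 := h.coe_node (j := j) (by omega)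
      have piece : ∀ t : UnitQ, a j ≤ t → t ≤ u → H t ≤ H u := by
        intro t h3 h4
        have h4' : (t : ℚ) ≤ u := h4
        rw [h.lin j hj t u h3 (h4'.trans hu) h1 hu, smul_eq_mul]
        have := mul_nonneg (sub_nonneg.2 h4') (hc j hj)
        linarith
      rcases le_total (a j) (t : ℚ) with h3 | h3
      · exact piece t h3 htu
      · exact (ih (by omega) t (node a j) (show (t : ℚ) ≤ node a j by rwa [h2]) h2.le).trans
          (piece (node a j) h2.ge (show (node a j : ℚ) ≤ u by rwa [h2]))
  exact fun t u htu => key s le_rfl t u htu (by rw [h.a_last]; exact u.2.2)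

namespace Realization

variable {I : Type*} {A : Matrix I I ℤ} {𝔥 : Type*} [AddCommGroup 𝔥] [Module ℚ 𝔥]
  {R : Realization A 𝔥}

open Relation

/-! ### Imaginary root operators -/

variable (R) in
/-- `R.rInv i` as a linear map. -/
def rInvLin (i : I) : Dual ℚ 𝔥 →ₗ[ℚ] Dual ℚ 𝔥 where
  toFun := R.rInv i
  map_add' x y := by
    simp only [rInv, LinearMap.add_apply]
    module
  map_smul' q x := by
    simp only [rInv, LinearMap.smul_apply, smul_eq_mul, RingHom.id_apply]
    module

theorem rInvLin_apply (i : I) (x : Dual ℚ 𝔥) :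
    R.rInvLin i x = x + (1 / (1 - (A i i : ℚ)) * x (R.coroot i)) • R.root i := rfl

theorem one_sub_pos (hA : IsBorcherdsCartan A) {i : I} (hi : A i i ≠ 2) :
    (1 : ℚ) ≤ 1 - A i i := by
  have : (A i i : ℚ) ≤ 0 := by exact_mod_cast IsBorcherdsCartan.le_zero_of_ne_two hA hi
  linarith

theorem rInvLin_coroot (hA : IsBorcherdsCartan A) {i : I} (hi : A i i ≠ 2) (x : Dual ℚ 𝔥) :
    R.rInvLin i x (R.coroot i) = x (R.coroot i) / (1 - A i i) := by
  have h1 := one_sub_pos hA hi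
  have h2 : (1 - A i i : ℚ) ≠ 0 := by linarith
  rw [rInvLin_apply, LinearMap.add_apply, LinearMap.smul_apply, R.root_coroot, smul_eq_mul]
  field_simp
  ring

theorem rInvLin_r (hA : IsBorcherdsCartan A) {i : I} (hi : A i i ≠ 2) (x : Dual ℚ 𝔥) :
    R.rInvLin i (R.r i x) = x := by
  have h1 := one_sub_pos hA hi
  have h2 : (1 - A i i : ℚ) ≠ 0 := by linarith
  rw [rInvLin_apply, r_coroot_im, ← mul_assoc, one_div_mul_cancel h2, one_mul, r_apply,
    sub_add_cancel]

theorem r_rInvLin (hA : IsBorcherdsCartan A) {i : I} (hi : A i i ≠ 2) (x : Dual ℚ 𝔥) :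
    R.r i (R.rInvLin i x) = x := by
  rw [r_apply, rInvLin_coroot hA hi, rInvLin_apply, one_div_mul_eq_div, add_sub_cancel_right]

namespace PathData

variable {lam : Dual ℚ 𝔥} {π π' : PathMap 𝔥} {s : ℕ} {v : ℕ → Dual ℚ 𝔥} {a : ℕ → ℚ} {i : I}
  {p q : UnitQ}

theorem coroot_antitone_im (hA : IsBorcherdsCartan A) (h : R.PathData lam π s v a)
    (hi : A i i ≠ 2) {j : ℕ} (hj : j ≤ s) : v j (R.coroot i) ≤ v 0 (R.coroot i) := by
  induction j with
  | zero => exact le_rfl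
  | succ j ih => exact (chain_coroot_le hA hi (h.chain j hj)).trans (ih (by omega))

theorem ht_node_sub_succ (h : R.PathData lam π s v a) (i : I) {j : ℕ} (hj : j < s) :
    R.ht i π (node a (j + 1)) - a (j + 1) * v (j + 1) (R.coroot i) =
      R.ht i π (node a j) - a j * v j (R.coroot i) +
        a (j + 1) * (v j (R.coroot i) - v (j + 1) (R.coroot i)) := by
  rw [(h.ht_linear i).node_succ hj, smul_eq_mul]
  ring

theorem ht_node_sub_mono (hA : IsBorcherdsCartan A) (h : R.PathData lam π s v a)
    (hi : A i i ≠ 2) {j k : ℕ} (hjk : j ≤ k) (hk : k ≤ s) :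
    R.ht i π (node a j) - a j * v j (R.coroot i) ≤
      R.ht i π (node a k) - a k * v k (R.coroot i) := by
  induction k, hjk using Nat.le_induction with
  | base => exact le_rfl
  | succ k hjk ih =>
    refine (ih (by omega)).trans ?_
    rw [h.ht_node_sub_succ i hk]
    have h1 : 0 ≤ a (k + 1) := by rw [← h.a_zero]; exact h.a_mono (Nat.zero_le _) hk
    have h2 := mul_nonneg h1 (sub_nonneg.2 (chain_coroot_le hA hi (h.chain k hk)))
    linarith

section Imaginary

variable (hA : IsBorcherdsCartan A) (hlam : lam ∈ R.dominantWeights)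
  (h : R.PathData lam π s v a) (hi : A i i ≠ 2)

include hA hlam h hi

theorem coroot_nonneg_im {j : ℕ} (hj : j ≤ s) : 0 ≤ v j (R.coroot i) :=
  orbit_coroot_nonneg hA hlam (h.mem_orbit hj) hi

theorem ht_monotone_im : Monotone (R.ht i π) :=
  (h.ht_linear i).monotone fun _ hj => h.coroot_nonneg_im hA hlam hi hj.le

theorem ht_nonneg_im (t : UnitQ) : 0 ≤ R.ht i π t := by
  rw [← h.ht_zero i]
  exact h.ht_monotone_im hA hlam hi t.2.1

theorem minInt_im : R.minInt i π = 0 :=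
  minInt_eq (t := 0) (by rw [h.ht_zero]; simp)
    fun u => by simpa using h.ht_nonneg_im hA hlam hi u

/-- The height function of an imaginary simple root is concave, hence it vanishes identically if
it vanishes at a positive time. -/
theorem ht_one_of_ht_eq_zero {t : UnitQ} (ht0 : 0 < t) (ht : R.ht i π t = 0) :
    R.ht i π 1 = 0 := by
  have hmono := h.ht_monotone_im hA hlam hi
  have h0 : (0 : ℚ) < t := ht0
  have h1 := h.a_lt 0 h.s_pos
  rw [h.a_zero, zero_add] at h1
  have hc : v 0 (R.coroot i) ≤ 0 := by
    by_contra hc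
    rw [not_le] at hc
    have hle : R.ht i π (min t (node a 1)) ≤ 0 := by
      exact (hmono (min_le_left _ _)).trans_eq ht
    have hn : (node a 1 : ℚ) = a 1 := h.coe_node h.s_pos
    have hm : 0 < ((min t (node a 1) : UnitQ) : ℚ) ∧ ((min t (node a 1) : UnitQ) : ℚ) ≤ a 1 := by
      rcases le_total t (node a 1) with h2 | h2
      · rw [min_eq_left h2, ← hn]; exact ⟨h0, h2⟩
      · rw [min_eq_right h2, hn]; exact ⟨h1, le_rfl⟩
    rw [(h.ht_linear i).lin_left h.s_pos (by rw [h.a_zero]; exact hm.1.le) hm.2, h.node_zero,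
      h.ht_zero, h.a_zero, smul_eq_mul] at hle
    have := mul_pos hm.1 hc
    linarith
  have key : ∀ j, j ≤ s → R.ht i π (node a j) = 0 := by
    intro j
    induction j with
    | zero => intro _; rw [h.node_zero, h.ht_zero]
    | succ j ih =>
      intro hj
      have e : v j (R.coroot i) = 0 := le_antisymm
        ((h.coroot_antitone_im hA hi (by omega)).trans hc)
        (h.coroot_nonneg_im hA hlam hi (by omega))
      rw [(h.ht_linear i).node_succ hj, ih (by omega), e, smul_zero, add_zero]
  rw [← h.node_last, key s le_rfl]

theorem eq_zero_of_isGreatest (hp : IsGreatest {t | R.ht i π t = R.minInt i π} p) (hp1 : p < 1) :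
    p = 0 := by
  have hp0 : R.ht i π p = R.minInt i π := hp.1
  rw [h.minInt_im hA hlam hi, Int.cast_zero] at hp0
  by_contra hne
  have h0 : 0 < p := lt_of_le_of_ne p.2.1 (Ne.symm hne)
  have h1 := h.ht_one_of_ht_eq_zero hA hlam hi h0 hp0
  refine absurd (hp.2 (show R.ht i π 1 = R.minInt i π from ?_)) (not_le.2 hp1)
  rw [h1, h.minInt_im hA hlam hi, Int.cast_zero]

theorem fRel_eImRel (hf : R.FRel i π π') : R.EImRel i π' π := by
  obtain ⟨p, q, hp, hp1, hq, rfl⟩ := hf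
  obtain rfl := h.eq_zero_of_isGreatest hA hlam hi hp hp1
  have hmono := h.ht_monotone_im hA hlam hi
  have hnn := h.ht_nonneg_im hA hlam hi
  have hM := h.minInt_im hA hlam hi
  have hz := h.ht_zero i
  have hd := one_sub_pos hA hi
  rw [hM] at hp hq
  have hq0 : R.ht i π q = 1 := by have := hq.1.2; push_cast at this; linarith
  have hlt : ∀ t, t < q → R.ht i π t < 1 := fun t ht =>
    lt_of_le_of_ne (hq0 ▸ hmono ht.le) fun e =>
      absurd (hq.2 ⟨t.2.1, by rw [e]; simp⟩) (not_le.2 ht)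
  have hge : ∀ t, q ≤ t → 1 ≤ R.ht i π t := fun t ht => hq0 ▸ hmono ht
  have hpos : ∀ t, 0 < t → 0 < R.ht i π t := fun t ht =>
    lt_of_le_of_ne (hnn t) fun e =>
      absurd (hp.2 (show R.ht i π t = ((0 : ℤ) : ℚ) by rw [← e]; simp)) (not_le.2 ht)
  have hc : R.r i (π q - π 0) = π q - π 0 + -R.root i := by
    rw [r_sub_eq π 0 q (x := 1) (by rw [hz, hq0]; ring), one_smul]
  have hq0' : (0 : UnitQ) ≤ q := q.2.1
  set π' := Realization.bend (R.r i) (-R.root i) 0 q π with hπ'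
  have b2 : ∀ t, t ≤ q → R.ht i π' t = (1 - A i i) * R.ht i π t := fun t ht => by
    rw [ht_def, hπ', bend_of_mem t.2.1 ht, h.map_zero, sub_zero, zero_add, r_coroot_im, ht_def]
  have b3 : ∀ t, q ≤ t → R.ht i π' t = R.ht i π t - A i i := fun t ht => by
    rw [ht_def, hπ', bend_of_ge hq0' hc ht, ht_add, LinearMap.neg_apply, R.root_coroot]; ring
  have hnn' : ∀ t, 0 < t → 0 < R.ht i π' t := fun t ht => by
    rcases le_total t q with ht' | ht'
    · rw [b2 t ht']; exact mul_pos (by linarith) (hpos t ht)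
    · rw [b3 t ht']; linarith [hge t ht']
  have hz' : R.ht i π' 0 = 0 := by rw [b2 0 hq0', hz, mul_zero]
  have hM' : R.minInt i π' = 0 := by
    refine minInt_eq (t := 0) (by rw [hz']; simp) fun u => ?_
    rw [Int.cast_zero]
    rcases (show (0 : UnitQ) ≤ u from u.2.1).eq_or_lt with hu | hu
    · rw [← hu, hz']
    · exact (hnn' u hu).le
  refine ⟨0, q, ⟨?_, ?_⟩, hp1, ⟨⟨hq0', ?_⟩, ?_⟩, ?_, ?_⟩
  · change R.ht i π' 0 = _
    rw [hM', hz', Int.cast_zero]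
  · intro t (ht : R.ht i π' t = _)
    rw [hM', Int.cast_zero] at ht
    by_contra hlt
    exact absurd ht (hnn' t (not_le.1 hlt)).ne'
  · rw [hM', b2 q le_rfl, hq0]; push_cast; ring
  · rintro t ⟨-, ht⟩
    rw [hM'] at ht
    by_contra hlt'
    rw [not_le] at hlt'
    rw [b2 t hlt'.le] at ht
    have := mul_pos (show (0 : ℚ) < 1 - A i i by linarith) (sub_pos.2 (hlt t hlt'))
    push_cast at ht
    linarith
  · intro t ht
    rw [hM', b3 t ht]
    push_cast
    linarith [hge t ht]
  · have := bend_bend (g' := R.rInvLin i) hq0' hc (rInvLin_r hA hi)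
    rwa [neg_neg] at this

theorem eImRel_fRel (he : R.EImRel i π π') : R.FRel i π' π := by
  obtain ⟨p, q, hp, hp1, hq, hafter, rfl⟩ := he
  obtain rfl := h.eq_zero_of_isGreatest hA hlam hi hp hp1
  have hmono := h.ht_monotone_im hA hlam hi
  have hnn := h.ht_nonneg_im hA hlam hi
  have hM := h.minInt_im hA hlam hi
  have hz := h.ht_zero i
  have hd := one_sub_pos hA hi
  have hd0 : (0 : ℚ) < 1 - A i i := by linarith
  rw [hM] at hp hq hafter
  have hq0 : R.ht i π q = 1 - A i i := by have := hq.1.2; push_cast at this; linarith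
  have hlt : ∀ t, t < q → R.ht i π t < 1 - A i i := fun t ht =>
    lt_of_le_of_ne (hq0 ▸ hmono ht.le) fun e =>
      absurd (hq.2 ⟨t.2.1, by rw [e]; simp⟩) (not_le.2 ht)
  have hpos : ∀ t, 0 < t → 0 < R.ht i π t := fun t ht =>
    lt_of_le_of_ne (hnn t) fun e =>
      absurd (hp.2 (show R.ht i π t = ((0 : ℤ) : ℚ) by rw [← e]; simp)) (not_le.2 ht)
  have hc : R.rInvLin i (π q - π 0) = π q - π 0 + R.root i := by
    rw [rInvLin_apply, h.map_zero, sub_zero, ← ht_def, hq0, one_div_mul_cancel hd0.ne', one_smul]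
  have hq0' : (0 : UnitQ) ≤ q := q.2.1
  change R.FRel i (Realization.bend (R.rInvLin i) (R.root i) 0 q π) π
  set π' := Realization.bend (R.rInvLin i) (R.root i) 0 q π with hπ'
  have b2 : ∀ t, t ≤ q → R.ht i π' t = R.ht i π t / (1 - A i i) := fun t ht => by
    rw [ht_def, hπ', bend_of_mem t.2.1 ht, h.map_zero, sub_zero, zero_add,
      rInvLin_coroot hA hi, ht_def]
  have b3 : ∀ t, q ≤ t → R.ht i π' t = R.ht i π t + A i i := fun t ht => by
    rw [ht_def, hπ', bend_of_ge hq0' hc ht, ht_add, R.root_coroot]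
  have hnn' : ∀ t, 0 < t → 0 < R.ht i π' t := fun t ht => by
    rcases le_total t q with ht' | ht'
    · rw [b2 t ht']; exact div_pos (hpos t ht) hd0
    · have := hafter t ht'
      push_cast at this
      rw [b3 t ht']; linarith
  have hz' : R.ht i π' 0 = 0 := by rw [b2 0 hq0', hz, zero_div]
  have hM' : R.minInt i π' = 0 := by
    refine minInt_eq (t := 0) (by rw [hz']; simp) fun u => ?_
    rw [Int.cast_zero]
    rcases (show (0 : UnitQ) ≤ u from u.2.1).eq_or_lt with hu | hu
    · rw [← hu, hz']
    · exact (hnn' u hu).le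
  refine ⟨0, q, ⟨?_, ?_⟩, hp1, ⟨⟨hq0', ?_⟩, ?_⟩, ?_⟩
  · change R.ht i π' 0 = _
    rw [hM', hz', Int.cast_zero]
  · intro t (ht : R.ht i π' t = _)
    rw [hM', Int.cast_zero] at ht
    by_contra hlt
    exact absurd ht (hnn' t (not_le.1 hlt)).ne'
  · rw [hM', b2 q le_rfl, hq0, div_self hd0.ne']; push_cast; ring
  · rintro t ⟨-, ht⟩
    rw [hM'] at ht
    by_contra hlt'
    rw [not_le] at hlt'
    rw [b2 t hlt'.le, div_eq_iff hd0.ne'] at ht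
    push_cast at ht
    linarith [hlt t hlt']
  · exact bend_bend (g' := R.r i) hq0' hc (r_rInvLin hA hi)

/-- The part of the path before the time `q` at which the height function reaches `1` has velocities
with constant pairing with `α_i^∨`: the integer `h_i(t) - t α_i^∨(v)` increases at each break
point where the pairing drops. -/
theorem f_mem_im (hf : R.FRel i π π') : π' ∈ R.glsPaths lam := by
  obtain ⟨p, q, hp, hp1, hq, rfl⟩ := hf
  obtain rfl := h.eq_zero_of_isGreatest hA hlam hi hp hp1
  obtain ⟨s, v, a, h, -, -, y, hy, -, hyq⟩ := h.exists_breaks q q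
  have hmono := h.ht_monotone_im hA hlam hi
  have hM := h.minInt_im hA hlam hi
  rw [hM] at hq
  have hq0 : R.ht i π q = 1 := by have := hq.1.2; push_cast at this; linarith
  have hny : node a y = q := Subtype.ext (by rw [h.coe_node hy, hyq])
  have hy0 : 0 < y := by
    rcases Nat.eq_zero_or_pos y with rfl | hy0
    · rw [← hny, h.node_zero, h.ht_zero] at hq0
      norm_num at hq0
    · exact hy0
  have hc : R.r i (π q - π 0) = π q - π 0 + -R.root i := by
    rw [r_sub_eq π 0 q (x := 1) (by rw [h.ht_zero, hq0]; ring), one_smul]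
  have hay : ∀ j, 0 < j → j ≤ s → 0 < a j := fun j h1 h2 => by
    rw [← h.a_zero]; exact h.a_strict h1 h2
  obtain ⟨k, rfl⟩ : ∃ k, y = k + 1 := ⟨y - 1, by omega⟩
  have hstep := (h.ht_linear i).node_succ (j := k) (by omega)
  rw [hny, hq0, smul_eq_mul] at hstep
  have hck : 0 < v k (R.coroot i) := by
    refine h.slope_pos i (by omega) ?_
    have hlt := h.node_lt (show k < k + 1 by omega) hy
    rw [hny] at hlt ⊢
    refine lt_of_le_of_ne (hmono hlt.le) fun e => absurd (hq.2 ⟨(node a k).2.1, ?_⟩) (not_le.2 hlt)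
    rw [e, hq0]; simp
  have hN0 : R.ht i π (node a 0) - a 0 * v 0 (R.coroot i) = 0 := by
    rw [h.node_zero, h.ht_zero, h.a_zero]; ring
  have hNk : R.ht i π (node a k) - a k * v k (R.coroot i) = 0 := by
    obtain ⟨n, hn⟩ := h.ht_node hA i (j := k) (by omega)
    have h1 := h.ht_node_sub_mono hA hi (Nat.zero_le k) (by omega)
    have h2 := mul_pos (hay _ hy0 hy) hck
    rw [hN0, hn] at h1
    rw [hn] at hstep ⊢
    have h3 : (0 : ℚ) ≤ n := by linarith
    have h4 : (n : ℚ) < 1 := by linarith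
    have h5 : 0 ≤ n := by exact_mod_cast h3
    have h6 : n < 1 := by exact_mod_cast h4
    obtain rfl : n = 0 := by omega
    simp
  have hconst : ∀ j, j < k → v j (R.coroot i) = v (j + 1) (R.coroot i) := by
    intro j hj
    have h1 := h.ht_node_sub_mono hA hi (Nat.zero_le j) (by omega)
    have h2 := h.ht_node_sub_mono hA hi (show j + 1 ≤ k from hj) (by omega)
    have h3 := h.ht_node_sub_succ i (j := j) (by omega)
    have h4 := chain_coroot_le hA hi (h.chain j (by omega))
    rw [hN0] at h1
    rw [hNk] at h2
    have h5 : a (j + 1) * (v j (R.coroot i) - v (j + 1) (R.coroot i)) ≤ 0 := by linarith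
    have h6 : ¬ 0 < v j (R.coroot i) - v (j + 1) (R.coroot i) := fun h6 =>
      absurd (mul_pos (hay (j + 1) (by omega) (by omega)) h6) (not_lt.2 h5)
    linarith
  refine (h.bend (g := R.r i) (c := -R.root i) hy (Nat.zero_le _) h.a_zero hyq hc ?_ ?_
    ?_).mem_glsPaths hA
  · intro j hj
    omega
  · intro j _ hj
    exact chain_r_im hA hi (h.chain j (by omega)) (hconst j (by omega))
  · intro j _ hj
    obtain rfl : j = k := by omega
    exact .head (link_simple hA (h.mem_orbit (by omega)) hck (fun h' => absurd h' hi)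
      fun _ => by linarith) (h.chain j (by omega))

end Imaginary

end PathData

end Realization
end BorcherdsPath

namespace BorcherdsPath
namespace Realization

variable {I : Type*} {A : Matrix I I ℤ} {𝔥 : Type*} [AddCommGroup 𝔥] [Module ℚ 𝔥]
  {R : Realization A 𝔥}

open Relation

/-! ### Weights of paths -/

namespace PathData

variable {lam : Dual ℚ 𝔥} {π π' : PathMap 𝔥} {s : ℕ} {v : ℕ → Dual ℚ 𝔥} {a : ℕ → ℚ}

theorem sub_map_one_mem (hA : IsBorcherdsCartan A) (h : R.PathData lam π s v a) :
    lam - π 1 ∈ R.posRootLattice := by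
  have key : ∀ j, j ≤ s → a j • v j - π (node a j) ∈ R.posRootLattice := by
    intro j
    induction j with
    | zero =>
      intro _
      rw [h.node_zero, h.map_zero, h.a_zero, zero_smul, sub_zero]
      exact zero_mem _
    | succ j ih =>
      intro hj
      have := add_mem (ih (by omega)) (chain_smul_sub_mem hA (h.chain j hj))
      rw [h.node_succ hj]
      convert this using 1
      module
  have := key s le_rfl
  rwa [h.a_last, h.v_last, h.node_last, one_smul] at this

theorem map_one_mem_weights (hA : IsBorcherdsCartan A) (hlam : lam ∈ R.dominantWeights)
    (h : R.PathData lam π s v a) : π 1 ∈ R.weights := fun i => h.ht_one hA hlam i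

theorem eq_smul_of_le (h : R.PathData lam π s v a) {y : ℕ} (hy0 : 0 < y) (hy : y ≤ s)
    {x : Dual ℚ 𝔥} (hv : ∀ j, j < y → v j = x) {t : UnitQ} (ht : (t : ℚ) ≤ a y) :
    π t = (t : ℚ) • x := by
  have key : ∀ j, j ≤ y → π (node a j) = a j • x := by
    intro j
    induction j with
    | zero => intro _; rw [h.node_zero, h.map_zero, h.a_zero, zero_smul]
    | succ j ih =>
      intro hj
      rw [h.node_succ (by omega), ih (by omega), hv j (by omega)]
      module
  obtain ⟨j, -, h1, h2, h3⟩ := PiecewiseLinear.exists_lt_le (a := a) (t := t) hy0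
    (by rw [h.a_zero]; exact t.2.1) ht
  rw [h.lin_left (by omega) h2 h3, key j (by omega), hv j h1]
  module

end PathData

theorem straightPath_pathData (lam : Dual ℚ 𝔥) :
    R.PathData lam (straightPath lam) 1 (fun _ => lam) (fun j => j) where
  a_zero := Nat.cast_zero
  a_last := Nat.cast_one
  a_lt j _ := by push_cast; linarith
  lin j _ t u _ _ _ _ := by
    simp only [straightPath]
    module
  map_zero := zero_smul ℚ lam
  v_last := rfl
  chain _ _ := .refl

theorem FRel.map_one {i : I} {π π' : PathMap 𝔥} (hf : R.FRel i π π') : π' 1 = π 1 - R.root i := by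
  obtain ⟨p, q, hp, -, hq, rfl⟩ := hf
  have hp0 : R.ht i π p = R.minInt i π := hp.1
  have hq0 : R.ht i π q = R.minInt i π + 1 := hq.1.2
  rw [bend_of_ge hq.1.1 (g := R.r i) _ q.2.2, ← sub_eq_add_neg]
  rw [r_sub_eq π p q (x := 1) (by rw [hp0, hq0]; ring), one_smul]

/-! ### The crystal of generalized Lakshmibai-Seshadri paths -/

section Crystal

variable {lam : Dual ℚ 𝔥} {π π' : PathMap 𝔥} {i : I}

theorem FRel.mem_glsPaths (hA : IsBorcherdsCartan A) (hlam : lam ∈ R.dominantWeights)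
    (hπ : π ∈ R.glsPaths lam) (hf : R.FRel i π π') : π' ∈ R.glsPaths lam := by
  obtain ⟨s, v, a, h⟩ := exists_pathData_of_mem hπ
  by_cases hi : A i i = 2
  · exact h.f_mem hA hlam hi hf
  · exact h.f_mem_im hA hlam hi hf

/-- On generalized Lakshmibai-Seshadri paths the operators `e_i` and `f_i` are inverse to each
other. -/
theorem eRel_iff_fRel (hA : IsBorcherdsCartan A) (hlam : lam ∈ R.dominantWeights)
    (hπ : π ∈ R.glsPaths lam) (hπ' : π' ∈ R.glsPaths lam) : R.ERel i π π' ↔ R.FRel i π' π := by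
  obtain ⟨s, v, a, h⟩ := exists_pathData_of_mem hπ
  obtain ⟨s', v', a', h'⟩ := exists_pathData_of_mem hπ'
  by_cases hi : A i i = 2
  · refine ⟨?_, fun hf => Or.inl ⟨hi, hf.eRealRel hA hlam h' hi⟩⟩
    rintro (⟨-, he⟩ | ⟨hi', -⟩)
    · exact (he.fRel hA hlam h hi).1
    · exact absurd hi hi'
  · refine ⟨?_, fun hf => Or.inr ⟨hi, h'.fRel_eImRel hA hlam hi hf⟩⟩
    rintro (⟨hi', -⟩ | ⟨-, he⟩)
    · exact absurd hi' hi
    · exact h.eImRel_fRel hA hlam hi he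

/-- If the initial velocity is negative on a real simple coroot, the corresponding `e_i` applies.
Otherwise the first velocity different from the initial one arises by a chain whose first link is
the reflection in an imaginary simple root `α_i`, and `e_i` undoes this link. -/
theorem exists_eRel_mem (hA : IsBorcherdsCartan A) (hlam : lam ∈ R.dominantWeights)
    (hπ : π ∈ R.glsPaths lam) (hne : π ≠ straightPath lam) :
    ∃ i π', R.ERel i π π' ∧ π' ∈ R.glsPaths lam := by
  obtain ⟨s, v, a, h⟩ := exists_pathData_of_mem hπ
  by_cases hneg : ∃ i, A i i = 2 ∧ v 0 (R.coroot i) < 0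
  · obtain ⟨i, hi, hv⟩ := hneg
    obtain ⟨π', he⟩ := h.exists_eRealRel hA hlam hi hv
    exact ⟨i, π', Or.inl ⟨hi, he⟩, h.e_mem hA hlam hi he⟩
  have hdom : ∀ i, A i i = 2 → 0 ≤ v 0 (R.coroot i) := fun i hi =>
    not_lt.1 fun hv => hneg ⟨i, hi, hv⟩
  have hch : ∃ j, j ≤ s ∧ v j ≠ v 0 := by
    by_contra hch
    have hall : ∀ j, j ≤ s → v j = v 0 := fun j hj => by
      by_contra hj'
      exact hch ⟨j, hj, hj'⟩
    refine hne (funext fun t => ?_)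
    refine h.eq_smul_of_le h.s_pos le_rfl (fun j hj => ?_) (by rw [h.a_last]; exact t.2.2)
    rw [hall j hj.le, ← hall s le_rfl, h.v_last]
  classical
  obtain ⟨hks, hkne⟩ := Nat.find_spec hch
  have hmin := fun j => Nat.find_min hch (m := j)
  generalize Nat.find hch = y at hks hkne hmin
  obtain ⟨k, rfl⟩ : ∃ k, y = k + 1 := ⟨y - 1, by
    rcases Nat.eq_zero_or_pos y with rfl | hy
    · exact absurd rfl hkne
    · omega⟩
  have hv : ∀ j, j < k + 1 → v j = v 0 := fun j hj => by
    by_contra hj'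
    exact hmin j hj ⟨by omega, hj'⟩
  have hch := h.chain k hks
  rw [hv k (by omega)] at hch
  obtain heq | ⟨κ, hl, hκ⟩ := ReflTransGen.cases_head hch
  · exact absurd heq.symm hkne
  obtain ⟨i, hi, hvκ, hκ0, haκ⟩ := hl.exists_imaginary hA hlam hdom
  have hd := one_sub_pos hA hi
  set q := node a (k + 1) with hq
  have hqa : (q : ℚ) = a (k + 1) := h.coe_node hks
  have hc0 : 0 < v 0 (R.coroot i) := by
    rw [hvκ, r_coroot_im]; exact mul_pos (by linarith) hκ0
  have hlin : ∀ t, t ≤ q → R.ht i π t = t * v 0 (R.coroot i) := fun t ht => by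
    have ht' : (t : ℚ) ≤ q := ht
    rw [ht_def, h.eq_smul_of_le (Nat.succ_pos k) hks hv (ht'.trans_eq hqa)]
    rfl
  have hHq : R.ht i π q = 1 - A i i := by
    rw [hlin q le_rfl, hqa, hvκ, r_coroot_im, mul_left_comm, haκ, mul_one]
  have hmono := h.ht_monotone_im hA hlam hi
  have hM := h.minInt_im hA hlam hi
  have hc : R.rInvLin i (π q - π 0) = π q - π 0 + R.root i := by
    rw [rInvLin_apply, h.map_zero, sub_zero, ← ht_def, hHq,
      one_div_mul_cancel (by linarith), one_smul]
  refine ⟨i, bend (R.rInvLin i) (R.root i) 0 q π, Or.inr ⟨hi, 0, q, ⟨?_, ?_⟩, ?_, ⟨⟨q.2.1, ?_⟩, ?_⟩,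
    ?_, rfl⟩, ?_⟩
  · change R.ht i π 0 = _
    rw [h.ht_zero, hM, Int.cast_zero]
  · intro t (ht : R.ht i π t = _)
    rw [hM, Int.cast_zero] at ht
    by_contra hlt
    rw [not_le] at hlt
    have h0 : (0 : ℚ) < t := hlt
    rcases le_total t q with h1 | h1
    · rw [hlin t h1] at ht
      exact absurd ht (mul_pos h0 hc0).ne'
    · have := hmono h1
      rw [hHq, ht] at this
      linarith
  · exact show ((0 : UnitQ) : ℚ) < 1 from zero_lt_one
  · rw [hHq, hM]; push_cast; ring
  · rintro t ⟨-, ht⟩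
    rw [hM] at ht
    by_contra hlt
    rw [not_le] at hlt
    have hlt' : (t : ℚ) < q := hlt
    rw [hlin q le_rfl] at hHq
    rw [hlin t hlt.le] at ht
    have := mul_pos (sub_pos.2 hlt') hc0
    push_cast at ht
    linarith
  · intro t ht
    have := hmono ht
    rw [hHq] at this
    rw [hM]
    push_cast
    linarith
  · refine (h.bend (g := R.rInvLin i) (c := R.root i) hks (Nat.zero_le _) h.a_zero hqa.symm hc ?_ ?_
      ?_).mem_glsPaths hA
    · intro j hj
      omega
    · intro j _ hj
      rw [hv j (by omega), hv (j + 1) hj]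
    · intro j _ hj
      obtain rfl : j = k := by omega
      rw [hv j (by omega), hvκ, rInvLin_r hA hi]
      exact hκ

theorem truncate_eq_some_iff {X : Set (PathMap 𝔥)} {o : Option (PathMap 𝔥)} {x : X} :
    truncate X o = some x ↔ o = some x.1 := by
  cases o with
  | none => simp [truncate]
  | some y =>
    by_cases hy : y ∈ X
    · simp [truncate, hy, Subtype.ext_iff]
    · simp only [truncate, Option.bind_some, dif_neg hy, reduceCtorEq, false_iff,
        Option.some.injEq]
      rintro rfl
      exact hy x.2

theorem glsCrystal_e_eq_some {b b' : R.glsPaths lam} :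
    (R.glsCrystal lam).e i b = some b' ↔ R.ERel i b.1 b'.1 :=
  truncate_eq_some_iff.trans R.e_eq_some_iff

theorem glsCrystal_f_eq_some {b b' : R.glsPaths lam} :
    (R.glsCrystal lam).f i b = some b' ↔ R.FRel i b.1 b'.1 :=
  truncate_eq_some_iff.trans R.f_eq_some_iff

theorem map_one_of_eRel (hA : IsBorcherdsCartan A) (hlam : lam ∈ R.dominantWeights)
    (hπ : π ∈ R.glsPaths lam) (hπ' : π' ∈ R.glsPaths lam) (he : R.ERel i π π') :
    π' 1 = π 1 + R.root i := by
  rw [((eRel_iff_fRel hA hlam hπ hπ').1 he).map_one, sub_add_cancel]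

theorem glsCrystal_isCrystal (hA : IsBorcherdsCartan A) (hlam : lam ∈ R.dominantWeights) :
    (R.glsCrystal lam).IsCrystal where
  wt_mem b := by
    obtain ⟨s, v, a, h⟩ := exists_pathData_of_mem b.2
    exact h.map_one_mem_weights hA hlam
  phi_eq i b n hn := by
    have h1 : R.ht i b.1 1 = n := hn
    simp only [glsCrystal, h1, Int.floor_intCast]
    rfl
  wt_e i b b' he := map_one_of_eRel hA hlam b.2 b'.2 (glsCrystal_e_eq_some.1 he)
  eps_e_real i b b' hi he := by
    obtain ⟨s, v, a, h⟩ := exists_pathData_of_mem b.2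
    rcases glsCrystal_e_eq_some.1 he with ⟨-, he⟩ | ⟨hi', -⟩
    · simp only [glsCrystal, if_pos hi, (he.fRel hA hlam h hi).2]
      have : -R.minInt i b.1 = -(R.minInt i b.1 + 1) + 1 := by ring
      rw [this]
      rfl
    · exact absurd hi hi'
  eps_e_im i b b' hi _ := by simp only [glsCrystal, if_neg hi]
  e_iff_f i b b' := by
    rw [glsCrystal_e_eq_some, glsCrystal_f_eq_some, eRel_iff_fRel hA hlam b.2 b'.2]
  phi_bot i b h := absurd h WithBot.coe_ne_bot
  eps_im i b hi := by
    simp only [glsCrystal, if_neg hi]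
    rfl
  phi_im i b hi := by
    obtain ⟨s, v, a, h⟩ := exists_pathData_of_mem b.2
    right
    simp only [glsCrystal, if_neg hi, zero_add]
    exact_mod_cast Int.floor_nonneg.2 (h.ht_nonneg_im hA hlam hi 1)

theorem straightPath_mem (hA : IsBorcherdsCartan A) (lam : Dual ℚ 𝔥) :
    straightPath lam ∈ R.glsPaths lam := (straightPath_pathData lam).mem_glsPaths hA

/-- A nonzero `e_i π_λ` would have the weight `λ + α_i`, which does not lie in `λ - Q^+`. -/
theorem glsCrystal_e_eq_none_iff (hA : IsBorcherdsCartan A) (hlam : lam ∈ R.dominantWeights)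
    (b : R.glsPaths lam) : (∀ i, (R.glsCrystal lam).e i b = none) ↔
      b = ⟨straightPath lam, straightPath_mem hA lam⟩ := by
  constructor
  · intro h
    by_contra hne
    obtain ⟨i, π', he, hπ'⟩ := exists_eRel_mem hA hlam b.2 fun e => hne (Subtype.ext e)
    have := glsCrystal_e_eq_some.2 (show R.ERel i b.1 (⟨π', hπ'⟩ : R.glsPaths lam).1 from he)
    rw [h i] at this
    exact absurd this (by simp)
  · rintro rfl i
    rw [Option.eq_none_iff_forall_ne_some]
    intro b' he
    have h1 := map_one_of_eRel hA hlam (straightPath_mem hA lam) b'.2 (glsCrystal_e_eq_some.1 he)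
    obtain ⟨s, v, a, h⟩ := exists_pathData_of_mem b'.2
    have h2 := posRootLattice_le_posCone (h.sub_map_one_mem hA)
    have h3 : straightPath lam 1 = lam := one_smul ℚ lam
    rw [h1, h3, sub_add_cancel_left] at h2
    exact root_ne_zero i (eq_zero_of_neg_mem (R.root_mem_posCone i) h2)

/-- Every path is reached from `π_λ`: the operators `e_i` lower the height of `λ - π(1)`. -/
theorem reflTransGen_glsCrystal_f (hA : IsBorcherdsCartan A) (hlam : lam ∈ R.dominantWeights)
    (b : R.glsPaths lam) : ReflTransGen (fun y z => ∃ i, (R.glsCrystal lam).f i y = some z)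
      ⟨straightPath lam, straightPath_mem hA lam⟩ b := by
  have hnat : ∀ b : R.glsPaths lam, ∃ n : ℕ, R.height (lam - b.1 1) = n := fun b => by
    obtain ⟨s, v, a, h⟩ := exists_pathData_of_mem b.2
    exact exists_nat_height (h.sub_map_one_mem hA)
  have hdrop : ∀ b : R.glsPaths lam, b ≠ ⟨straightPath lam, straightPath_mem hA lam⟩ →
      ∃ i b', (R.glsCrystal lam).f i b' = some b ∧
        R.height (lam - b'.1 1) = R.height (lam - b.1 1) - 1 := by
    intro b hb
    obtain ⟨i, π', he, hπ'⟩ := exists_eRel_mem hA hlam b.2 fun e => hb (Subtype.ext e)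
    refine ⟨i, ⟨π', hπ'⟩, glsCrystal_f_eq_some.2 ((eRel_iff_fRel hA hlam b.2 hπ').1 he), ?_⟩
    change R.height (lam - π' 1) = _
    rw [map_one_of_eRel hA hlam b.2 hπ' he, ← sub_sub, map_sub, height_root]
  obtain ⟨n, hn⟩ := hnat b
  induction n generalizing b with
  | zero =>
    by_cases hb : b = ⟨straightPath lam, straightPath_mem hA lam⟩
    · rw [hb]
    obtain ⟨-, b', -, hb'⟩ := hdrop b hb
    obtain ⟨m, hm⟩ := hnat b'
    have : (0 : ℚ) ≤ m := m.cast_nonneg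
    push_cast at hn
    linarith
  | succ n ih =>
    by_cases hb : b = ⟨straightPath lam, straightPath_mem hA lam⟩
    · rw [hb]
    obtain ⟨i, b', hf, hb'⟩ := hdrop b hb
    refine .tail (ih b' ?_) ⟨i, hf⟩
    rw [hb', hn]
    push_cast
    ring

theorem glsPaths_eq_generatedBy (hA : IsBorcherdsCartan A) (hlam : lam ∈ R.dominantWeights) :
    R.glsPaths lam = generatedBy R.f (straightPath lam) := by
  refine Set.Subset.antisymm (fun π hπ => ?_) fun π hπ => ?_
  · refine ReflTransGen.lift Subtype.val ?_ _ _ (reflTransGen_glsCrystal_f hA hlam ⟨π, hπ⟩)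
    rintro b b' ⟨i, hf⟩
    exact ⟨i, truncate_eq_some_iff.1 hf⟩
  · induction hπ with
    | refl => exact straightPath_mem hA lam
    | tail _ hf ih =>
      obtain ⟨i, hf⟩ := hf
      exact FRel.mem_glsPaths hA hlam ih (R.f_eq_some_iff.1 hf)

end Crystal

end Realization
end BorcherdsPath

theorem mainTheorem5 {I : Type*} [Countable I] {A : Matrix I I ℤ}
    (hA : BorcherdsPath.IsBorcherdsCartan A)
    {𝔥 : Type*} [AddCommGroup 𝔥] [Module ℚ 𝔥] (R : BorcherdsPath.Realization A 𝔥)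
    (lam : Module.Dual ℚ 𝔥) (hlam : lam ∈ R.dominantWeights) :
    (∃ hmem : BorcherdsPath.straightPath lam ∈ R.glsPaths lam,
      (∀ π : R.glsPaths lam, (∀ i, (R.glsCrystal lam).e i π = none) ↔
        π = ⟨BorcherdsPath.straightPath lam, hmem⟩) ∧
      (R.glsCrystal lam).IsHighestWeight lam ⟨BorcherdsPath.straightPath lam, hmem⟩) ∧
    R.glsPaths lam = BorcherdsPath.generatedBy R.f (BorcherdsPath.straightPath lam) := by
  refine ⟨⟨BorcherdsPath.Realization.straightPath_mem hA lam,
    BorcherdsPath.Realization.glsCrystal_e_eq_none_iff hA hlam,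
    BorcherdsPath.Realization.glsCrystal_isCrystal hA hlam, one_smul ℚ lam, ?_⟩,
    BorcherdsPath.Realization.glsPaths_eq_generatedBy hA hlam⟩
  exact Set.eq_univ_of_forall (BorcherdsPath.Realization.reflTransGen_glsCrystal_f hA hlam)
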